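/- Let $\Sigma$ and $\widehat\Sigma$ be connected Riemann surfaces and let $X\colon\Sigma\to\mathbf R^4$ and $\widehat X\colon\widehat\Sigma\to\mathbf R^4$ be two nonflat minimal surfaces (the Gaussian curvature of the induced metric does not vanish identically), where the complex structure of the domain is the one given by the positive isothermal coordinates $z=u+\sqrt{-1}\,v$ of the induced metric. The Gauss map $G=(g_1,g_2)\colon\Sigma\to\overline{\mathbf C}\times\overline{\mathbf C}$, $\overline{\mathbf C}=\mathbf C\cup\{\infty\}$, of $X=(x^1,\dots,x^4)$ is the oriented tangent plane $[\phi_1:\phi_2:\phi_3:\phi_4]$, $\phi_i=\partial x^i\,dz$, regarded as a point of the quadric $\{(w^1)^2+\cdots+(w^4)^2=0\}\subset\mathbf P^3(\mathbf C)$, under the identification of this quadric with $\overline{\mathbf C}\times\overline{\mathbf C}$ given by $$g_1=\frac{\phi_3+\sqrt{-1}\,\phi_4}{\phi_1-\sqrt{-1}\,\phi_2}=\frac{\phi_1+\sqrt{-1}\,\phi_2}{-\phi_3+\sqrt{-1}\,\phi_4},\qquad g_2=\frac{-\phi_3+\sqrt{-1}\,\phi_4}{\phi_1-\sqrt{-1}\,\phi_2}=\frac{\phi_1+\sqrt{-1}\,\phi_2}{\phi_3+\sqrt{-1}\,\phi_4}$$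 (if one of the two quotients reads $0/0$, the other is used); let $\widehat G=(\hat g_1,\hat g_2)$ be the Gauss map of $\widehat X$. Assume that there is an orientation-preserving conformal diffeomorphism (that is, a biholomorphic map) $\Psi\colon\Sigma\to\widehat\Sigma$ and that at least one of the two induced metrics is complete. Two maps $f,\hat f$ to $\overline{\mathbf C}$ are said to share the value $\alpha$ if $f^{-1}(\alpha)=\hat f^{-1}(\alpha)$ (ignoring multiplicity). (i) Assume that $g_1,g_2,\hat g_1,\hat g_2$ are nonconstant and that, for each $i=1,2$, $g_i$ and $\hat g_i\circ\Psi$ share $p_i>4$ distinct values. If $g_1\not\equiv\hat g_1\circ\Psi$ and $g_2\not\equiv\hat g_2\circ\Psi$, then $$\frac1{p_1-4}+\frac1{p_2-4}\ge 1.$$ In particular, if $p_1\ge 7$ and $p_2\ge 7$, then $g_1\equiv\hat g_1\circ\Psi$ or $g_2\equiv\hat g_2\circ\Psi$ (or both). (ii) Assume that $g_1,\hat g_1$ are nonconstant, that $g_1$ and $\hat g_1\circ\Psi$ share $p$ distinct values, and that $g_2\equiv\hat g_2\circ\Psi$ is constant. If $g_1\not\equiv\hat g_1\circ\Psi$, then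 $p\le 5$. In particular, if $p\ge 6$, then $G\equiv\widehat G\circ\Psi$. -/

import Mathlib

open scoped Manifold ContDiff

noncomputable section

namespace MinimalSurface

/-- Euclidean four-space. -/
abbrev E4 : Type := EuclideanSpace ℝ (Fin 4)

section Surface

variable {S : Type*} [TopologicalSpace S] [ChartedSpace ℂ S]

/-- `X` written in the local complex coordinate `z = u + i v` given by the chart `e`. -/
def inChart (X : S → E4) (e : OpenPartialHomeomorph S ℂ) : ℂ → E4 :=
  fun z => X (e.symm z)

/-- The vector `X_u` at the point with coordinate `z`. -/
def partialU (X : S → E4) (e : OpenPartialHomeomorph S ℂ) (z : ℂ) : E4 :=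
  fderiv ℝ (inChart X e) z 1

/-- The vector `X_v` at the point with coordinate `z`. -/
def partialV (X : S → E4) (e : OpenPartialHomeomorph S ℂ) (z : ℂ) : E4 :=
  fderiv ℝ (inChart X e) z Complex.I

/-- The tangent plane of the surface (the span of `X_u` and `X_v`), as a subspace of `E4`. -/
def tangentPlane (X : S → E4) (e : OpenPartialHomeomorph S ℂ) (z : ℂ) : Submodule ℝ E4 :=
  Submodule.span ℝ {partialU X e z, partialV X e z}

/-- The mean curvature vector (half the trace of the second fundamental form) of a surface in
isothermal coordinates `z = u + i v`, where the induced metric is `|X_u|² (du² + dv²)`: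
`H = (X_uu + X_vv)^⊥ / (2 |X_u|²)`, with `⊥` the projection to the normal plane. -/
def meanCurvature (X : S → E4) (e : OpenPartialHomeomorph S ℂ) (z : ℂ) : E4 :=
  (2 * ‖partialU X e z‖ ^ 2)⁻¹ •
    (Submodule.orthogonal (tangentPlane X e z)).starProjection (Laplacian.laplacian (inChart X e) z)

/-- The Gaussian curvature of the induced metric `|X_u|² (du² + dv²)` in isothermal coordinates:
`K = - Δ (log |X_u|) / |X_u|²`. -/
def gaussCurvature (X : S → E4) (e : OpenPartialHomeomorph S ℂ) (z : ℂ) : ℝ :=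
  -(Laplacian.laplacian (fun w => Real.log ‖partialU X e w‖) z) / ‖partialU X e z‖ ^ 2

/-- `X` is a minimal surface in `E4` whose domain, a Riemann surface, carries the conformal
structure of the induced metric: `X` is smooth, it is an immersion for which the complex
coordinates of `S` are isothermal, and its mean curvature vanishes. -/
structure IsMinimalSurface (X : S → E4) : Prop where
  smooth : ContMDiff 𝓘(ℝ, ℂ) 𝓘(ℝ, E4) ∞ X
  conformal : ∀ e ∈ atlas ℂ S, ∀ z ∈ e.target, IsConformalMap (fderiv ℝ (inChart X e) z)
  minimal : ∀ e ∈ atlas ℂ S, ∀ z ∈ e.target, meanCurvature X e z = 0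

/-- The induced metric is flat. -/
def IsFlat (X : S → E4) : Prop :=
  ∀ e ∈ atlas ℂ S, ∀ z ∈ e.target, gaussCurvature X e z = 0

/-- Completeness of the induced metric: every `C¹` curve `γ : [0, 1) → S` that eventually leaves
every compact subset of `S` has infinite length, the length in the induced metric being the length
of `X ∘ γ` in `E4`. -/
def IsCompleteSurface (X : S → E4) : Prop :=
  ∀ γ : ℝ → S, ContMDiffOn 𝓘(ℝ, ℝ) 𝓘(ℝ, ℂ) 1 γ (Set.Ico 0 1) →
    Filter.Tendsto γ (nhdsWithin 1 (Set.Iio 1)) (Filter.cocompact S) →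
    ∫⁻ t in Set.Ioo (0 : ℝ) 1, ‖deriv (fun s => X (γ s)) t‖ₑ = ⊤

/-- The point `a / b` of the Riemann sphere, for `(a, b) ≠ (0, 0)`. -/
def ratio (a b : ℂ) : OnePoint ℂ :=
  open Classical in if b = 0 then OnePoint.infty else ((a / b : ℂ) : OnePoint ℂ)

/-- The identification of the quadric `w₁² + w₂² + w₃² + w₄² = 0` in the complex projective
three-space (here given by homogeneous coordinates `w ≠ 0`, indexed from `0`) with the product of
two Riemann spheres,
`w ↦ ((w₃ + i w₄) / (w₁ - i w₂), (- w₃ + i w₄) / (w₁ - i w₂))`.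
On the quadric `(w₁ - i w₂) (w₁ + i w₂) = (w₃ + i w₄) (- w₃ + i w₄)`, so that the two quotients are
also `(w₁ + i w₂) / (- w₃ + i w₄)` and `(w₁ + i w₂) / (w₃ + i w₄)`; these are used where the first
form reads `0 / 0`. -/
def quadricToSpheres (w : Fin 4 → ℂ) : OnePoint ℂ × OnePoint ℂ :=
  open Classical in
  (if w 0 - Complex.I * w 1 = 0 ∧ w 2 + Complex.I * w 3 = 0
      then ratio (w 0 + Complex.I * w 1) (-w 2 + Complex.I * w 3)
      else ratio (w 2 + Complex.I * w 3) (w 0 - Complex.I * w 1),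
    if w 0 - Complex.I * w 1 = 0 ∧ -w 2 + Complex.I * w 3 = 0
      then ratio (w 0 + Complex.I * w 1) (w 2 + Complex.I * w 3)
      else ratio (-w 2 + Complex.I * w 3) (w 0 - Complex.I * w 1))

/-- The coefficients `∂xⁱ/∂z = (xⁱ_u - i xⁱ_v) / 2` of the forms `φᵢ = ∂xⁱ dz`. -/
def phi (X : S → E4) (e : OpenPartialHomeomorph S ℂ) (z : ℂ) : Fin 4 → ℂ :=
  fun i => ((partialU X e z i : ℂ) - Complex.I * (partialV X e z i : ℂ)) / 2

/-- The Gauss map `G = (g₁, g₂)`: the oriented tangent plane at `p`, as the point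
`[φ₁ : φ₂ : φ₃ : φ₄]` of the quadric, under its identification with a product of two spheres.
(A change of the coordinate multiplies `φ` by a nonzero factor, which does not matter.) -/
def gaussMap (X : S → E4) (p : S) : OnePoint ℂ × OnePoint ℂ :=
  quadricToSpheres (phi X (chartAt ℂ p) (chartAt ℂ p p))

/-- The first component `g₁` of the Gauss map. -/
def gauss₁ (X : S → E4) (p : S) : OnePoint ℂ := (gaussMap X p).1

/-- The second component `g₂` of the Gauss map. -/
def gauss₂ (X : S → E4) (p : S) : OnePoint ℂ := (gaussMap X p).2

end Surface

/-- The function `f` is constant. -/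
def IsConst {A B : Type*} (f : A → B) : Prop := ∃ c, ∀ a, f a = c

/-- `f` and `f'` share `p` distinct values, ignoring multiplicity. -/
def ShareValues {A : Type*} (f f' : A → OnePoint ℂ) (p : ℕ) : Prop :=
  ∃ V : Finset (OnePoint ℂ), V.card = p ∧ ∀ α ∈ V, f ⁻¹' {α} = f' ⁻¹' {α}

end MinimalSurface

end

/-!
# Gauss maps of two minimal surfaces that share values

Let `g₁, g₂` be the components of the Gauss map of `X`, let `ds` be the metric induced by `X`, and
let `h₁, h₂` be the components of the Gauss map of the second surface, transported to the domain of
`X`. By symmetry `X` may be assumed to be complete. In a local coordinate `gᵢ` has homogeneous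
coordinates `aᵢ` in `ℂ² \ {0}`, and these can be chosen such that `ds = |a₁| |a₂| |dz|`
(`IsMinimalSurface.hasLiftPairs`). This is the only property of minimal surfaces that is used.

Let `g ≠ h` share `n > 4` values, let `4 < Q < n`, and let `k_g` and `k_h` be the spherical
derivatives of the two maps, multiplied with negative powers of the chordal distances to the shared
values, the exponent being `Q / n`. The product of the chordal distance of `g` and `h` with
`k_g^α k_h^β`, `α + β = 1`, is the density of a pseudometric with zeros: where `g` and `h` take a
shared value, the zero of the chordal distance outweighs the poles of `k_g` and `k_h`
(`flatLog_le_of_mem`). For the asymmetric choice `β = 1 / (Q - 2)` the coordinates of `h` drop out of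
the curvature, and the density is `|a|^(Q - 4)` up to the modulus of a holomorphic function, where
`a` are the coordinates of `g`. A slightly larger density, with a larger exponent in the weights
and a bounded correction factor, has curvature bounded above by a negative constant, because the
Laplacians of small powers of the chordal distances are large near the shared values
(`exists_curvLog_hasLap`). Both densities are the content of `exists_isBlock`.

Now let `Qᵢ - 4` be such numbers for the pairs `gᵢ, hᵢ`, and suppose that
`p = 1 / (Q₁ - 4) + 1 / (Q₂ - 4) < 1`. The geometric mean `τ` of the two densities, with weights
proportional to `1 / (Qᵢ - 4)`, satisfies `τ^p = |F| ds` with holomorphic `F` (`IsBlock.combine`; if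
`g₂` and `h₂` are the same constant, then `a₂` contributes a holomorphic factor only, and
`p = 1 / (Q₁ - 4)` will do, see `IsBlock.single`). Hence the metric `σ` with `ds = σ^(1 - p) τ^p` is
flat, and if `p` is close to one, it grows at the zeros of `τ` at least like `|dz| / |z|`, so that
these zeros are infinitely far away. Since `τ` is at most the geometric mean of the negatively curved
densities, the length of `ds` can be estimated in terms of `σ` and these densities.

The contradiction to completeness comes from a maximal disc in the surface that is isometric to a
Euclidean disc for the metric `σ` (`IsFlatPair.not_isCompleteSurface`). By the Ahlfors–Schwarz
lemma, the negatively curved density on this disc is bounded by the Poincaré density, so its radius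
is finite, and `ds` is bounded by the `p`-th power of the Poincaré density. As `p < 1`, the radii of
the disc have finite length for `ds`. By completeness they cannot diverge, they do not accumulate at
zeros of `τ`, and so the disc extends across each boundary point, which is absurd.
-/

noncomputable section

namespace MinimalSurface

open Filter Topology Complex ComplexConjugate
open InnerProductSpace (HarmonicAt)

/-! ### Laplacians of functions of a complex variable -/

/-- The real linear form `h ↦ Re (g h)`. -/
def reMul (g : ℂ) : ℂ →L[ℝ] ℝ := Complex.reCLM.comp (ContinuousLinearMap.mul ℝ ℂ g)

@[simp] lemma reMul_apply (g h : ℂ) : reMul g h = (g * h).re := by simp [reMul]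

/-- `G = u_x - i u_y` is the complex gradient of `u` near `z`, it is differentiable at `z`, and
the Laplacian of `u` at `z`, which is the real part of `G_x + i G_y`, is `L`. -/
def HasLap (u : ℂ → ℝ) (G : ℂ → ℂ) (z : ℂ) (L : ℝ) : Prop :=
  (∀ᶠ w in 𝓝 z, HasFDerivAt u (reMul (G w)) w) ∧
    ∃ G' : ℂ →L[ℝ] ℂ, HasFDerivAt G G' z ∧ (G' 1 + I * G' I).re = L

lemma hasFDerivAt_real {f : ℂ → ℂ} {z : ℂ} (hf : AnalyticAt ℂ f z) :
    HasFDerivAt f ((deriv f z) • (1 : ℂ →L[ℝ] ℂ)) z :=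
  (hf.differentiableAt.hasDerivAt.hasFDerivAt.restrictScalars ℝ).congr_fderiv
    (by ext; simp; ring)

namespace HasLap

variable {u v : ℂ → ℝ} {G H : ℂ → ℂ} {z : ℂ} {L M : ℝ}

lemma continuousAt (h : HasLap u G z L) : ContinuousAt u z :=
  h.1.self_of_nhds.continuousAt

lemma congr (h : HasLap u G z L) (huv : u =ᶠ[𝓝 z] v) : HasLap v G z L := by
  refine ⟨?_, h.2⟩
  filter_upwards [h.1, huv.eventuallyEq_nhds] with w hw hw'
  exact hw.congr_of_eventuallyEq hw'.symm

lemma congr_lap (h : HasLap u G z L) (hLM : L = M) : HasLap u G z M := hLM ▸ h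

lemma add (h : HasLap u G z L) (k : HasLap v H z M) :
    HasLap (fun w => u w + v w) (fun w => G w + H w) z (L + M) := by
  obtain ⟨h1, G', hG, hL⟩ := h
  obtain ⟨k1, H', hH, hM⟩ := k
  refine ⟨?_, G' + H', hG.add hH, ?_⟩
  · filter_upwards [h1, k1] with w hw kw
    exact (hw.add kw).congr_fderiv (by ext; simp; ring)
  · rw [← hL, ← hM]; simp; ring

lemma const (c : ℝ) : HasLap (fun _ => c) (fun _ => 0) z 0 := by
  refine ⟨Eventually.of_forall fun w => ?_, 0, hasFDerivAt_const _ _, by simp⟩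
  exact (hasFDerivAt_const c w).congr_fderiv (by ext; simp)

lemma const_mul (c : ℝ) (h : HasLap u G z L) :
    HasLap (fun w => c * u w) (fun w => c * G w) z (c * L) := by
  obtain ⟨h1, G', hG, hL⟩ := h
  refine ⟨?_, (c : ℂ) • G', hG.const_mul (c : ℂ), ?_⟩
  · filter_upwards [h1] with w hw
    exact (hw.const_mul c).congr_fderiv (by ext; simp; ring)
  · rw [← hL]; simp; ring

lemma sum {ι : Type*} (s : Finset ι) {u : ι → ℂ → ℝ} {G : ι → ℂ → ℂ} {L : ι → ℝ}
    (h : ∀ i ∈ s, HasLap (u i) (G i) z (L i)) :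
    HasLap (fun w => ∑ i ∈ s, u i w) (fun w => ∑ i ∈ s, G i w) z (∑ i ∈ s, L i) := by
  classical
  induction s using Finset.induction_on with
  | empty => simpa using const (z := z) 0
  | insert a s ha ih =>
    simp only [Finset.sum_insert ha]
    exact (h a (by simp)).add (ih fun i hi => h i (by simp [hi]))

lemma exp (h : HasLap u G z L) :
    HasLap (fun w => Real.exp (u w)) (fun w => (Real.exp (u w) : ℝ) * G w) z
      (Real.exp (u z) * (L + ‖G z‖ ^ 2)) := by
  obtain ⟨h1, G', hG, hL⟩ := h
  have hu := h1.self_of_nhds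
  refine ⟨?_, _, (Complex.ofRealCLM.hasFDerivAt.comp z hu.exp).mul hG, ?_⟩
  · filter_upwards [h1] with w hw
    exact hw.exp.congr_fderiv (by ext; simp [-Complex.ofReal_exp]; ring)
  · rw [← hL, ← Complex.normSq_eq_norm_sq, Complex.normSq_apply]
    simp [-Complex.ofReal_exp]
    ring

lemma log (h : HasLap u G z L) (hz : u z ≠ 0) :
    HasLap (fun w => Real.log (u w)) (fun w => ((u w)⁻¹ : ℝ) * G w) z
      (L / u z - ‖G z‖ ^ 2 / u z ^ 2) := by
  have hc := h.continuousAt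
  obtain ⟨h1, G', hG, hL⟩ := h
  have hu := h1.self_of_nhds
  have hinv : HasFDerivAt (fun w => (u w)⁻¹) (-(u z ^ 2)⁻¹ • reMul (G z)) z :=
    (hasDerivAt_inv hz).comp_hasFDerivAt z hu
  refine ⟨?_, _, (Complex.ofRealCLM.hasFDerivAt.comp z hinv).mul hG, ?_⟩
  · filter_upwards [h1, hc.eventually_ne hz] with w hw hw0
    exact (hw.log hw0).congr_fderiv (by ext; simp [-Complex.ofReal_inv]; ring)
  · rw [← hL, ← Complex.normSq_eq_norm_sq, Complex.normSq_apply]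
    simp [-Complex.ofReal_inv, -Complex.ofReal_pow]
    field_simp
    ring

lemma normSq {f : ℂ → ℂ} (hf : AnalyticAt ℂ f z) :
    HasLap (fun w => ‖f w‖ ^ 2) (fun w => 2 * (deriv f w * conj (f w))) z
      (4 * ‖deriv f z‖ ^ 2) := by
  have hd : ∀ᶠ w in 𝓝 z, HasFDerivAt f ((deriv f w) • (1 : ℂ →L[ℝ] ℂ)) w := by
    filter_upwards [hf.eventually_analyticAt] with w hw using hasFDerivAt_real hw
  have hd2 : HasFDerivAt (deriv f) ((deriv (deriv f) z) • (1 : ℂ →L[ℝ] ℂ)) z  :=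
    hasFDerivAt_real hf.deriv
  have hz := hd.self_of_nhds
  have hcz := Complex.conjCLE.toContinuousLinearMap.hasFDerivAt.comp z hz
  refine ⟨?_, _, (hd2.mul hcz).const_mul 2, ?_⟩
  · filter_upwards [hd] with w hw
    exact hw.norm_sq.congr_fderiv (by ext; simp; ring)
  · rw [← Complex.normSq_eq_norm_sq, Complex.normSq_apply]
    simp
    ring

lemma re {F : ℂ → ℂ} (hF : AnalyticAt ℂ F z) :
    HasLap (fun w => (F w).re) (deriv F) z 0 := by
  refine ⟨?_, (deriv (deriv F) z) • (1 : ℂ →L[ℝ] ℂ), hasFDerivAt_real hF.deriv, ?_⟩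
  · filter_upwards [hF.eventually_analyticAt] with w hw
    exact (Complex.reCLM.hasFDerivAt.comp w (hasFDerivAt_real hw)).congr_fderiv
      (by ext; simp)
  · simp

/-- The Laplacian of `u ∘ f` for holomorphic `f` is `|f'|²` times that of `u`. -/
lemma comp_analytic {f : ℂ → ℂ} (h : HasLap u G (f z) L) (hf : AnalyticAt ℂ f z) :
    HasLap (fun w => u (f w)) (fun w => G (f w) * deriv f w) z (‖deriv f z‖ ^ 2 * L) := by
  obtain ⟨h1, G', hG, hL⟩ := h
  have hd : ∀ᶠ w in 𝓝 z, HasFDerivAt f ((deriv f w) • (1 : ℂ →L[ℝ] ℂ)) w := by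
    filter_upwards [hf.eventually_analyticAt] with w hw using hasFDerivAt_real hw
  have hd2 : HasFDerivAt (deriv f) ((deriv (deriv f) z) • (1 : ℂ →L[ℝ] ℂ)) z  :=
    hasFDerivAt_real hf.deriv
  refine ⟨?_, _, (hG.comp z hd.self_of_nhds).mul hd2, ?_⟩
  · filter_upwards [hd, hf.continuousAt.eventually h1] with w hw hw1
    exact (hw1.comp w hw).congr_fderiv (by ext; simp; ring)
  · have key : ∀ c : ℂ, G' c = c.re • G' 1 + c.im • G' I := fun c => by
      rw [← map_smul, ← map_smul, ← map_add]; congr 1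
      apply Complex.ext <;> simp
    rw [← hL, ← Complex.normSq_eq_norm_sq, Complex.normSq_apply]
    simp
    rw [key (deriv f z), key (deriv f z * I)]
    simp
    ring

/-- At a local maximum the Laplacian is nonpositive. -/
lemma nonpos_of_isLocalMax (h : HasLap u G z L) (hmax : IsLocalMax u z) : L ≤ 0 := by
  obtain ⟨h1, G', hG, hL⟩ := h
  have key : ∀ ξ : ℂ, (G' ξ * ξ).re ≤ 0 := by
    intro ξ
    by_contra! hpos
    set φ : ℝ → ℝ := fun t => u (z + t * ξ) with hφ
    have hline : ∀ t : ℝ, HasDerivAt (fun t : ℝ => z + (t : ℂ) * ξ) ξ t := fun t => by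
      simpa using (((hasDerivAt_id t).ofReal_comp).mul_const ξ).const_add z
    have hlc : Tendsto (fun t : ℝ => z + (t : ℂ) * ξ) (𝓝 0) (𝓝 z) := by
      have := (hline 0).continuousAt.tendsto
      simpa using this
    have hd1 : ∀ᶠ t : ℝ in 𝓝 0, HasDerivAt φ (G (z + t * ξ) * ξ).re t := by
      filter_upwards [hlc.eventually h1] with t ht
      exact ht.comp_hasDerivAt t (hline t)
    have hd2 : HasDerivAt (fun t : ℝ => (G (z + t * ξ) * ξ).re) (G' ξ * ξ).re 0 := by
      have hG0 : HasFDerivAt G G' (z + ((0 : ℝ) : ℂ) * ξ) := by simpa using hG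
      have := (hG0.comp_hasDerivAt (0 : ℝ) (hline 0)).mul_const ξ
      exact Complex.reCLM.hasFDerivAt.comp_hasDerivAt (0 : ℝ) this
    have hmaxφ : IsLocalMax φ 0 := by
      have := hlc.eventually hmax
      filter_upwards [this] with t ht
      simpa [hφ] using ht
    have hder : deriv φ =ᶠ[𝓝 0] fun t : ℝ => (G (z + t * ξ) * ξ).re := by
      filter_upwards [hd1] with t ht using ht.deriv
    have hdd : deriv (deriv φ) 0 = (G' ξ * ξ).re := by
      rw [hder.deriv_eq, hd2.deriv]
    have hmin := isLocalMin_of_deriv_deriv_pos (hdd ▸ hpos) hmaxφ.deriv_eq_zero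
      hd1.self_of_nhds.continuousAt
    have hconst : φ =ᶠ[𝓝 0] fun _ => φ 0 := by
      filter_upwards [hmin, hmaxφ] with t h1 h2 using le_antisymm h2 h1
    have h0 : deriv φ =ᶠ[𝓝 0] fun _ => 0 := by
      filter_upwards [hconst.eventuallyEq_nhds] with t ht
      rw [ht.deriv_eq]; simp
    rw [h0.deriv_eq] at hdd
    simp at hdd
    simp [← hdd] at hpos
  have h1 := key 1
  have h2 := key I
  rw [← hL]
  simp at h1 h2 ⊢
  linarith

end HasLap

/-- The Ahlfors–Schwarz lemma: if `Δ u ≥ c e^{2u}` on the disc of radius `R` about the origin, then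
`e^u` is at most `c^{-1/2}` times the Poincaré density of this disc. -/
lemma ahlfors_schwarz {u : ℂ → ℝ} {c R : ℝ} (hc : 0 < c)
    (hu : ∀ z ∈ Metric.ball (0 : ℂ) R, ∃ G L, HasLap u G z L ∧ c * Real.exp (2 * u z) ≤ L)
    {w : ℂ} (hw : w ∈ Metric.ball (0 : ℂ) R) :
    Real.exp (u w) ≤ (Real.sqrt c)⁻¹ * (2 * R / (R ^ 2 - ‖w‖ ^ 2)) := by
  have hwR : ‖w‖ < R := by simpa using hw
  have main : ∀ r, ‖w‖ < r → r < R →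
      (r ^ 2 - ‖w‖ ^ 2) * Real.exp (u w) ≤ (Real.sqrt c)⁻¹ * (2 * r) := by
    intro r hr hrR
    have hr0 : 0 < r := (norm_nonneg w).trans_lt hr
    have hsub : Metric.closedBall (0 : ℂ) r ⊆ Metric.ball 0 R :=
      Metric.closedBall_subset_ball hrR
    have hcont : ContinuousOn (fun z : ℂ => (r ^ 2 - ‖z‖ ^ 2) * Real.exp (u z))
        (Metric.closedBall 0 r) := by
      intro z hz
      obtain ⟨G, L, h, -⟩ := hu z (hsub hz)
      have := h.continuousAt
      exact ContinuousAt.continuousWithinAt (by fun_prop)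
    obtain ⟨z, hz, hmax⟩ := (isCompact_closedBall (0 : ℂ) r).exists_isMaxOn
      ⟨w, by simpa using hr.le⟩ hcont
    have hwz := hmax (show w ∈ Metric.closedBall (0 : ℂ) r by simpa using hr.le)
    simp only [Set.mem_ofPred_eq] at hwz
    refine hwz.trans ?_
    have hwpos : 0 < (r ^ 2 - ‖w‖ ^ 2) * Real.exp (u w) := by
      have : ‖w‖ ^ 2 < r ^ 2 := by gcongr
      have := Real.exp_pos (u w)
      exact mul_pos (by linarith) this
    have hzpos : 0 < r ^ 2 - ‖z‖ ^ 2 := by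
      by_contra! hcon
      have := mul_nonpos_of_nonpos_of_nonneg hcon (Real.exp_pos (u z)).le
      linarith
    have hzr : ‖z‖ < r := by
      by_contra! hcon
      have : r ^ 2 ≤ ‖z‖ ^ 2 := by gcongr
      linarith
    obtain ⟨G, L, hL, hcL⟩ := hu z (hsub hz)
    have hlog : HasLap (fun w : ℂ => Real.log (r ^ 2 + (-1) * ‖w‖ ^ 2)) _ z _ :=
      ((HasLap.const (r ^ 2)).add ((HasLap.normSq analyticAt_id).const_mul (-1))).log
        (by simp only [id]; linarith)
    have hlap := hL.add hlog
    have hlm : IsLocalMax (fun w => u w + Real.log (r ^ 2 + (-1) * ‖w‖ ^ 2)) z := by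
      filter_upwards [Metric.isOpen_ball.mem_nhds (show z ∈ Metric.ball (0 : ℂ) r by simpa using hzr)]
        with y hy
      have hyr : ‖y‖ < r := by simpa using hy
      have hypos : 0 < r ^ 2 - ‖y‖ ^ 2 := by
        have : ‖y‖ ^ 2 < r ^ 2 := by gcongr
        linarith
      have h := hmax (show y ∈ Metric.closedBall (0 : ℂ) r by simpa using hyr.le)
      simp only [Set.mem_ofPred_eq] at h
      have := Real.log_le_log (mul_pos hypos (Real.exp_pos _)) h
      rw [Real.log_mul hypos.ne' (Real.exp_pos _).ne', Real.log_mul hzpos.ne' (Real.exp_pos _).ne',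
        Real.log_exp, Real.log_exp] at this
      have e1 : r ^ 2 + (-1) * ‖y‖ ^ 2 = r ^ 2 - ‖y‖ ^ 2 := by ring
      have e2 : r ^ 2 + (-1) * ‖z‖ ^ 2 = r ^ 2 - ‖z‖ ^ 2 := by ring
      simp only [e1, e2]
      linarith
    have hle := hlap.nonpos_of_isLocalMax hlm
    set d := r ^ 2 - ‖z‖ ^ 2 with hd
    have hdz : r ^ 2 + -1 * ‖z‖ ^ 2 = d := by rw [hd]; ring
    have hLd : L ≤ 4 * r ^ 2 / d ^ 2 := by
      simp at hle
      have e : r ^ 2 + -‖z‖ ^ 2 = d := by rw [hd]; ring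
      rw [e] at hle
      have : 4 * r ^ 2 / d ^ 2 = 4 / d + (2 * ‖z‖) ^ 2 / d ^ 2 := by
        have : r ^ 2 = d + ‖z‖ ^ 2 := by rw [hd]; ring
        rw [this]; field_simp; ring
      rw [this]
      have e2 : -4 / d = -(4 / d) := by ring
      linarith
    have hsq : (d * Real.exp (u z)) ^ 2 ≤ ((Real.sqrt c)⁻¹ * (2 * r)) ^ 2 := by
      have h1 : c * Real.exp (2 * u z) ≤ 4 * r ^ 2 / d ^ 2 := hcL.trans hLd
      have h2 : Real.exp (2 * u z) = Real.exp (u z) ^ 2 := by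
        rw [← Real.exp_nat_mul]; norm_num
      rw [h2, le_div_iff₀ (by positivity)] at h1
      rw [mul_pow (Real.sqrt c)⁻¹, inv_pow, Real.sq_sqrt hc.le, inv_mul_eq_div,
        le_div_iff₀ hc]
      linarith
    exact le_of_sq_le_sq hsq (by positivity)
  have hR0 : 0 < R := (norm_nonneg w).trans_lt hwR
  have hpos : 0 < R ^ 2 - ‖w‖ ^ 2 := by
    have : ‖w‖ ^ 2 < R ^ 2 := by gcongr
    linarith
  have hlim : (R ^ 2 - ‖w‖ ^ 2) * Real.exp (u w) ≤ (Real.sqrt c)⁻¹ * (2 * R) := by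
    have t1 : Tendsto (fun r : ℝ => (r ^ 2 - ‖w‖ ^ 2) * Real.exp (u w)) (𝓝[<] R)
        (𝓝 ((R ^ 2 - ‖w‖ ^ 2) * Real.exp (u w))) :=
      (Continuous.tendsto (by fun_prop) R).mono_left nhdsWithin_le_nhds
    have t2 : Tendsto (fun r : ℝ => (Real.sqrt c)⁻¹ * (2 * r)) (𝓝[<] R)
        (𝓝 ((Real.sqrt c)⁻¹ * (2 * R))) :=
      (Continuous.tendsto (by fun_prop) R).mono_left nhdsWithin_le_nhds
    refine le_of_tendsto_of_tendsto t1 t2 ?_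
    filter_upwards [Ioo_mem_nhdsLT hwR] with r hr using main r hr.1 hr.2
  rw [mul_div_assoc', le_div_iff₀ hpos]
  linarith

/-! ### Holomorphic discs in a Riemann surface that are isometric for a flat metric -/

/-- The map `Y` is differentiable at `z` and its derivative stretches all lengths by the factor
`e^l`. -/
def ConfAt (Y : ℂ → E4) (l : ℝ) (z : ℂ) : Prop :=
  DifferentiableAt ℝ Y z ∧ ∀ h, ‖fderiv ℝ Y z h‖ = Real.exp l * ‖h‖

lemma ConfAt.congr {Y Y' : ℂ → E4} {l : ℝ} {z : ℂ} (h : ConfAt Y l z) (hY : Y =ᶠ[𝓝 z] Y') :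
    ConfAt Y' l z :=
  ⟨h.1.congr_of_eventuallyEq hY.symm, fun x => by rw [← hY.fderiv_eq, h.2]⟩

lemma ConfAt.comp {Y : ℂ → E4} {l m : ℝ} {z : ℂ} {f : ℂ → ℂ} (h : ConfAt Y l (f z))
    (hf : AnalyticAt ℂ f z) (hm : Real.exp l * ‖deriv f z‖ = Real.exp m) :
    ConfAt (Y ∘ f) m z := by
  have hd := h.1.hasFDerivAt.comp z (hasFDerivAt_real hf)
  refine ⟨hd.differentiableAt, fun x => ?_⟩
  rw [hd.fderiv]
  simp [h.2, ← hm, mul_assoc]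

/-- If `Y ∘ f` and `Y` are both conformal, their factors differ by the factor `|f'|`. -/
lemma ConfAt.exp_mul_norm_deriv {Y : ℂ → E4} {l m : ℝ} {z : ℂ} {f : ℂ → ℂ} (h : ConfAt Y l (f z))
    (hf : AnalyticAt ℂ f z) (hm : ConfAt (Y ∘ f) m z) :
    Real.exp l * ‖deriv f z‖ = Real.exp m := by
  have hd := h.1.hasFDerivAt.comp z (hasFDerivAt_real hf)
  have := hm.2 1
  rw [hd.fderiv] at this
  simpa [h.2] using this

/-- A complex function with nonzero derivative is locally invertible. -/
lemma exists_local_inverse {D : ℂ → ℂ} {z : ℂ} (hD : AnalyticAt ℂ D z) (h0 : deriv D z ≠ 0) :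
    ∃ R : OpenPartialHomeomorph ℂ ℂ, z ∈ R.source ∧ (R : ℂ → ℂ) = D := by
  let i : ℂ ≃L[ℂ] ℂ := .unitsEquivAut ℂ (.mk0 _ h0)
  have hfd : HasStrictFDerivAt D i.toContinuousLinearMap z := hD.hasStrictDerivAt
  exact ⟨hfd.toOpenPartialHomeomorph _, HasStrictFDerivAt.mem_toOpenPartialHomeomorph_source _,
    HasStrictFDerivAt.toOpenPartialHomeomorph_coe _⟩

section Surface

variable {S : Type*} [TopologicalSpace S] [ChartedSpace ℂ S]

/-- The map `Φ` into the complement of `E` is holomorphic at `w` and, there, a local isometry from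
the Euclidean metric to `e^{2s}` times the metric induced by `X`. -/
structure IsFlatAt (X : S → E4) (E : Set S) (s : S → ℝ) (Φ : ℂ → S) (w : ℂ) : Prop where
  hol : ContMDiffAt 𝓘(ℂ) 𝓘(ℂ) ω Φ w
  notMem : Φ w ∉ E
  conf : ConfAt (X ∘ Φ) (-s (Φ w)) w

/-- The functions `s` and `θ` describe, off the closed set `E`, the conformal metrics `σ = e^s ds`
and `e^θ σ`, where `ds` is induced by `X`: the metric `σ` is flat and at points of `E` it grows at
least like `|dz| / |z|`, whereas the curvature of `e^θ σ` is bounded above by `-c`. -/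
structure IsFlatPair (X : S → E4) (E : Set S) (s θ : S → ℝ) (c : ℝ) : Prop where
  regular : ∀ q ∉ E, ∃ (l : ℂ → ℝ) (F : ℂ → ℂ), AnalyticAt ℂ F (chartAt ℂ q q) ∧
    ∀ᶠ z in 𝓝 (chartAt ℂ q q), (chartAt ℂ q).symm z ∉ E ∧
      ConfAt (X ∘ (chartAt ℂ q).symm) (l z) z ∧
      l z + s ((chartAt ℂ q).symm z) = (F z).re ∧
      ∃ G L, HasLap (fun z => θ ((chartAt ℂ q).symm z)) G z L ∧
        c * Real.exp (2 * (θ ((chartAt ℂ q).symm z) + (F z).re)) ≤ L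
  singular : ∀ q ∈ E, ∃ (l : ℂ → ℝ) (C : ℝ), ∀ᶠ z in 𝓝 (chartAt ℂ q q),
      ConfAt (X ∘ (chartAt ℂ q).symm) (l z) z ∧
      ((chartAt ℂ q).symm z ∉ E →
        -Real.log ‖z - chartAt ℂ q q‖ - C ≤ l z + s ((chartAt ℂ q).symm z))

lemma comp_eventuallyEq_chart {A B : Type*} (Y : S → B) {l : Filter A} {Φ : A → S} {q : S}
    (h : ∀ᶠ w in l, Φ w ∈ (chartAt ℂ q).source) :
    Y ∘ Φ =ᶠ[l] (Y ∘ (chartAt ℂ q).symm) ∘ (chartAt ℂ q ∘ Φ) := by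
  filter_upwards [h] with w hw
  simp [hw]

variable {X : S → E4} {E : Set S} {s θ : S → ℝ} {c : ℝ}

lemma IsFlatAt.comp_affine {P : ℂ → S} {a u w₀ w : ℂ}
    (h : IsFlatAt X E s P (a + u * (w - w₀))) (hu : ‖u‖ = 1) :
    IsFlatAt X E s (fun w => P (a + u * (w - w₀))) w := by
  have hf : AnalyticAt ℂ (fun w => a + u * (w - w₀)) w := by fun_prop
  refine ⟨h.hol.comp w (contMDiffAt_iff_contDiffAt.2 hf.contDiffAt), h.notMem, ?_⟩
  refine ConfAt.comp (f := fun w => a + u * (w - w₀)) h.conf hf ?_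
  have : deriv (fun w => a + u * (w - w₀)) w = u := by simp
  rw [this, hu, mul_one]

variable [IsManifold 𝓘(ℂ) ω S]

lemma analyticAt_chart_comp {Φ : ℂ → S} {w : ℂ} (hΦ : ContMDiffAt 𝓘(ℂ) 𝓘(ℂ) ω Φ w) {q : S}
    (hq : Φ w ∈ (chartAt ℂ q).source) : AnalyticAt ℂ (chartAt ℂ q ∘ Φ) w := by
  have := ((contMDiffAt_iff_target_of_mem_source hq).1 hΦ).2
  rw [contMDiffAt_iff_contDiffAt] at this
  exact this.analyticAt

lemma contMDiffAt_chart_symm_comp {f : ℂ → ℂ} {w : ℂ} (hf : AnalyticAt ℂ f w) {q : S}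
    (hq : f w ∈ (chartAt ℂ q).target) :
    ContMDiffAt 𝓘(ℂ) 𝓘(ℂ) ω (fun w => (chartAt ℂ q).symm (f w)) w := by
  have h1 : ContMDiffAt 𝓘(ℂ) 𝓘(ℂ) ω (chartAt ℂ q).symm (f w) :=
    (contMDiffOn_chart_symm (I := 𝓘(ℂ)) (n := ω) (x := q)).contMDiffAt
      ((chartAt ℂ q).open_target.mem_nhds hq)
  exact h1.comp w (contMDiffAt_iff_contDiffAt.2 hf.contDiffAt)

/-- Two holomorphic maps that agree near one point of a connected open set agree on that set. -/
lemma eqOn_of_eventuallyEq [T2Space S] {Φ₁ Φ₂ : ℂ → S} {U : Set ℂ} (hU : IsPreconnected U)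
    (h₁ : ∀ w ∈ U, ContMDiffAt 𝓘(ℂ) 𝓘(ℂ) ω Φ₁ w) (h₂ : ∀ w ∈ U, ContMDiffAt 𝓘(ℂ) 𝓘(ℂ) ω Φ₂ w)
    {c : ℂ} (hc : c ∈ U) (h : Φ₁ =ᶠ[𝓝 c] Φ₂) : Set.EqOn Φ₁ Φ₂ U := by
  suffices hsub : U ⊆ {w | Φ₁ =ᶠ[𝓝 w] Φ₂} from fun w hw => (hsub hw).self_of_nhds
  refine hU.subset_of_closure_inter_subset (isOpen_setOfPred_eventually_nhds) ⟨c, hc, h⟩ ?_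
  rintro w ⟨hw, hwU⟩
  by_contra hcon
  have hfr : ∃ᶠ y in 𝓝[≠] w, Φ₁ y = Φ₂ y := by
    rw [frequently_nhdsWithin_iff]
    refine (mem_closure_iff_frequently.1 hw).mono fun y hy => ⟨EventuallyEq.eq_of_nhds hy, ?_⟩
    rintro rfl
    exact hcon hy
  have c₁ := (h₁ w hwU).continuousAt
  have c₂ := (h₂ w hwU).continuousAt
  have heq : Φ₁ w = Φ₂ w := tendsto_nhds_unique_of_frequently_eq
    (c₁.tendsto.mono_left nhdsWithin_le_nhds) (c₂.tendsto.mono_left nhdsWithin_le_nhds) hfr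
  have hs₁ : Φ₁ w ∈ (chartAt ℂ (Φ₁ w)).source := mem_chart_source _ _
  have hs₂ : Φ₂ w ∈ (chartAt ℂ (Φ₁ w)).source := heq ▸ hs₁
  have a₁ := analyticAt_chart_comp (h₁ w hwU) hs₁
  have a₂ := analyticAt_chart_comp (h₂ w hwU) hs₂
  have hev := (a₁.frequently_eq_iff_eventually_eq a₂).1 (hfr.mono fun y hy => by simp [hy])
  apply hcon
  filter_upwards [hev, c₁.eventually ((chartAt ℂ (Φ₁ w)).open_source.mem_nhds hs₁),
    c₂.eventually ((chartAt ℂ (Φ₁ w)).open_source.mem_nhds hs₂)] with y hy hy1 hy2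
  exact (chartAt ℂ (Φ₁ w)).injOn hy1 hy2 hy

/-- Off `E`, the flat metric is the Euclidean one in a local coordinate `D` with inverse `P`, and
in this coordinate flat maps are rigid motions. -/
lemma IsFlatPair.exists_flat_coordinate (H : IsFlatPair X E s θ c) {q : S} (hq : q ∉ E) :
    ∃ N ∈ 𝓝 q, ∃ r > 0, ∃ (D : S → ℂ) (P : ℂ → S),
      (∀ ζ ∈ Metric.ball (D q) (2 * r), IsFlatAt X E s P ζ) ∧
      (∀ x ∈ N, D x ∈ Metric.ball (D q) r) ∧ P (D q) = q ∧
      ∀ Φ : ℂ → S, ∀ w₀, (∀ᶠ w in 𝓝 w₀, IsFlatAt X E s Φ w) → Φ w₀ ∈ N →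
        ∃ u : ℂ, ‖u‖ = 1 ∧ ∀ᶠ w in 𝓝 w₀, Φ w = P (D (Φ w₀) + u * (w - w₀)) := by
  obtain ⟨l, F, hF, hev⟩ := H.regular q hq
  set e := chartAt ℂ q with he
  obtain ⟨ρ, hρ, hball⟩ := Metric.eventually_nhds_iff_ball.1
    (hev.and (hF.eventually_analyticAt.and
      (e.open_target.mem_nhds (e.map_source (mem_chart_source ℂ q)))))
  have hex : DifferentiableOn ℂ (fun z => exp (F z)) (Metric.ball (e q) ρ) := fun z hz =>
    ((hball z hz).2.1.differentiableAt.cexp).differentiableWithinAt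
  obtain ⟨D, hD⟩ := hex.isExactOn_ball
  have hDa : ∀ z ∈ Metric.ball (e q) ρ, AnalyticAt ℂ D z := fun z hz =>
    DifferentiableOn.analyticAt (s := Metric.ball (e q) ρ)
      (fun y hy => (hD y hy).differentiableAt.differentiableWithinAt)
      (Metric.isOpen_ball.mem_nhds hz)
  have hz₀ : e q ∈ Metric.ball (e q) ρ := Metric.mem_ball_self hρ
  obtain ⟨R, hRs, rfl⟩ := exists_local_inverse (hDa _ hz₀)
    (by rw [(hD _ hz₀).deriv]; exact exp_ne_zero _)
  -- the inverse of `R` on a small disc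
  have hsymm : ∀ᶠ ζ in 𝓝 (R (e q)), ζ ∈ R.target ∧ R.symm ζ ∈ Metric.ball (e q) ρ := by
    refine (show ∀ᶠ ζ in 𝓝 (R (e q)), ζ ∈ R.target from
      R.open_target.mem_nhds (R.map_source hRs)).and ?_
    have := R.continuousAt_symm (R.map_source hRs)
    exact this.eventually (by
      rw [R.left_inv hRs]; exact Metric.isOpen_ball.mem_nhds hz₀)
  obtain ⟨r₀, hr₀, hr⟩ := Metric.eventually_nhds_iff_ball.1 hsymm
  have hcR : ContinuousAt R (e q) := R.continuousAt hRs
  have hce : ContinuousAt e q := e.continuousAt (mem_chart_source ℂ q)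
  have hN : ∀ᶠ x in 𝓝 q, x ∈ e.source ∧ e x ∈ R.source ∧ e x ∈ Metric.ball (e q) ρ ∧
      R (e x) ∈ Metric.ball (R (e q)) (r₀ / 2) :=
    (show ∀ᶠ x in 𝓝 q, x ∈ e.source from e.open_source.mem_nhds (mem_chart_source ℂ q)).and
      ((hce.eventually (R.open_source.mem_nhds hRs)).and
      ((hce.eventually (Metric.isOpen_ball.mem_nhds hz₀)).and
      ((ContinuousAt.comp (f := e) hcR hce).eventually
        (Metric.isOpen_ball.mem_nhds (Metric.mem_ball_self (half_pos hr₀))))))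
  refine ⟨_, hN, r₀ / 2, half_pos hr₀, fun x => R (e x), fun ζ => e.symm (R.symm ζ), ?_,
    fun x hx => hx.2.2.2, ?_, ?_⟩
  · intro ζ hζ
    have hζ' : ζ ∈ Metric.ball (R (e q)) r₀ := by convert hζ using 2; ring
    obtain ⟨h1, h2⟩ := hr ζ hζ'
    obtain ⟨⟨hE, hconf, hls, -⟩, -, htar⟩ := hball _ h2
    have hd : HasDerivAt R (exp (F (R.symm ζ))) (R.symm ζ) := hD _ h2
    have hinv := R.hasDerivAt_symm h1 (exp_ne_zero _) hd
    have hia : AnalyticAt ℂ R.symm ζ := (R.contDiffAt_symm_deriv (n := ω) (exp_ne_zero _) h1 hd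
      (hDa _ h2).contDiffAt).analyticAt
    refine ⟨contMDiffAt_chart_symm_comp hia htar, hE, ?_⟩
    refine ConfAt.comp (f := R.symm) hconf hia ?_
    rw [hinv.deriv, norm_inv, Complex.norm_exp, ← Real.exp_neg, ← Real.exp_add, ← hls]
    congr 1; ring
  · simp only [R.left_inv hRs, e.left_inv (mem_chart_source ℂ q)]
  · intro Φ w₀ hΦ hw₀
    obtain ⟨hs, hsR, hb, -⟩ := hw₀
    have hc := hΦ.self_of_nhds.hol.continuousAt
    have hcf : ContinuousAt (e ∘ Φ) w₀ := (e.continuousAt hs).comp hc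
    have hnear : ∀ᶠ w in 𝓝 w₀, IsFlatAt X E s Φ w ∧ Φ w ∈ e.source ∧ e (Φ w) ∈ R.source ∧
        e (Φ w) ∈ Metric.ball (e q) ρ :=
      hΦ.and ((hc.eventually (e.open_source.mem_nhds hs)).and
        ((hcf.eventually (R.open_source.mem_nhds hsR)).and
          (hcf.eventually (Metric.isOpen_ball.mem_nhds hb))))
    have hder : ∀ᶠ w in 𝓝 w₀, AnalyticAt ℂ (fun w => R (e (Φ w))) w ∧
        ‖deriv (fun w => R (e (Φ w))) w‖ = 1 := by
      filter_upwards [hnear.eventually_nhds] with w hw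
      obtain ⟨hfl, hs', hR', hb'⟩ := hw.self_of_nhds
      have hfa : AnalyticAt ℂ (e ∘ Φ) w := analyticAt_chart_comp hfl.hol hs'
      obtain ⟨⟨-, hconf, hls, -⟩, -, -⟩ := hball _ hb'
      rw [e.left_inv hs'] at hls
      have hXΦ : ConfAt ((X ∘ e.symm) ∘ (e ∘ Φ)) (-s (Φ w)) w :=
        hfl.conf.congr (comp_eventuallyEq_chart X (hw.mono fun _ h => h.2.1))
      have hm := ConfAt.exp_mul_norm_deriv (f := e ∘ Φ) hconf hfa hXΦ
      have hcomp : HasDerivAt (fun w => R (e (Φ w))) _ w :=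
        HasDerivAt.comp (h := e ∘ Φ) w (hD _ hb') hfa.differentiableAt.hasDerivAt
      refine ⟨(hDa _ hb').comp (f := e ∘ Φ) hfa, ?_⟩
      rw [hcomp.deriv, norm_mul, Complex.norm_exp, Function.comp_apply, ← hls, Real.exp_add, mul_comm (Real.exp _),
        mul_assoc]
      rw [hm, ← Real.exp_add]; simp
    set h : ℂ → ℂ := fun w => R (e (Φ w)) with hh
    have hconst : ∀ᶠ w in 𝓝 w₀, deriv h w = deriv h w₀ := by
      refine Complex.eventually_eq_of_isLocalMax_norm
        (hder.mono fun w hw => hw.1.deriv.differentiableAt) ?_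
      filter_upwards [hder] with w hw
      simp [hw.2, hder.self_of_nhds.2]
    obtain ⟨ε, hε, hεb⟩ := Metric.eventually_nhds_iff_ball.1 (hconst.and (hder.and hnear))
    refine ⟨deriv h w₀, hder.self_of_nhds.2, ?_⟩
    filter_upwards [Metric.ball_mem_nhds w₀ hε] with w hw
    have hlin : h w - deriv h w₀ * (w - w₀) = h w₀ - deriv h w₀ * (w₀ - w₀) := by
      refine Metric.isOpen_ball.is_const_of_deriv_eq_zero
        (f := fun w => h w - deriv h w₀ * (w - w₀)) (convex_ball w₀ ε).isPreconnected ?_ ?_ hw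
        (Metric.mem_ball_self hε)
      · intro y hy
        have := (hεb y hy).2.1.1.differentiableAt
        exact DifferentiableAt.differentiableWithinAt (by fun_prop)
      · intro y hy
        have := ((hεb y hy).2.1.1.differentiableAt.hasDerivAt).sub
          (((hasDerivAt_id y).sub_const w₀).const_mul (deriv h w₀))
        refine this.deriv.trans ?_
        rw [(hεb y hy).1]
        simp
    have hlin' : h w = h w₀ + deriv h w₀ * (w - w₀) := by
      rw [sub_self, mul_zero, sub_zero] at hlin
      rw [← hlin]; ring
    obtain ⟨-, hs', hR', -⟩ := (hεb w hw).2.2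
    have : e.symm (R.symm (h w)) = Φ w := by
      rw [hh]; simp only; rw [R.left_inv hR', e.left_inv hs']
    rw [← this, hlin']

/-- The Ahlfors–Schwarz lemma bounds `θ` along a flat disc. -/
lemma IsFlatPair.exp_le (H : IsFlatPair X E s θ c) (hc : 0 < c) {Φ : ℂ → S} {R : ℝ}
    (hΦ : ∀ w ∈ Metric.ball (0 : ℂ) R, IsFlatAt X E s Φ w) {w : ℂ}
    (hw : w ∈ Metric.ball (0 : ℂ) R) :
    Real.exp (θ (Φ w)) ≤ (Real.sqrt c)⁻¹ * (2 * R / (R ^ 2 - ‖w‖ ^ 2)) := by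
  refine ahlfors_schwarz (u := fun w => θ (Φ w)) hc (fun z hz => ?_) hw
  have hfl := hΦ z hz
  obtain ⟨l, F, hF, hev⟩ := H.regular _ hfl.notMem
  obtain ⟨-, hconf, hls, G, L, hL, hcL⟩ := hev.self_of_nhds
  set e := chartAt ℂ (Φ z) with he
  have hs : Φ z ∈ e.source := mem_chart_source ℂ (Φ z)
  have hse : ∀ᶠ w in 𝓝 z, Φ w ∈ e.source :=
    hfl.hol.continuousAt.eventually (e.open_source.mem_nhds hs)
  have hfa : AnalyticAt ℂ (e ∘ Φ) z := analyticAt_chart_comp hfl.hol hs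
  have hXΦ : ConfAt ((X ∘ e.symm) ∘ (e ∘ Φ)) (-s (Φ z)) z :=
    hfl.conf.congr (comp_eventuallyEq_chart X hse)
  have hm := ConfAt.exp_mul_norm_deriv (f := e ∘ Φ) hconf hfa hXΦ
  refine ⟨_, _, (HasLap.comp_analytic (f := e ∘ Φ) hL hfa).congr
    (comp_eventuallyEq_chart θ hse).symm, ?_⟩
  rw [e.left_inv hs] at hls hcL
  have h1 : Real.exp (F (e (Φ z))).re * ‖deriv (e ∘ Φ) z‖ = 1 := by
    rw [← hls, Real.exp_add, mul_comm (Real.exp _), mul_assoc, hm, ← Real.exp_add]; simp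
  calc c * Real.exp (2 * θ (Φ z))
      = ‖deriv (e ∘ Φ) z‖ ^ 2 * (c * Real.exp (2 * (θ (Φ z) + (F (e (Φ z))).re))) := by
        have h2 : Real.exp (2 * (θ (Φ z) + (F (e (Φ z))).re))
            = Real.exp (2 * θ (Φ z)) * Real.exp (F (e (Φ z))).re ^ 2 := by
          rw [← Real.exp_nat_mul, ← Real.exp_add]; congr 1; push_cast; ring
        rw [h2]
        calc _ = c * Real.exp (2 * θ (Φ z)) *
              (Real.exp (F (e (Φ z))).re * ‖deriv (e ∘ Φ) z‖) ^ 2 := by rw [h1]; ring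
          _ = _ := by ring
    _ ≤ _ := by gcongr

end Surface

/-! ### Completeness and the maximal flat disc -/

lemma ray_mem_ball {a : ℂ} {R : ℝ} (ha : ‖a‖ = R) (hR : 0 < R) {t : ℝ}
    (ht : t ∈ Set.Ico (0 : ℝ) 1) :
    (t : ℂ) * a ∈ Metric.ball (0 : ℂ) R := by
  have h0 := ht.1
  have h1 := ht.2
  simp [ha, abs_of_nonneg h0]
  nlinarith

section Surface

variable {S : Type*} [TopologicalSpace S] [ChartedSpace ℂ S]
  {X : S → E4} {E : Set S} {s θ : S → ℝ} {c : ℝ}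

lemma IsFlatAt.congr {Φ Φ' : ℂ → S} {w : ℂ} (h : IsFlatAt X E s Φ w) (he : Φ' =ᶠ[𝓝 w] Φ) :
    IsFlatAt X E s Φ' w := by
  refine ⟨h.hol.congr_of_eventuallyEq he, he.self_of_nhds ▸ h.notMem, ?_⟩
  rw [he.self_of_nhds]
  exact h.conf.congr (he.symm.fun_comp X)

/-- The speed of a flat map along a ray. -/
lemma IsFlatAt.norm_deriv_line {Φ : ℂ → S} {a : ℂ} {t : ℝ} (h : IsFlatAt X E s Φ (t * a)) :
    ‖deriv (fun t : ℝ => X (Φ (t * a))) t‖ = Real.exp (-s (Φ (t * a))) * ‖a‖ := by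
  have hline : HasDerivAt (fun t : ℝ => (t : ℂ) * a) a t := by
    simpa using ((hasDerivAt_id t).ofReal_comp).mul_const a
  have := h.conf.1.hasFDerivAt.comp_hasDerivAt t hline
  rw [← h.conf.2 a, ← this.deriv]
  rfl

variable [IsManifold 𝓘(ℂ) ω S]

/-- A holomorphic map restricted to a line is a `C¹` curve. -/
lemma contMDiffOn_comp_line {Φ : ℂ → S} {a : ℂ} {I : Set ℝ}
    (h : ∀ t ∈ I, ContMDiffAt 𝓘(ℂ) 𝓘(ℂ) ω Φ (t * a)) :
    ContMDiffOn 𝓘(ℝ, ℝ) 𝓘(ℝ, ℂ) 1 (fun t : ℝ => Φ (t * a)) I := by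
  intro t ht
  have hline : ContDiff ℝ 1 (fun t : ℝ => (t : ℂ) * a) := by
    have := Complex.ofRealCLM.contDiff (n := 1)
    exact this.mul contDiff_const
  rw [contMDiffWithinAt_iff]
  have hc : ContinuousAt (fun t : ℝ => Φ (t * a)) t :=
    ContinuousAt.comp (f := fun t : ℝ => (t : ℂ) * a) (h t ht).continuousAt
      hline.continuous.continuousAt
  refine ⟨hc.continuousWithinAt, ?_⟩
  have ha := (analyticAt_chart_comp (h t ht) (mem_chart_source ℂ (Φ (t * a)))).contDiffAt (n := 1)
  have := (ha.restrict_scalars ℝ).comp t hline.contDiffAt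
  exact (this.contDiffWithinAt :)

/-- The induced metric being dominated by the power `p < 1` of the Poincaré metric, a ray of a flat
disc is mapped to a curve of finite length. -/
lemma IsFlatPair.ray_length_lt_top (H : IsFlatPair X E s θ c) (hc : 0 < c) {p : ℝ} (hp0 : 0 < p)
    (hp : p < 1) (hs : ∀ x ∉ E, -s x ≤ p * θ x) {Φ : ℂ → S} {R : ℝ} (hR : 0 < R)
    (hΦ : ∀ w ∈ Metric.ball (0 : ℂ) R, IsFlatAt X E s Φ w) {a : ℂ} (ha : ‖a‖ = R) :
    ∫⁻ t in Set.Ioo (0 : ℝ) 1, ‖deriv (fun t : ℝ => X (Φ (t * a))) t‖ₑ < ⊤ := by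
  set K := (Real.sqrt c)⁻¹ * (2 / R) with hK
  have hK0 : 0 ≤ K := by positivity
  have hint : MeasureTheory.IntegrableOn (fun t : ℝ => K ^ p * R * (1 - t) ^ (-p))
      (Set.Ioo 0 1) := by
    have h1 : IntervalIntegrable (fun t : ℝ => t ^ (-p)) MeasureTheory.volume 0 1 :=
      intervalIntegral.intervalIntegrable_rpow' (by linarith)
    have h2 := (h1.comp_sub_left 1).symm
    simp only [sub_zero, sub_self] at h2
    have h3 := (intervalIntegrable_iff_integrableOn_Ioo_of_le zero_le_one).1 h2
    exact h3.const_mul _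
  refine lt_of_le_of_lt ?_ hint.2
  refine MeasureTheory.setLIntegral_mono' measurableSet_Ioo fun t ht => ?_
  have hball := ray_mem_ball ha hR ⟨ht.1.le, ht.2⟩
  have hfl := hΦ _ hball
  have h1t : 0 < 1 - t := by linarith [ht.2]
  rw [← ofReal_norm, ← ofReal_norm]
  refine ENNReal.ofReal_le_ofReal ?_
  rw [hfl.norm_deriv_line, ha]
  have hexp := H.exp_le hc hΦ hball
  have hnorm : ‖(t : ℂ) * a‖ = t * R := by simp [ha, abs_of_pos ht.1]
  rw [hnorm] at hexp
  have hb : Real.exp (θ (Φ (t * a))) ≤ K * (1 - t)⁻¹ := by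
    refine hexp.trans ?_
    rw [hK, mul_assoc]
    gcongr
    have : R ^ 2 - (t * R) ^ 2 = R * (R * (1 - t)) * (1 + t) := by ring
    rw [this, div_mul_eq_mul_div, div_le_div_iff₀ (mul_pos (by positivity) (by linarith [ht.1])) hR]
    have h2 : (2 * (1 - t)⁻¹) * (R * (R * (1 - t)) * (1 + t)) = 2 * R * R * (1 + t) := by
      field_simp
    rw [h2]
    have := ht.1
    nlinarith [mul_pos hR hR]
  have hle : Real.exp (-s (Φ (t * a))) ≤ K ^ p * (1 - t) ^ (-p) := by
    calc Real.exp (-s (Φ (t * a))) ≤ Real.exp (p * θ (Φ (t * a))) :=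
          Real.exp_le_exp.2 (hs _ hfl.notMem)
      _ = Real.exp (θ (Φ (t * a))) ^ p := by rw [← Real.exp_mul, mul_comm]
      _ ≤ (K * (1 - t)⁻¹) ^ p := by gcongr
      _ = _ := by rw [Real.mul_rpow hK0 (by positivity), Real.inv_rpow h1t.le, Real.rpow_neg h1t.le]
  have h3 : 0 ≤ (1 - t) ^ (-p) := by positivity
  rw [Real.norm_of_nonneg (by positivity)]
  calc _ ≤ K ^ p * (1 - t) ^ (-p) * R := by gcongr
    _ = _ := by ring

/-- The points of `E` are infinitely far away for the flat metric: a ray of a flat disc of finite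
radius does not accumulate there. -/
lemma IsFlatPair.notMem_of_mapClusterPt [T2Space S] (H : IsFlatPair X E s θ c) {Φ : ℂ → S} {R : ℝ}
    (hR : 0 < R) (hΦ : ∀ w ∈ Metric.ball (0 : ℂ) R, IsFlatAt X E s Φ w) {a : ℂ} (ha : ‖a‖ = R)
    {q : S} (hq : MapClusterPt q (𝓝[<] 1) (fun t : ℝ => Φ (t * a))) : q ∉ E := by
  intro hqE
  obtain ⟨l, C, hev⟩ := H.singular q hqE
  set e := chartAt ℂ q with he
  have hqs : q ∈ e.source := mem_chart_source ℂ q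
  obtain ⟨ρ₁, hρ₁, hball⟩ := Metric.eventually_nhds_iff_ball.1
    (hev.and (show ∀ᶠ z in 𝓝 (e q), z ∈ e.target from e.open_target.mem_nhds (e.map_source hqs)))
  set ρ := ρ₁ / 2 with hρdef
  have hρ : 0 < ρ := half_pos hρ₁
  have hρlt : ρ < ρ₁ := half_lt_self hρ₁
  set γ : ℝ → S := fun t => Φ (t * a) with hγ
  set f : ℝ → ℂ := fun t => e (γ t) - e q with hf
  set K := R * Real.exp C with hK
  have hK0 : 0 ≤ K := by positivity
  have hflat : ∀ t ∈ Set.Ico (0 : ℝ) 1, IsFlatAt X E s Φ (t * a) := fun t ht =>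
    hΦ _ (ray_mem_ball ha hR ht)
  have hline : ∀ t : ℝ, HasDerivAt (fun t : ℝ => (t : ℂ) * a) a t := fun t => by
    simpa using ((hasDerivAt_id t).ofReal_comp).mul_const a
  have hγc : ∀ t ∈ Set.Ico (0 : ℝ) 1, ContinuousAt γ t := fun t ht =>
    ContinuousAt.comp (f := fun t : ℝ => (t : ℂ) * a) (hflat t ht).hol.continuousAt
      (hline t).continuousAt
  have hfd : ∀ t ∈ Set.Ico (0 : ℝ) 1, γ t ∈ e.source →
      HasDerivAt f (deriv (e ∘ Φ) (t * a) * a) t := by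
    intro t ht hs
    have h1 := (analyticAt_chart_comp (hflat t ht).hol hs).differentiableAt.hasDerivAt
    exact (HasDerivAt.comp_of_eq t h1 (hline t) rfl).sub_const (e q)
  let V : Set S := {x | x ∈ e.source ∧ ‖e x - e q‖ < ρ}
  have hVopen : IsOpen V := by
    have : V = e.source ∩ e ⁻¹' Metric.ball (e q) ρ := by
      ext x; simp [V, dist_eq_norm]
    rw [this]
    exact e.isOpen_inter_preimage Metric.isOpen_ball
  have hspeed : ∀ t ∈ Set.Ico (0 : ℝ) 1, γ t ∈ V →
      ‖deriv (e ∘ Φ) (t * a) * a‖ ≤ K * ‖f t‖ := by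
    intro t ht hV
    have hfl := hflat t ht
    have hz : e (γ t) ∈ Metric.ball (e q) ρ₁ := by
      rw [Metric.mem_ball, dist_eq_norm]; exact hV.2.trans hρlt
    obtain ⟨⟨hconf, hls⟩, -⟩ := hball _ hz
    rw [e.left_inv hV.1] at hls
    have hls := hls hfl.notMem
    have hsrc : ∀ᶠ w in 𝓝 ((t : ℂ) * a), Φ w ∈ e.source :=
      hfl.hol.continuousAt.eventually (e.open_source.mem_nhds hV.1)
    have hm := ConfAt.exp_mul_norm_deriv (f := e ∘ Φ) hconf (analyticAt_chart_comp hfl.hol hV.1)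
      (hfl.conf.congr (comp_eventuallyEq_chart X hsrc))
    have hne : f t ≠ 0 := by
      intro h0
      have : e (γ t) = e q := by simpa [hf, sub_eq_zero] using h0
      have hγq : γ t = q := e.injOn hV.1 hqs this
      exact hfl.notMem (by change γ t ∈ E; rw [hγq]; exact hqE)
    have hpos : 0 < ‖f t‖ := norm_pos_iff.2 hne
    rw [norm_mul, ha]
    have h1 : ‖deriv (e ∘ Φ) (t * a)‖ = Real.exp (-(l (e (γ t)) + s (γ t))) := by
      rw [neg_add, Real.exp_add, ← hm, ← mul_assoc, ← Real.exp_add]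
      simp
    have h2 : Real.exp (-(l (e (γ t)) + s (γ t))) ≤ Real.exp C * ‖f t‖ := by
      rw [← Real.exp_log hpos, ← Real.exp_add]
      refine Real.exp_le_exp.2 ?_
      change -Real.log ‖f t‖ - C ≤ _ at hls
      linarith
    rw [h1, hK]
    nlinarith
  -- backwards Gronwall estimate while the curve stays in `V`
  have hgron : ∀ t ∈ Set.Ico (0 : ℝ) 1, ∀ t₀ ∈ Set.Icc 0 t, (∀ τ ∈ Set.Ioc t₀ t, γ τ ∈ V) →
      γ t₀ ∈ e.source → ‖f t₀‖ ≤ ‖f t‖ * Real.exp K := by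
    intro t ht t₀ ht₀ hV hs
    have hsrc : ∀ r ∈ Set.Icc 0 (t - t₀), t - r ∈ Set.Ico (0 : ℝ) 1 ∧ γ (t - r) ∈ e.source := by
      intro r hr
      refine ⟨⟨by linarith [ht₀.1, hr.2], by linarith [ht.2, hr.1]⟩, ?_⟩
      rcases eq_or_lt_of_le hr.2 with h | h
      · rw [h]; simpa using hs
      · exact (hV _ ⟨by linarith, by linarith [hr.1]⟩).1
    have hd : ∀ r ∈ Set.Icc 0 (t - t₀), HasDerivAt (fun r => f (t - r))
        (-(deriv (e ∘ Φ) ((t - r : ℝ) * a) * a)) r := by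
      intro r hr
      have := (hfd _ (hsrc r hr).1 (hsrc r hr).2).scomp_of_eq r ((hasDerivAt_id r).const_sub t) rfl
      exact this.congr_deriv (by simp)
    have := norm_le_gronwallBound_of_norm_deriv_right_le (f := fun r => f (t - r))
      (f' := fun r => -(deriv (e ∘ Φ) ((t - r : ℝ) * a) * a)) (δ := ‖f t‖) (K := K) (ε := 0)
      (a := 0) (b := t - t₀) (fun r hr => (hd r hr).continuousAt.continuousWithinAt)
      (fun r hr => (hd r ⟨hr.1, hr.2.le⟩).hasDerivWithinAt) (by simp)
      (fun r hr => by
        rw [norm_neg, add_zero]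
        exact hspeed _ (hsrc r ⟨hr.1, hr.2.le⟩).1
          (hV _ ⟨by linarith [hr.2], by linarith [hr.1]⟩))
      (t - t₀) ⟨by linarith [ht₀.2], le_rfl⟩
    rw [gronwallBound_ε0] at this
    simp only [sub_sub_cancel, sub_zero] at this
    refine this.trans ?_
    gcongr
    have : t - t₀ ≤ 1 := by linarith [ht.2, ht₀.1]
    nlinarith
  -- so if it is close enough to `q` at some time, it was in `V` at all earlier times
  have hstay : ∀ t ∈ Set.Ico (0 : ℝ) 1, γ t ∈ V → ‖f t‖ * Real.exp K < ρ →
      γ 0 ∈ e.source ∧ ‖f 0‖ ≤ ‖f t‖ * Real.exp K := by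
    intro t ht hV hlt
    by_cases hB : ∃ τ ∈ Set.Icc 0 t, γ τ ∉ V
    · exfalso
      have hcont : ContinuousOn γ (Set.Icc 0 t) := fun τ hτ =>
        (hγc τ ⟨hτ.1, hτ.2.trans_lt ht.2⟩).continuousWithinAt
      have hcl : IsClosed (Set.Icc 0 t ∩ γ ⁻¹' Vᶜ) :=
        hcont.preimage_isClosed_of_isClosed isClosed_Icc hVopen.isClosed_compl
      have hcpt : IsCompact (Set.Icc 0 t ∩ γ ⁻¹' Vᶜ) :=
        isCompact_Icc.of_isClosed_subset hcl Set.inter_subset_left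
      obtain ⟨t₀, ⟨ht₀, ht₀V⟩, hmax⟩ := hcpt.exists_isGreatest
        (let ⟨τ, h1, h2⟩ := hB; ⟨τ, h1, h2⟩)
      have hin : ∀ τ ∈ Set.Ioc t₀ t, γ τ ∈ V := by
        intro τ hτ
        by_contra hn
        have := hmax ⟨⟨ht₀.1.trans hτ.1.le, hτ.2⟩, hn⟩
        linarith [hτ.1]
      have hlt₀ : t₀ < t := lt_of_le_of_ne ht₀.2 (by rintro rfl; exact ht₀V hV)
      have hKc : IsClosed (e.symm '' Metric.closedBall (e q) ρ) := by
        refine ((isCompact_closedBall (e q) ρ).image_of_continuousOn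
          (e.continuousOn_symm.mono fun z hz => ?_)).isClosed
        exact (hball z (Metric.closedBall_subset_ball hρlt hz)).2
      have hmem : γ t₀ ∈ e.symm '' Metric.closedBall (e q) ρ := by
        refine hKc.mem_of_tendsto (b := 𝓝[>] t₀)
          ((hγc t₀ ⟨ht₀.1, ht₀.2.trans_lt ht.2⟩).tendsto.mono_left nhdsWithin_le_nhds) ?_
        filter_upwards [Ioc_mem_nhdsGT hlt₀] with τ hτ
        have := hin τ hτ
        exact ⟨e (γ τ), by rw [Metric.mem_closedBall, dist_eq_norm]; exact this.2.le,
          e.left_inv this.1⟩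
      obtain ⟨z, hz, hzγ⟩ := hmem
      have hsrc : γ t₀ ∈ e.source :=
        hzγ ▸ e.map_target (hball z (Metric.closedBall_subset_ball hρlt hz)).2
      have := hgron t ht t₀ ht₀ hin hsrc
      exact ht₀V ⟨hsrc, this.trans_lt hlt⟩
    · push Not at hB
      have h0 := hB 0 ⟨le_rfl, ht.1⟩
      exact ⟨h0.1, hgron t ht 0 ⟨le_rfl, ht.1⟩ (fun τ hτ => hB τ ⟨hτ.1.le, hτ.2⟩) h0.1⟩
  -- as it accumulates at `q`, it started at `q`
  have hsmall : ∀ δ > 0, γ 0 ∈ e.source ∧ ‖f 0‖ ≤ δ := by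
    intro δ hδ
    have hcq : ContinuousAt (fun x => ‖e x - e q‖ * Real.exp K) q :=
      (((e.continuousAt hqs).sub continuousAt_const).norm).mul continuousAt_const
    have hlim : Tendsto (fun x => ‖e x - e q‖ * Real.exp K) (𝓝 q) (𝓝 0) := by
      have := hcq.tendsto; simpa using this
    have hVq : V ∈ 𝓝 q := hVopen.mem_nhds ⟨hqs, by simpa using hρ⟩
    have hfr := (hq.frequently ((show ∀ᶠ x in 𝓝 q, x ∈ V from hVq).and
      (hlim.eventually (gt_mem_nhds (lt_min hρ hδ))))).and_eventually
      (Ico_mem_nhdsLT (show (0 : ℝ) < 1 by norm_num))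
    obtain ⟨t, ⟨hV, hlt⟩, ht⟩ := hfr.exists
    obtain ⟨h1, h2⟩ := hstay t ht hV (hlt.trans_le (min_le_left _ _))
    exact ⟨h1, h2.trans (hlt.le.trans (min_le_right _ _))⟩
  have hf0 : f 0 = 0 := by
    rw [← norm_le_zero_iff]
    exact le_of_forall_pos_le_add fun δ hδ => by simpa using (hsmall δ hδ).2
  have : e (γ 0) = e q := by simpa [hf, sub_eq_zero] using hf0
  have hγ0 : γ 0 = q := e.injOn (hsmall 1 one_pos).1 hqs this
  exact (hflat 0 ⟨le_rfl, one_pos⟩).notMem (by change γ 0 ∈ E; rw [hγ0]; exact hqE)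

/-- If `X` is complete, a flat disc extends across each boundary point. -/
lemma IsFlatPair.exists_extension_at [T2Space S] (H : IsFlatPair X E s θ c) (hc : 0 < c) {p : ℝ}
    (hp0 : 0 < p) (hp : p < 1) (hs : ∀ x ∉ E, -s x ≤ p * θ x) (hX : IsCompleteSurface X)
    {Φ : ℂ → S} {R : ℝ} (hR : 0 < R)
    (hΦ : ∀ w ∈ Metric.ball (0 : ℂ) R, IsFlatAt X E s Φ w) {a : ℂ} (ha : ‖a‖ = R) :
    ∃ r > 0, ∃ Φ' : ℂ → S, (∀ w ∈ Metric.ball a r, IsFlatAt X E s Φ' w) ∧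
      Set.EqOn Φ' Φ (Metric.ball a r ∩ Metric.ball 0 R) := by
  have hlen := H.ray_length_lt_top hc hp0 hp hs hR hΦ ha
  have hnot : ¬ Tendsto (fun t : ℝ => Φ (t * a)) (𝓝[<] 1) (cocompact S) := fun ht =>
    hlen.ne (hX _ (contMDiffOn_comp_line fun t ht => (hΦ _ (ray_mem_ball ha hR ht)).hol) ht)
  rw [hasBasis_cocompact.tendsto_right_iff] at hnot
  push Not at hnot
  obtain ⟨K, hK, hfr⟩ := hnot
  obtain ⟨q, -, hq⟩ := hK.exists_mapClusterPt_of_frequently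
    (hfr.mono fun t ht => by simpa using ht)
  have hqE := H.notMem_of_mapClusterPt hR hΦ ha hq
  obtain ⟨N, hN, r, hr, D, P, hP, hDN, -, hrig⟩ := H.exists_flat_coordinate hqE
  have hta : ∀ᶠ t : ℝ in 𝓝[<] 1, (t : ℂ) * a ∈ Metric.ball a (r / 2) := by
    have hcont : Continuous fun t : ℝ => (t : ℂ) * a := by fun_prop
    have : Tendsto (fun t : ℝ => (t : ℂ) * a) (𝓝[<] 1) (𝓝 a) := by
      have := hcont.tendsto 1
      simp only [ofReal_one, one_mul] at this
      exact this.mono_left nhdsWithin_le_nhds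
    exact this.eventually (Metric.ball_mem_nhds a (half_pos hr))
  obtain ⟨t, ⟨htN, hta⟩, ht⟩ := (((hq.frequently hN).and_eventually hta).and_eventually
    (Ico_mem_nhdsLT (show (0 : ℝ) < 1 by norm_num))).exists
  set w₀ : ℂ := t * a with hw₀
  have hw₀R : w₀ ∈ Metric.ball (0 : ℂ) R := ray_mem_ball ha hR ht
  obtain ⟨u, hu, hev⟩ := hrig Φ w₀
    ((show ∀ᶠ w in 𝓝 w₀, w ∈ Metric.ball (0 : ℂ) R from
      Metric.isOpen_ball.mem_nhds hw₀R).mono hΦ) htN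
  set Φ' : ℂ → S := fun w => P (D (Φ w₀) + u * (w - w₀)) with hΦ'
  have hfl : ∀ w ∈ Metric.ball w₀ r, IsFlatAt X E s Φ' w := by
    intro w hw
    refine IsFlatAt.comp_affine (hP _ ?_) hu
    have h1 := hDN _ htN
    rw [Metric.mem_ball, dist_eq_norm] at h1 hw ⊢
    calc ‖D (Φ w₀) + u * (w - w₀) - D q‖ = ‖(D (Φ w₀) - D q) + u * (w - w₀)‖ := by ring_nf
      _ ≤ ‖D (Φ w₀) - D q‖ + ‖u * (w - w₀)‖ := norm_add_le _ _
      _ < r + r := by rw [norm_mul, hu, one_mul]; exact add_lt_add h1 hw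
      _ = 2 * r := by ring
  have hsub : Metric.ball a (r / 2) ⊆ Metric.ball w₀ r := by
    refine Metric.ball_subset_ball' ?_
    rw [Metric.mem_ball, dist_comm] at hta
    linarith
  refine ⟨r / 2, half_pos hr, Φ', fun w hw => hfl w (hsub hw), ?_⟩
  have heq : Set.EqOn Φ' Φ (Metric.ball w₀ r ∩ Metric.ball 0 R) :=
    eqOn_of_eventuallyEq ((convex_ball w₀ r).inter (convex_ball 0 R)).isPreconnected
      (fun w hw => (hfl w hw.1).hol) (fun w hw => (hΦ w hw.2).hol)
      ⟨Metric.mem_ball_self hr, hw₀R⟩ (hev.mono fun w hw => hw.symm)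
  exact heq.mono (Set.inter_subset_inter_left _ hsub)

/-- A flat disc that extends across each boundary point extends to a larger disc. -/
lemma exists_larger_flat_disc [T2Space S] {Φ : ℂ → S} {R : ℝ} (hR : 0 < R)
    (hΦ : ∀ w ∈ Metric.ball (0 : ℂ) R, IsFlatAt X E s Φ w)
    (hext : ∀ a : ℂ, ‖a‖ = R → ∃ r > 0, ∃ Φ' : ℂ → S,
      (∀ w ∈ Metric.ball a r, IsFlatAt X E s Φ' w) ∧
        Set.EqOn Φ' Φ (Metric.ball a r ∩ Metric.ball 0 R)) :
    ∃ R' > R, ∃ Φ' : ℂ → S, (∀ w ∈ Metric.ball (0 : ℂ) R', IsFlatAt X E s Φ' w) ∧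
      Set.EqOn Φ' Φ (Metric.ball 0 R) := by
  classical
  have : Nonempty S := ⟨Φ 0⟩
  choose! r hr Ψ hΨ hΨΦ using hext
  -- two of the local extensions agree, because a segment between boundary points lies in the disc
  have hagree : ∀ a b : ℂ, ‖a‖ = R → ‖b‖ = R →
      Set.EqOn (Ψ a) (Ψ b) (Metric.ball a (r a) ∩ Metric.ball b (r b)) := by
    intro a b ha hb w hw
    by_cases hab : a = b
    · rw [hab]
    have hdist : dist a b < r a + r b := by
      calc dist a b ≤ dist w a + dist w b := dist_triangle_left a b w
        _ < _ := add_lt_add hw.1 hw.2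
    have hra := hr a ha
    have hrb := hr b hb
    set t : ℝ := r a / (r a + r b) with ht
    have hsum : 0 < r a + r b := by linarith
    have ht0 : 0 < t := by positivity
    have ht1 : t < 1 := by rw [ht, div_lt_one hsum]; linarith
    set y : ℂ := (1 - t) • a + t • b with hy
    have hdab : 0 < dist a b := dist_pos.2 hab
    have hya : y ∈ Metric.ball a (r a) := by
      have : y - a = t • (b - a) := by rw [hy]; module
      rw [Metric.mem_ball, dist_eq_norm, this, norm_smul, Real.norm_of_nonneg ht0.le,
        ← dist_eq_norm, dist_comm]
      calc t * dist a b < t * (r a + r b) := by gcongr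
        _ = r a := by rw [ht]; field_simp
    have hyb : y ∈ Metric.ball b (r b) := by
      have : y - b = (1 - t) • (a - b) := by rw [hy]; module
      rw [Metric.mem_ball, dist_eq_norm, this, norm_smul, Real.norm_of_nonneg (by linarith),
        ← dist_eq_norm]
      calc (1 - t) * dist a b < (1 - t) * (r a + r b) := by
            have : 0 < 1 - t := by linarith
            gcongr
        _ = r b := by rw [ht]; field_simp; ring
    have hyR : y ∈ Metric.ball (0 : ℂ) R := by
      have hsc := (strictConvex_closedBall ℝ (0 : ℂ) R) (x := a) (by simp [ha]) (y := b)
        (by simp [hb]) hab (show 0 < 1 - t by linarith) ht0 (by ring)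
      rwa [interior_closedBall _ hR.ne'] at hsc
    have hev : Ψ a =ᶠ[𝓝 y] Ψ b := by
      filter_upwards [Metric.isOpen_ball.mem_nhds hya, Metric.isOpen_ball.mem_nhds hyb,
        Metric.isOpen_ball.mem_nhds hyR] with x h1 h2 h3
      rw [hΨΦ a ha ⟨h1, h3⟩, hΨΦ b hb ⟨h2, h3⟩]
    exact eqOn_of_eventuallyEq ((convex_ball a (r a)).inter (convex_ball b (r b))).isPreconnected
      (fun x hx => (hΨ a ha x hx.1).hol) (fun x hx => (hΨ b hb x hx.2).hol) ⟨hya, hyb⟩ hev hw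
  set U : Set ℂ := Metric.ball 0 R ∪ ⋃ a ∈ Metric.sphere (0 : ℂ) R, Metric.ball a (r a) with hU
  have hUo : IsOpen U := Metric.isOpen_ball.union
    (isOpen_biUnion fun _ _ => Metric.isOpen_ball)
  have hsub : Metric.closedBall (0 : ℂ) R ⊆ U := by
    intro z hz
    rcases lt_or_eq_of_le (mem_closedBall_zero_iff.1 hz) with h | h
    · exact Or.inl (mem_ball_zero_iff.2 h)
    · exact Or.inr (Set.mem_biUnion (mem_sphere_zero_iff_norm.2 h)
        (Metric.mem_ball_self (hr z h)))
  obtain ⟨δ, hδ, hthick⟩ := (isCompact_closedBall (0 : ℂ) R).exists_thickening_subset_open hUo hsub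
  rw [thickening_closedBall hδ hR.le] at hthick
  have hch : ∀ z : ℂ, ∃ a : ℂ, z ∈ U → z ∉ Metric.ball (0 : ℂ) R →
      ‖a‖ = R ∧ z ∈ Metric.ball a (r a) := by
    intro z
    by_cases hz : z ∈ ⋃ a ∈ Metric.sphere (0 : ℂ) R, Metric.ball a (r a)
    · simp only [Set.mem_iUnion, exists_prop, mem_sphere_zero_iff_norm] at hz
      obtain ⟨a, h1, h2⟩ := hz
      exact ⟨a, fun _ _ => ⟨h1, h2⟩⟩
    · exact ⟨0, fun h1 h2 => (hz (h1.resolve_left h2)).elim⟩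
  choose A hA using hch
  set Φ' : ℂ → S := fun z => if z ∈ Metric.ball (0 : ℂ) R then Φ z else Ψ (A z) z with hΦ'
  have hin : Set.EqOn Φ' Φ (Metric.ball 0 R) := fun z hz => by simp only [hΦ', if_pos hz]
  refine ⟨δ + R, by linarith, Φ', fun w hw => ?_, hin⟩
  rcases hthick hw with h | h
  · exact (hΦ w h).congr (hin.eventuallyEq_of_mem (Metric.isOpen_ball.mem_nhds h))
  · simp only [Set.mem_iUnion, exists_prop, mem_sphere_zero_iff_norm] at h
    obtain ⟨a, ha, hwa⟩ := h
    refine (hΨ a ha w hwa).congr ?_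
    filter_upwards [Metric.isOpen_ball.mem_nhds hwa] with z hz
    by_cases hzR : z ∈ Metric.ball (0 : ℂ) R
    · rw [hin hzR, hΨΦ a ha ⟨hz, hzR⟩]
    · have hzU : z ∈ U := Or.inr (Set.mem_biUnion (mem_sphere_zero_iff_norm.2 ha) hz)
      obtain ⟨h1, h2⟩ := hA z hzU hzR
      simp only [hΦ', if_neg hzR]
      exact hagree _ _ h1 ha ⟨h2, hz⟩

/-- A surface with a flat metric and a negatively curved metric as in `IsFlatPair`, such that the
induced metric is at most the geometric mean, with weights `1 - p` and `p`, of the two, is not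
complete. -/
theorem IsFlatPair.not_isCompleteSurface [T2Space S] (H : IsFlatPair X E s θ c) (hc : 0 < c)
    {p : ℝ} (hp0 : 0 < p) (hp : p < 1) (hs : ∀ x ∉ E, -s x ≤ p * θ x) {x₀ : S} (hx₀ : x₀ ∉ E) :
    ¬ IsCompleteSurface X := by
  intro hX
  obtain ⟨N, hN, r, hr, D, P, hP, -, hPD, -⟩ := H.exists_flat_coordinate hx₀
  set Φ₀ : ℂ → S := fun w => P (D x₀ + 1 * (w - 0)) with hΦ₀
  have hΦ₀flat : ∀ w ∈ Metric.ball (0 : ℂ) r, IsFlatAt X E s Φ₀ w := by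
    intro w hw
    refine IsFlatAt.comp_affine (hP _ ?_) (by simp)
    have : ‖w‖ < r := by simpa using hw
    simp [dist_eq_norm]
    linarith
  have hΦ₀0 : Φ₀ 0 = x₀ := by simp [hΦ₀, hPD]
  set T : Set ℝ := {R | r ≤ R ∧ ∃ Φ : ℂ → S, (∀ w ∈ Metric.ball (0 : ℂ) R, IsFlatAt X E s Φ w) ∧
    Φ =ᶠ[𝓝 0] Φ₀} with hT
  have hrT : r ∈ T := ⟨le_rfl, Φ₀, hΦ₀flat, EventuallyEq.rfl⟩
  have hbdd : BddAbove T := by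
    refine ⟨2 * (Real.sqrt c)⁻¹ * (Real.exp (θ x₀))⁻¹, ?_⟩
    rintro R ⟨hrR, Φ, hΦ, hΦ0⟩
    have hR : 0 < R := hr.trans_le hrR
    have h1 := H.exp_le hc hΦ (w := 0) (by simpa using hR)
    rw [hΦ0.self_of_nhds, hΦ₀0] at h1
    have h2 : 2 * R / (R ^ 2 - ‖(0 : ℂ)‖ ^ 2) = 2 / R := by
      simp; field_simp
    rw [h2, ← mul_div_assoc, le_div_iff₀ hR] at h1
    rw [← div_eq_mul_inv, le_div_iff₀ (Real.exp_pos _)]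
    linarith
  set R := sSup T with hRdef
  have hrR : r ≤ R := le_csSup hbdd hrT
  have hR : 0 < R := hr.trans_le hrR
  have hex : ∀ z : ℂ, ∃ R₁ : ℝ, ‖z‖ < R → ‖z‖ < R₁ ∧ R₁ ∈ T := by
    intro z
    by_cases hz : ‖z‖ < R
    · obtain ⟨R₁, h1, h2⟩ := exists_lt_of_lt_csSup ⟨r, hrT⟩ hz
      exact ⟨R₁, fun _ => ⟨h2, h1⟩⟩
    · exact ⟨0, fun h => (hz h).elim⟩
  choose ρ hρ using hex
  have hTΦ : ∀ R₁ : ℝ, ∃ Φ : ℂ → S, R₁ ∈ T →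
      (∀ w ∈ Metric.ball (0 : ℂ) R₁, IsFlatAt X E s Φ w) ∧ Φ =ᶠ[𝓝 0] Φ₀ := by
    intro R₁
    by_cases h : R₁ ∈ T
    · obtain ⟨-, Φ, h2⟩ := h
      exact ⟨Φ, fun _ => h2⟩
    · exact ⟨Φ₀, fun h' => (h h').elim⟩
  choose F hF using hTΦ
  have hFF : ∀ R₁ ∈ T, ∀ R₂ ∈ T, ∀ z : ℂ, ‖z‖ < R₁ → ‖z‖ < R₂ → F R₁ z = F R₂ z := by
    intro R₁ h₁ R₂ h₂ z hz₁ hz₂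
    exact eqOn_of_eventuallyEq
      ((convex_ball (0 : ℂ) R₁).inter (convex_ball (0 : ℂ) R₂)).isPreconnected
      (fun w hw => ((hF R₁ h₁).1 w hw.1).hol) (fun w hw => ((hF R₂ h₂).1 w hw.2).hol)
      (c := 0) (by simp [hr.trans_le h₁.1, hr.trans_le h₂.1])
      ((hF R₁ h₁).2.trans (hF R₂ h₂).2.symm) (by simp [hz₁, hz₂])
  set Φ : ℂ → S := fun z => F (ρ z) z with hΦdef
  have hΦF : ∀ R₁ ∈ T, ∀ z : ℂ, ‖z‖ < R₁ → Φ z = F R₁ z := by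
    intro R₁ h₁ z hz
    have hzR := hρ z (hz.trans_le (le_csSup hbdd h₁))
    exact hFF _ hzR.2 _ h₁ z hzR.1 hz
  have hΦ : ∀ w ∈ Metric.ball (0 : ℂ) R, IsFlatAt X E s Φ w := by
    intro w hw
    obtain ⟨h1, h2⟩ := hρ w (by simpa using hw)
    have hwb : w ∈ Metric.ball (0 : ℂ) (ρ w) := by simpa using h1
    refine ((hF _ h2).1 w hwb).congr ?_
    filter_upwards [Metric.isOpen_ball.mem_nhds hwb] with z hz
    exact hΦF _ h2 z (by simpa using hz)
  have hΦ0 : Φ =ᶠ[𝓝 0] Φ₀ := by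
    refine EventuallyEq.trans ?_ (hF r hrT).2
    filter_upwards [Metric.ball_mem_nhds (0 : ℂ) hr] with z hz
    exact hΦF r hrT z (by simpa using hz)
  obtain ⟨R', hR', Φ', hΦ', hΦ'Φ⟩ := exists_larger_flat_disc hR hΦ fun a ha =>
    H.exists_extension_at hc hp0 hp hs hX hR hΦ ha
  have : R' ∈ T := ⟨hrR.trans hR'.le, Φ', hΦ',
    (hΦ'Φ.eventuallyEq_of_mem (Metric.ball_mem_nhds 0 hR)).trans hΦ0⟩
  exact absurd (le_csSup hbdd this) (not_le.2 hR')

end Surface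

/-! ### The chordal distance on the Riemann sphere and homogeneous lifts -/

/-- The determinant of two vectors of `ℂ²`. -/
def det2 (a b : ℂ × ℂ) : ℂ := a.1 * b.2 - a.2 * b.1

/-- The squared Hermitian norm on `ℂ²`. -/
def nsq (a : ℂ × ℂ) : ℝ := ‖a.1‖ ^ 2 + ‖a.2‖ ^ 2

/-- Homogeneous coordinates of norm one of a point of the Riemann sphere, where the point
`w₂ / w₁` has the homogeneous coordinates `(w₁, w₂)`. -/
def rep : OnePoint ℂ → ℂ × ℂ
  | none => (0, 1)
  | some w => ((((Real.sqrt (1 + ‖w‖ ^ 2))⁻¹ : ℝ) : ℂ), ((Real.sqrt (1 + ‖w‖ ^ 2))⁻¹ : ℝ) * w)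

/-- The square of the chordal distance on the Riemann sphere (of diameter one). -/
def chordSq (x y : OnePoint ℂ) : ℝ := ‖det2 (rep x) (rep y)‖ ^ 2

lemma rep_infty : rep OnePoint.infty = (0, 1) := rfl

lemma rep_coe (w : ℂ) : rep (w : OnePoint ℂ) =
    ((((Real.sqrt (1 + ‖w‖ ^ 2))⁻¹ : ℝ) : ℂ), ((Real.sqrt (1 + ‖w‖ ^ 2))⁻¹ : ℝ) * w) := rfl

lemma nsq_rep (x : OnePoint ℂ) : nsq (rep x) = 1 := by
  induction x using OnePoint.rec with
  | infty => simp [rep_infty, nsq]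
  | coe w =>
    have h : 0 < 1 + ‖w‖ ^ 2 := by positivity
    simp only [rep_coe, nsq, norm_mul, Complex.norm_real, norm_inv, mul_pow, inv_pow]
    rw [Real.norm_of_nonneg (Real.sqrt_nonneg _), Real.sq_sqrt h.le]
    field_simp

lemma nsq_smul (c : ℂ) (a : ℂ × ℂ) : nsq (c • a) = ‖c‖ ^ 2 * nsq a := by
  simp [nsq]; ring

lemma nsq_pos {a : ℂ × ℂ} (ha : a ≠ 0) : 0 < nsq a := by
  have h : a.1 ≠ 0 ∨ a.2 ≠ 0 := by
    by_contra! h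
    exact ha (Prod.ext h.1 h.2)
  rcases h with h | h
  · have := norm_pos_iff.2 h; unfold nsq; positivity
  · have := norm_pos_iff.2 h; unfold nsq; positivity

lemma det2_swap (a b : ℂ × ℂ) : det2 a b = -det2 b a := by simp [det2]; ring

lemma det2_smul_right (c : ℂ) (a b : ℂ × ℂ) : det2 a (c • b) = c * det2 a b := by
  simp [det2]; ring

lemma det2_smul_left (c : ℂ) (a b : ℂ × ℂ) : det2 (c • a) b = c * det2 a b := by
  simp [det2]; ring

/-- Lagrange's identity. -/
lemma norm_det2_sq_add (l a : ℂ × ℂ) :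
    ‖det2 l a‖ ^ 2 + ‖l.1 * conj a.1 + l.2 * conj a.2‖ ^ 2 = nsq l * nsq a := by
  simp only [nsq, det2, ← Complex.normSq_eq_norm_sq, Complex.normSq_apply]
  simp
  ring

lemma norm_det2_sq_le (l a : ℂ × ℂ) : ‖det2 l a‖ ^ 2 ≤ nsq l * nsq a := by
  rw [← norm_det2_sq_add]; nlinarith [sq_nonneg ‖l.1 * conj a.1 + l.2 * conj a.2‖]

lemma chordSq_nonneg (x y : OnePoint ℂ) : 0 ≤ chordSq x y := by unfold chordSq; positivity

lemma chordSq_le_one (x y : OnePoint ℂ) : chordSq x y ≤ 1 := by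
  have := norm_det2_sq_le (rep x) (rep y)
  rwa [nsq_rep, nsq_rep, one_mul] at this

lemma chordSq_eq_zero_iff {x y : OnePoint ℂ} : chordSq x y = 0 ↔ x = y := by
  have hs : ∀ w : ℂ, ((Real.sqrt (1 + ‖w‖ ^ 2) : ℝ) : ℂ) ≠ 0 := fun w => by
    have h : 0 < 1 + ‖w‖ ^ 2 := by positivity
    exact_mod_cast (Real.sqrt_pos.2 h).ne'
  have key : chordSq x y = 0 ↔ det2 (rep x) (rep y) = 0 := by simp [chordSq]
  rw [key]
  induction x using OnePoint.rec with
  | infty =>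
    induction y using OnePoint.rec with
    | infty => simp [det2, rep_infty]
    | coe w =>
      have := hs w
      simp only [det2, rep_infty, rep_coe, zero_mul, one_mul, zero_sub, neg_eq_zero, ofReal_inv,
        inv_eq_zero]
      exact ⟨fun h => (this h).elim, fun h => (OnePoint.infty_ne_coe w h).elim⟩
  | coe v =>
    induction y using OnePoint.rec with
    | infty =>
      have := hs v
      simp only [det2, rep_infty, rep_coe, mul_zero, mul_one, sub_zero, ofReal_inv, inv_eq_zero]
      exact ⟨fun h => (this h).elim, fun h => (OnePoint.coe_ne_infty v h).elim⟩
    | coe w =>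
      have h1 := hs v
      have h2 := hs w
      simp only [det2, rep_coe, OnePoint.coe_eq_coe, ofReal_inv]
      rw [show ((Real.sqrt (1 + ‖v‖ ^ 2) : ℝ) : ℂ)⁻¹ * (((Real.sqrt (1 + ‖w‖ ^ 2) : ℝ) : ℂ)⁻¹ * w) -
        ((Real.sqrt (1 + ‖v‖ ^ 2) : ℝ) : ℂ)⁻¹ * v * ((Real.sqrt (1 + ‖w‖ ^ 2) : ℝ) : ℂ)⁻¹ =
        (((Real.sqrt (1 + ‖v‖ ^ 2) : ℝ) : ℂ)⁻¹ * ((Real.sqrt (1 + ‖w‖ ^ 2) : ℝ) : ℂ)⁻¹) * (w - v) by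
          ring]
      simp only [mul_eq_zero, inv_eq_zero, h1, h2, false_or, sub_eq_zero]
      exact eq_comm

lemma exists_eq_smul_rep_ratio {a : ℂ × ℂ} (ha : a ≠ 0) :
    ∃ c : ℂ, c ≠ 0 ∧ a = c • rep (ratio a.2 a.1) := by
  by_cases h : a.1 = 0
  · refine ⟨a.2, fun h2 => ha (Prod.ext h h2), ?_⟩
    rw [ratio, if_pos h, rep_infty]
    ext <;> simp [h]
  · have hs : ((Real.sqrt (1 + ‖a.2 / a.1‖ ^ 2) : ℝ) : ℂ) ≠ 0 := by
      have h : 0 < 1 + ‖a.2 / a.1‖ ^ 2 := by positivity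
      exact_mod_cast (Real.sqrt_pos.2 h).ne'
    refine ⟨a.1 * (Real.sqrt (1 + ‖a.2 / a.1‖ ^ 2) : ℝ), mul_ne_zero h hs, ?_⟩
    rw [ratio, if_neg h, rep_coe]
    ext
    · simp only [Prod.smul_mk, smul_eq_mul, ofReal_inv]; field_simp
    · simp only [Prod.smul_mk, smul_eq_mul, ofReal_inv]; field_simp

/-- The holomorphic curve `a` in `ℂ² \ {0}` gives homogeneous coordinates of `G` near `z`. -/
structure IsLift (G : ℂ → OnePoint ℂ) (a : ℂ → ℂ × ℂ) (z : ℂ) : Prop where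
  an : AnalyticAt ℂ a z
  ne : a z ≠ 0
  eq : ∀ᶠ w in 𝓝 z, ∃ c : ℂ, c ≠ 0 ∧ a w = c • rep (G w)

namespace IsLift

variable {G H : ℂ → OnePoint ℂ} {a b : ℂ → ℂ × ℂ} {z : ℂ}

lemma eventually (h : IsLift G a z) : ∀ᶠ w in 𝓝 z, IsLift G a w := by
  filter_upwards [h.an.eventually_analyticAt, h.an.continuousAt.eventually_ne h.ne,
    h.eq.eventually_nhds] with w h1 h2 h3 using ⟨h1, h2, h3⟩

lemma congr (h : IsLift G a z) (hG : G =ᶠ[𝓝 z] H) : IsLift H a z :=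
  ⟨h.an, h.ne, by filter_upwards [h.eq, hG] with w h1 h2 using h2 ▸ h1⟩

lemma const (v : OnePoint ℂ) (z : ℂ) : IsLift (fun _ => v) (fun _ => rep v) z := by
  refine ⟨analyticAt_const, fun h => ?_, Eventually.of_forall fun _ => ⟨1, one_ne_zero, by simp⟩⟩
  have := nsq_rep v
  simp [h, nsq] at this

lemma comp {f : ℂ → ℂ} (h : IsLift G a (f z)) (hf : AnalyticAt ℂ f z) :
    IsLift (G ∘ f) (a ∘ f) z :=
  ⟨h.an.comp hf, h.ne, hf.continuousAt.eventually h.eq⟩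

lemma norm_det2_sq (h : IsLift G a z) (v : OnePoint ℂ) :
    ‖det2 (rep v) (a z)‖ ^ 2 = nsq (a z) * chordSq v (G z) := by
  obtain ⟨c, -, hac⟩ := h.eq.self_of_nhds
  rw [hac, det2_smul_right, nsq_smul, nsq_rep, chordSq, norm_mul]
  ring

lemma det2_eq_zero_iff (h : IsLift G a z) (v : OnePoint ℂ) :
    det2 (rep v) (a z) = 0 ↔ G z = v := by
  rw [← norm_eq_zero, ← sq_eq_zero_iff, h.norm_det2_sq, mul_eq_zero_iff_left (nsq_pos h.ne).ne',
    chordSq_eq_zero_iff, eq_comm]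

lemma norm_det2_sq' {z' : ℂ} (h : IsLift G a z) (k : IsLift H b z') :
    ‖det2 (a z) (b z')‖ ^ 2 = nsq (a z) * nsq (b z') * chordSq (G z) (H z') := by
  obtain ⟨c, -, hac⟩ := h.eq.self_of_nhds
  obtain ⟨d, -, hbd⟩ := k.eq.self_of_nhds
  rw [hac, hbd, det2_smul_right, det2_smul_left, nsq_smul, nsq_smul, nsq_rep, nsq_rep, chordSq,
    norm_mul, norm_mul]
  ring

lemma det2_eq_zero_iff' (h : IsLift G a z) (k : IsLift H b z) :
    det2 (a z) (b z) = 0 ↔ G z = H z := by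
  rw [← norm_eq_zero, ← sq_eq_zero_iff, h.norm_det2_sq' k,
    mul_eq_zero_iff_left (mul_pos (nsq_pos h.ne) (nsq_pos k.ne)).ne', chordSq_eq_zero_iff]

lemma an_fst (h : IsLift G a z) : AnalyticAt ℂ (fun w => (a w).1) z := analyticAt_fst.comp h.an

lemma an_snd (h : IsLift G a z) : AnalyticAt ℂ (fun w => (a w).2) z := analyticAt_snd.comp h.an

end IsLift

lemma analyticAt_det2 {a b : ℂ → ℂ × ℂ} {z : ℂ} (ha : AnalyticAt ℂ a z) (hb : AnalyticAt ℂ b z) :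
    AnalyticAt ℂ (fun w => det2 (a w) (b w)) z :=
  ((analyticAt_fst.comp ha).mul (analyticAt_snd.comp hb)).sub
    ((analyticAt_snd.comp ha).mul (analyticAt_fst.comp hb))

lemma deriv_pair {a : ℂ → ℂ × ℂ} {z : ℂ} (ha : AnalyticAt ℂ a z) :
    deriv a z = (deriv (fun w => (a w).1) z, deriv (fun w => (a w).2) z) := by
  have h1 : AnalyticAt ℂ (fun w => (a w).1) z := analyticAt_fst.comp ha
  have h2 : AnalyticAt ℂ (fun w => (a w).2) z := analyticAt_snd.comp ha
  exact (h1.differentiableAt.hasDerivAt.prodMk h2.differentiableAt.hasDerivAt).deriv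

lemma hasDerivAt_det2_const {a : ℂ → ℂ × ℂ} {z : ℂ} (l : ℂ × ℂ) (ha : AnalyticAt ℂ a z) :
    HasDerivAt (fun w => det2 l (a w)) (det2 l (deriv a z)) z := by
  have h1 : AnalyticAt ℂ (fun w => (a w).1) z := analyticAt_fst.comp ha
  have h2 : AnalyticAt ℂ (fun w => (a w).2) z := analyticAt_snd.comp ha
  rw [deriv_pair ha]
  exact (h2.differentiableAt.hasDerivAt.const_mul l.1).sub
    (h1.differentiableAt.hasDerivAt.const_mul l.2)

/-- The Wronskian `a₁ a₂' - a₂ a₁'` of a curve in `ℂ²`. -/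
def wronskian (a : ℂ → ℂ × ℂ) (z : ℂ) : ℂ := det2 (a z) (deriv a z)

lemma analyticAt_wronskian {a : ℂ → ℂ × ℂ} {z : ℂ} (ha : AnalyticAt ℂ a z) :
    AnalyticAt ℂ (wronskian a) z := analyticAt_det2 ha ha.deriv

/-! ### Laplacians of the functions attached to a lift -/

section Laplacian

variable {a : ℂ → ℂ × ℂ} {z : ℂ}

/-- The Hermitian product of `a'` and `a`. -/
def hermDeriv (a : ℂ → ℂ × ℂ) (z : ℂ) : ℂ :=
  (deriv a z).1 * conj (a z).1 + (deriv a z).2 * conj (a z).2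

lemma hasLap_log_nsq (ha : AnalyticAt ℂ a z) (h0 : a z ≠ 0) :
    ∃ G, HasLap (fun w => Real.log (nsq (a w))) G z (4 * (‖wronskian a z‖ ^ 2 / nsq (a z) ^ 2)) ∧
      G z = 2 * hermDeriv a z / nsq (a z) := by
  have hN := nsq_pos h0
  have h1 : AnalyticAt ℂ (fun w => (a w).1) z := analyticAt_fst.comp ha
  have h2 : AnalyticAt ℂ (fun w => (a w).2) z := analyticAt_snd.comp ha
  have h := ((HasLap.normSq h1).add (HasLap.normSq h2)).log (by exact hN.ne')
  have hd := deriv_pair ha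
  have hG : (2 * (deriv (fun w => (a w).1) z * conj (a z).1) +
      2 * (deriv (fun w => (a w).2) z * conj (a z).2)) = 2 * hermDeriv a z := by
    rw [hermDeriv, hd]; ring
  refine ⟨_, h.congr_lap ?_, ?_⟩
  · rw [hG]
    change _ / nsq (a z) - _ / nsq (a z) ^ 2 = _
    have key : ‖hermDeriv a z‖ ^ 2 =
        (‖(deriv a z).1‖ ^ 2 + ‖(deriv a z).2‖ ^ 2) * nsq (a z) - ‖wronskian a z‖ ^ 2 := by
      have := norm_det2_sq_add (deriv a z) (a z)
      rw [det2_swap, norm_neg] at this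
      rw [hermDeriv, wronskian]
      simp only [nsq] at this ⊢
      linarith
    rw [norm_mul, mul_pow, key, hd]
    simp only [Complex.norm_ofNat]
    field_simp
    ring
  · change (((nsq (a z))⁻¹ : ℝ) : ℂ) * _ = _
    rw [hG, ofReal_inv]
    field_simp

/-- The Laplacian of a power of the chordal distance to a fixed point. -/
lemma hasLap_chord_rpow (ha : AnalyticAt ℂ a z) {l : ℂ × ℂ} (hl : nsq l = 1)
    (h0 : det2 l (a z) ≠ 0) {x : ℝ} (hx : x = ‖det2 l (a z)‖ ^ 2 / nsq (a z)) (δ : ℝ) :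
    ∃ G, HasLap (fun w => (‖det2 l (a w)‖ ^ 2 / nsq (a w)) ^ δ) G z
      (4 * (‖wronskian a z‖ ^ 2 / nsq (a z) ^ 2) * (δ ^ 2 * x ^ (δ - 1) - (δ + δ ^ 2) * x ^ δ)) := by
  have hne : a z ≠ 0 := by
    intro h; rw [h] at h0; simp [det2] at h0
  have hN := nsq_pos hne
  have hdet : AnalyticAt ℂ (fun w => det2 l (a w)) z := analyticAt_det2 analyticAt_const ha
  have hpos : 0 < ‖det2 l (a z)‖ ^ 2 := by have := norm_pos_iff.2 h0; positivity
  obtain ⟨G₁, hG₁, hG₁z⟩ := hasLap_log_nsq ha hne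
  have hlog := ((HasLap.normSq hdet).log hpos.ne').add (hG₁.const_mul (-1))
  have hexp := (hlog.const_mul δ).exp
  refine ⟨_, (hexp.congr ?_).congr_lap ?_⟩
  · filter_upwards [hdet.continuousAt.eventually_ne h0, ha.continuousAt.eventually_ne hne]
      with w hw hw'
    have h1 : 0 < ‖det2 l (a w)‖ ^ 2 := by have := norm_pos_iff.2 hw; positivity
    have h2 := nsq_pos hw'
    rw [Real.rpow_def_of_pos (by positivity), Real.log_div h1.ne' h2.ne']
    congr 1; ring
  · have hxpos : 0 < x := by rw [hx]; positivity
    have hxδ : Real.exp (δ * (Real.log (‖det2 l (a z)‖ ^ 2) + -1 * Real.log (nsq (a z)))) =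
        x ^ δ := by
      rw [hx, Real.rpow_def_of_pos (by positivity), Real.log_div hpos.ne' hN.ne']
      congr 1; ring
    rw [hxδ, hG₁z, (hasDerivAt_det2_const l ha).deriv, Real.rpow_sub hxpos, Real.rpow_one]
    -- the gradient of the logarithm of the chordal distance
    have hgrad : ((((‖det2 l (a z)‖ ^ 2)⁻¹ : ℝ) : ℂ) *
        (2 * (det2 l (deriv a z) * conj (det2 l (a z)))) +
        ((-1 : ℝ) : ℂ) * (2 * hermDeriv a z / nsq (a z))) =
        2 * wronskian a z * (l.1 * conj (a z).1 + l.2 * conj (a z).2) /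
          (det2 l (a z) * nsq (a z)) := by
      have hd : (((‖det2 l (a z)‖ ^ 2)⁻¹ : ℝ) : ℂ) =
          (det2 l (a z) * conj (det2 l (a z)))⁻¹ := by
        rw [Complex.mul_conj, Complex.normSq_eq_norm_sq, ofReal_inv]
      have hn : ((nsq (a z) : ℝ) : ℂ) = (a z).1 * conj (a z).1 + (a z).2 * conj (a z).2 := by
        rw [Complex.mul_conj, Complex.mul_conj, Complex.normSq_eq_norm_sq,
          Complex.normSq_eq_norm_sq, nsq, ofReal_add]
      have hn0 : ((nsq (a z) : ℝ) : ℂ) ≠ 0 := by exact_mod_cast hN.ne'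
      have hc0 : conj (det2 l (a z)) ≠ 0 := by simpa using h0
      rw [hd]
      have e1 : (det2 l (a z) * conj (det2 l (a z)))⁻¹ *
          (2 * (det2 l (deriv a z) * conj (det2 l (a z)))) +
          ((-1 : ℝ) : ℂ) * (2 * hermDeriv a z / nsq (a z)) =
          2 * (det2 l (deriv a z) * nsq (a z) - det2 l (a z) * hermDeriv a z) /
            (det2 l (a z) * nsq (a z)) := by
        push_cast
        field_simp
        ring
      rw [e1]
      congr 1
      rw [hn]
      simp only [det2, hermDeriv, wronskian]
      ring
    have hL := norm_det2_sq_add l (a z)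
    rw [hl, one_mul] at hL
    have hhx : ‖det2 l (a z)‖ ^ 2 = x * nsq (a z) := by rw [hx]; field_simp
    have hL' : ‖l.1 * conj (a z).1 + l.2 * conj (a z).2‖ ^ 2 = nsq (a z) - x * nsq (a z) := by
      linarith
    have hQ : ‖2 * wronskian a z * (l.1 * conj (a z).1 + l.2 * conj (a z).2) /
          (det2 l (a z) * nsq (a z))‖ ^ 2 =
        4 * ‖wronskian a z‖ ^ 2 * (nsq (a z) - x * nsq (a z)) /
          (x * nsq (a z) * nsq (a z) ^ 2) := by
      rw [norm_div, norm_mul, norm_mul, norm_mul, div_pow, mul_pow, mul_pow, mul_pow, hL', hhx,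
        Complex.norm_real, Real.norm_of_nonneg hN.le, Complex.norm_ofNat]
      norm_num
    have e4 : ‖2 * (det2 l (deriv a z) * conj (det2 l (a z)))‖ ^ 2 =
        4 * ‖det2 l (deriv a z)‖ ^ 2 * ‖det2 l (a z)‖ ^ 2 := by
      rw [norm_mul, norm_mul, Complex.norm_conj, Complex.norm_ofNat]; ring
    rw [hgrad, norm_mul (δ : ℂ), mul_pow, hQ, e4, hhx, Complex.norm_real, Real.norm_eq_abs, sq_abs]
    field_simp
    ring

/-- A weighted sum of `log |a|²` and powers of chordal distances has a Laplacian that is large near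
the given points of the sphere. -/
lemma hasLap_curvature (ha : AnalyticAt ℂ a z) (V : Finset (OnePoint ℂ))
    (h0 : ∀ v ∈ V, det2 (rep v) (a z) ≠ 0) (hne : a z ≠ 0) {δ η κ : ℝ} (hδ : 0 < δ) (hη : 0 < η)
    (hκ : 2 * η * V.card * (δ + δ ^ 2) ≤ κ) :
    ∃ G L, HasLap (fun w => κ / 2 * Real.log (nsq (a w)) +
        η * ∑ v ∈ V, (‖det2 (rep v) (a w)‖ ^ 2 / nsq (a w)) ^ δ) G z L ∧
      4 * η * δ ^ 2 * (‖wronskian a z‖ ^ 2 / nsq (a z) ^ 2) *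
        ∑ v ∈ V, (‖det2 (rep v) (a z)‖ ^ 2 / nsq (a z)) ^ (δ - 1) ≤ L := by
  classical
  have hN := nsq_pos hne
  obtain ⟨G₁, hG₁, -⟩ := hasLap_log_nsq ha hne
  have hG : ∀ v, ∃ G, v ∈ V → HasLap (fun w => (‖det2 (rep v) (a w)‖ ^ 2 / nsq (a w)) ^ δ) G z _ :=
    fun v => by
      by_cases hv : v ∈ V
      · obtain ⟨G, h⟩ := hasLap_chord_rpow ha (nsq_rep v) (h0 v hv) rfl δ
        exact ⟨G, fun _ => h⟩
      · exact ⟨0, fun h => (hv h).elim⟩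
  choose G hG using hG
  refine ⟨_, _, (hG₁.const_mul (κ / 2)).add ((HasLap.sum V hG).const_mul η), ?_⟩
  set K := ‖wronskian a z‖ ^ 2 / nsq (a z) ^ 2 with hK
  have hK0 : 0 ≤ K := by positivity
  rw [← Finset.mul_sum, Finset.sum_sub_distrib, ← Finset.mul_sum, ← Finset.mul_sum]
  have hle : ∑ v ∈ V, (‖det2 (rep v) (a z)‖ ^ 2 / nsq (a z)) ^ δ ≤ V.card := by
    calc _ ≤ ∑ v ∈ V, (1 : ℝ) := by
          refine Finset.sum_le_sum fun v _ => ?_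
          refine Real.rpow_le_one (by positivity) ?_ hδ.le
          rw [div_le_one hN]
          have := norm_det2_sq_le (rep v) (a z)
          rwa [nsq_rep, one_mul] at this
      _ = _ := by simp
  set A := ∑ v ∈ V, (‖det2 (rep v) (a z)‖ ^ 2 / nsq (a z)) ^ δ
  have h1 : 4 * η * (δ + δ ^ 2) * A ≤ 2 * κ := by
    have : 4 * η * (δ + δ ^ 2) * A ≤ 4 * η * (δ + δ ^ 2) * V.card := by gcongr
    linarith
  nlinarith [mul_le_mul_of_nonneg_left h1 hK0]

end Laplacian

/-- Since at most one of finitely many points of the sphere is close to `y`, a product of negative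
powers of chordal distances is dominated by the sum of these powers. -/
lemma exists_prod_le_sum (V : Finset (OnePoint ℂ)) (hV : V.Nonempty) {m : ℝ} (hm : 0 ≤ m) :
    ∃ C > 0, ∀ y ∉ V, ∏ v ∈ V, chordSq v y ^ (-m) ≤ C * ∑ v ∈ V, chordSq v y ^ (-m) := by
  classical
  -- a quarter of the least squared distance of two points
  obtain ⟨d, hd0, hd⟩ : ∃ d > 0, ∀ v ∈ V, ∀ w ∈ V, v ≠ w → d ≤ chordSq v w := by
    by_cases h : V.offDiag.Nonempty
    · obtain ⟨⟨v, w⟩, hvw, hmin⟩ := V.offDiag.exists_min_image (fun x => chordSq x.1 x.2) h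
      refine ⟨chordSq v w, ?_, fun v' hv' w' hw' hne => hmin (v', w') ?_⟩
      · refine (chordSq_nonneg _ _).lt_of_ne fun h => ?_
        have := chordSq_eq_zero_iff.1 h.symm
        exact (Finset.mem_offDiag.1 hvw).2.2 this
      · exact Finset.mem_offDiag.2 ⟨hv', hw', hne⟩
    · refine ⟨1, one_pos, fun v hv w hw hne => (h ⟨(v, w), ?_⟩).elim⟩
      exact Finset.mem_offDiag.2 ⟨hv, hw, hne⟩
  -- the triangle inequality, in the form `chordSq v w ≤ 2 (chordSq v y + chordSq w y)`
  have htri : ∀ v w y : OnePoint ℂ, chordSq v w ≤ 2 * (chordSq v y + chordSq w y) := by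
    intro v w y
    have hy := nsq_rep y
    have hv := norm_det2_sq_add (rep v) (rep y)
    have hw := norm_det2_sq_add (rep w) (rep y)
    rw [nsq_rep, nsq_rep, one_mul] at hv hw
    set A := (rep v).1 * conj (rep y).1 + (rep v).2 * conj (rep y).2
    set B := (rep w).1 * conj (rep y).1 + (rep w).2 * conj (rep y).2
    have hone : (rep y).1 * conj (rep y).1 + (rep y).2 * conj (rep y).2 = 1 := by
      rw [Complex.mul_conj, Complex.mul_conj, Complex.normSq_eq_norm_sq,
          Complex.normSq_eq_norm_sq]
      exact_mod_cast hy
    have hid : det2 (rep v) (rep w) = det2 (rep v) (rep y) * B - det2 (rep w) (rep y) * A := by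
      have : det2 (rep v) (rep w) = det2 (rep v) (rep w) *
          ((rep y).1 * conj (rep y).1 + (rep y).2 * conj (rep y).2) := by rw [hone, mul_one]
      rw [this]
      simp only [det2, A, B]
      ring
    have hA : ‖A‖ ≤ 1 := by
      rw [← sq_le_one_iff₀ (norm_nonneg _)]; nlinarith [sq_nonneg ‖det2 (rep v) (rep y)‖]
    have hB : ‖B‖ ≤ 1 := by
      rw [← sq_le_one_iff₀ (norm_nonneg _)]; nlinarith [sq_nonneg ‖det2 (rep w) (rep y)‖]
    have h1 : ‖det2 (rep v) (rep w)‖ ≤ ‖det2 (rep v) (rep y)‖ + ‖det2 (rep w) (rep y)‖ := by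
      rw [hid]
      refine (norm_sub_le _ _).trans ?_
      rw [norm_mul, norm_mul]
      have := norm_nonneg (det2 (rep v) (rep y))
      have := norm_nonneg (det2 (rep w) (rep y))
      nlinarith
    simp only [chordSq]
    have := norm_nonneg (det2 (rep v) (rep w))
    nlinarith [sq_nonneg (‖det2 (rep v) (rep y)‖ - ‖det2 (rep w) (rep y)‖)]
  set M := max 1 ((d / 4) ^ (-m)) with hM
  have hM1 : 1 ≤ M := le_max_left _ _
  refine ⟨M ^ V.card, by positivity, fun y hy => ?_⟩
  have hpos : ∀ v ∈ V, 0 < chordSq v y := fun v hv =>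
    (chordSq_nonneg _ _).lt_of_ne fun h => hy (chordSq_eq_zero_iff.1 h.symm ▸ hv)
  obtain ⟨v₀, hv₀, hmin⟩ := V.exists_min_image (fun v => chordSq v y) hV
  have hfar : ∀ v ∈ V.erase v₀, chordSq v y ^ (-m) ≤ M := by
    intro v hv
    have hv' := Finset.mem_of_mem_erase hv
    have h1 := hd v hv' v₀ hv₀ (Finset.ne_of_mem_erase hv)
    have h2 := htri v v₀ y
    have h3 := hmin v hv'
    refine le_trans ?_ (le_max_right _ _)
    refine Real.rpow_le_rpow_of_nonpos (by positivity) ?_ (by linarith)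
    linarith
  have hone : 1 ≤ chordSq v₀ y ^ (-m) :=
    Real.one_le_rpow_of_pos_of_le_one_of_nonpos (hpos v₀ hv₀) (chordSq_le_one _ _) (by linarith)
  have hnn : ∀ v ∈ V, 0 ≤ chordSq v y ^ (-m) := fun v hv =>
    Real.rpow_nonneg (chordSq_nonneg _ _) _
  rw [← Finset.mul_prod_erase V _ hv₀]
  have h1 : ∏ v ∈ V.erase v₀, chordSq v y ^ (-m) ≤ M ^ V.card := by
    calc _ ≤ M ^ (V.erase v₀).card :=
          (Finset.prod_le_prod (fun v hv => hnn v (Finset.mem_of_mem_erase hv)) hfar).trans_eq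
            (by rw [Finset.prod_const])
      _ ≤ M ^ V.card := pow_le_pow_right₀ hM1 (Finset.card_le_card (Finset.erase_subset _ _))
  have h2 : chordSq v₀ y ^ (-m) ≤ ∑ v ∈ V, chordSq v y ^ (-m) :=
    Finset.single_le_sum hnn hv₀
  rw [mul_comm]
  gcongr

/-! ### Real parts of holomorphic functions and growth near a zero -/

/-- Near `z`, the function `u` is the real part of a holomorphic function. -/
def IsReHol (u : ℂ → ℝ) (z : ℂ) : Prop :=
  ∃ F : ℂ → ℂ, AnalyticAt ℂ F z ∧ u =ᶠ[𝓝 z] fun w => (F w).re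

namespace IsReHol

variable {u v : ℂ → ℝ} {z : ℂ}

lemma add (hu : IsReHol u z) (hv : IsReHol v z) : IsReHol (fun w => u w + v w) z := by
  obtain ⟨F, hF, hu⟩ := hu
  obtain ⟨G, hG, hv⟩ := hv
  refine ⟨_, hF.add hG, ?_⟩
  filter_upwards [hu, hv] with w h1 h2
  simp [h1, h2]

lemma const_mul (c : ℝ) (hu : IsReHol u z) : IsReHol (fun w => c * u w) z := by
  obtain ⟨F, hF, hu⟩ := hu
  refine ⟨_, (analyticAt_const (v := (c : ℂ))).mul hF, ?_⟩
  filter_upwards [hu] with w h1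
  simp [h1]

lemma const (c : ℝ) : IsReHol (fun _ => c) z :=
  ⟨fun _ => (c : ℂ), analyticAt_const, Eventually.of_forall fun _ => by simp⟩

lemma congr (hu : IsReHol u z) (huv : u =ᶠ[𝓝 z] v) : IsReHol v z := by
  obtain ⟨F, hF, hu⟩ := hu
  exact ⟨F, hF, huv.symm.trans hu⟩

lemma sum {ι : Type*} (s : Finset ι) {u : ι → ℂ → ℝ} (h : ∀ i ∈ s, IsReHol (u i) z) :
    IsReHol (fun w => ∑ i ∈ s, u i w) z := by
  classical
  induction s using Finset.induction_on with
  | empty => simpa using const (z := z) 0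
  | insert a s ha ih =>
    simp only [Finset.sum_insert ha]
    exact (h a (by simp)).add (ih fun i hi => h i (by simp [hi]))

lemma log_norm {f : ℂ → ℂ} (hf : AnalyticAt ℂ f z) (h0 : f z ≠ 0) :
    IsReHol (fun w => Real.log ‖f w‖) z := by
  have h1 : f z / f z ∈ slitPlane := by rw [div_self h0]; exact one_mem_slitPlane
  refine ⟨fun w => Complex.log (f w / f z) + (Real.log ‖f z‖ : ℝ),
    ((hf.div analyticAt_const h0).clog h1).add analyticAt_const, ?_⟩
  filter_upwards [hf.continuousAt.eventually_ne h0] with w hw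
  rw [add_re, ofReal_re, Complex.log_re, norm_div,
    Real.log_div (norm_ne_zero_iff.2 hw) (norm_ne_zero_iff.2 h0)]
  ring

lemma exists_hasLap (hu : IsReHol u z) : ∃ G, HasLap u G z 0 := by
  obtain ⟨F, hF, hu⟩ := hu
  exact ⟨_, (HasLap.re hF).congr hu.symm⟩

end IsReHol

section Growth

variable {f : ℂ → ℂ} {z₀ : ℂ}

lemma exists_eventually_le {A : Type*} [TopologicalSpace A] {u : A → ℝ} {x : A}
    (hu : ContinuousAt u x) : ∃ C, ∀ᶠ z in 𝓝 x, u z ≤ C :=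
  ⟨u x + 1, (hu.eventually (gt_mem_nhds (lt_add_one _))).mono fun _ h => h.le⟩

lemma log_norm_le (hf : AnalyticAt ℂ f z₀) :
    ∃ C, ∀ᶠ z in 𝓝 z₀, f z ≠ 0 → Real.log ‖f z‖ ≤ C := by
  obtain ⟨C, hC⟩ := exists_eventually_le hf.continuousAt.norm
  exact ⟨Real.log C, hC.mono fun z hz h0 => Real.log_le_log (norm_pos_iff.2 h0) hz⟩

lemma log_norm_le_of_zero (hf : AnalyticAt ℂ f z₀) (h0 : f z₀ = 0) :
    ∃ C, ∀ᶠ z in 𝓝 z₀, f z ≠ 0 → Real.log ‖f z‖ ≤ Real.log ‖z - z₀‖ + C := by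
  obtain ⟨K, hK⟩ := hf.differentiableAt.isBigO_sub.bound
  refine ⟨Real.log (max K 1), hK.mono fun z hz hfz => ?_⟩
  rw [h0, sub_zero] at hz
  have hne : z - z₀ ≠ 0 := by
    intro h
    rw [sub_eq_zero] at h
    exact hfz (h ▸ h0)
  have hpos := norm_pos_iff.2 hne
  have hm : 0 < max K 1 := lt_max_of_lt_right one_pos
  rw [← Real.log_mul hpos.ne' hm.ne']
  refine Real.log_le_log (norm_pos_iff.2 hfz) (hz.trans ?_)
  rw [mul_comm]
  gcongr
  exact le_max_left _ _

/-- The logarithmic derivative has at most a simple pole. -/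
lemma norm_sub_mul_norm_deriv_le (hf : AnalyticAt ℂ f z₀) (hne : ¬ ∀ᶠ z in 𝓝 z₀, f z = 0) :
    ∃ C > 0, ∀ᶠ z in 𝓝 z₀, ‖z - z₀‖ * ‖deriv f z‖ ≤ C * ‖f z‖ := by
  obtain ⟨n, g, hg, hg0, hev⟩ := hf.exists_eventuallyEq_pow_smul_nonzero_iff.2 hne
  have hlogd : ContinuousAt (fun z => (n : ℝ) + ‖z - z₀‖ * ‖deriv g z‖ / ‖g z‖) z₀ := by
    have h1 := hg.continuousAt
    have h2 := hg.deriv.continuousAt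
    have h3 := norm_ne_zero_iff.2 hg0
    fun_prop (disch := assumption)
  obtain ⟨C, hC⟩ := exists_eventually_le hlogd
  refine ⟨max C 1, lt_max_of_lt_right one_pos, ?_⟩
  filter_upwards [hev.eventually_nhds, hg.eventually_analyticAt,
    hg.continuousAt.eventually_ne hg0, hC] with z hz hga hgz hCz
  have hd : deriv f z = n * (z - z₀) ^ (n - 1) * g z + (z - z₀) ^ n * deriv g z := by
    have h1 : HasDerivAt (fun z => (z - z₀) ^ n) (n * (z - z₀) ^ (n - 1) * 1) z :=
      ((hasDerivAt_id z).sub_const z₀).pow n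
    have h2 := h1.mul hga.differentiableAt.hasDerivAt
    rw [(h2.congr_of_eventuallyEq hz :).deriv]; ring
  have hfz := hz.self_of_nhds
  have hkey : (z - z₀) * deriv f z = (z - z₀) ^ n * (n * g z + (z - z₀) * deriv g z) := by
    rw [hd]
    rcases n with _ | n
    · simp
    · simp only [Nat.add_sub_cancel]; ring
  have hgpos := norm_pos_iff.2 hgz
  rw [← norm_mul, hkey, hfz, smul_eq_mul, norm_mul, norm_mul]
  calc ‖(z - z₀) ^ n‖ * ‖n * g z + (z - z₀) * deriv g z‖
      ≤ ‖(z - z₀) ^ n‖ * (((n : ℝ) + ‖z - z₀‖ * ‖deriv g z‖ / ‖g z‖) * ‖g z‖) := by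
        gcongr
        refine (norm_add_le _ _).trans_eq ?_
        rw [norm_mul, norm_mul, Complex.norm_natCast]
        field_simp
    _ ≤ ‖(z - z₀) ^ n‖ * (max C 1 * ‖g z‖) := by
        gcongr
        exact hCz.trans (le_max_left _ _)
    _ = _ := by ring

end Growth

/-! ### The logarithm of the weighted spherical derivative -/

/-- The logarithm of `|a|^((1 - ε) q - 2) |W| ∏ |L_v|^{ε - 1}`, where `W` is the Wronskian of the
lift `a` and `L_v` are the linear forms which vanish at the `q` points of `V`. -/
def liftLog (V : Finset (OnePoint ℂ)) (ε : ℝ) (a : ℂ → ℂ × ℂ) (z : ℂ) : ℝ :=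
  Real.log ‖wronskian a z‖ - (1 - ε) * ∑ v ∈ V, Real.log ‖det2 (rep v) (a z)‖ +
    ((1 - ε) * V.card / 2 - 1) * Real.log (nsq (a z))

section LiftLog

variable {V : Finset (OnePoint ℂ)} {ε : ℝ} {a : ℂ → ℂ × ℂ} {z₀ : ℂ}

lemma continuousAt_log_nsq (ha : AnalyticAt ℂ a z₀) (h0 : a z₀ ≠ 0) :
    ContinuousAt (fun z => Real.log (nsq (a z))) z₀ := by
  obtain ⟨G, h, -⟩ := hasLap_log_nsq ha h0
  exact h.continuousAt

lemma continuousAt_log_det2 (ha : AnalyticAt ℂ a z₀) {l : ℂ × ℂ} (h0 : det2 l (a z₀) ≠ 0) :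
    ContinuousAt (fun z => Real.log ‖det2 l (a z)‖) z₀ :=
  (analyticAt_det2 analyticAt_const ha).continuousAt.norm.log (norm_ne_zero_iff.2 h0)

lemma liftLog_le_of_ne (ha : AnalyticAt ℂ a z₀) (h0 : a z₀ ≠ 0)
    (hV : ∀ v ∈ V, det2 (rep v) (a z₀) ≠ 0) :
    (∃ C, ∀ᶠ z in 𝓝 z₀, wronskian a z ≠ 0 → liftLog V ε a z ≤ C) ∧
      (wronskian a z₀ = 0 →
        ∃ C, ∀ᶠ z in 𝓝 z₀, wronskian a z ≠ 0 → liftLog V ε a z ≤ Real.log ‖z - z₀‖ + C) := by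
  have hcont : ContinuousAt (fun z => ((1 - ε) * V.card / 2 - 1) * Real.log (nsq (a z)) -
      (1 - ε) * ∑ v ∈ V, Real.log ‖det2 (rep v) (a z)‖) z₀ :=
    (continuousAt_const.mul (continuousAt_log_nsq ha h0)).sub (continuousAt_const.mul
      (tendsto_finsetSum V fun v hv => (continuousAt_log_det2 ha (hV v hv)).tendsto))
  obtain ⟨C, hC⟩ := exists_eventually_le hcont
  constructor
  · obtain ⟨C', hC'⟩ := log_norm_le (analyticAt_wronskian ha)
    refine ⟨C + C', ?_⟩
    filter_upwards [hC, hC'] with z h1 h2 h3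
    have := h2 h3
    unfold liftLog
    linarith
  · intro hW
    obtain ⟨C', hC'⟩ := log_norm_le_of_zero (analyticAt_wronskian ha) hW
    refine ⟨C + C', ?_⟩
    filter_upwards [hC, hC'] with z h1 h2 h3
    have := h2 h3
    unfold liftLog
    linarith

/-- For a unit vector `l`, the Wronskian of `a` is that of the two coordinates of `a` in an
orthonormal frame the first of whose linear forms is `det2 l`. -/
lemma wronskian_eq {l : ℂ × ℂ} (hl : nsq l = 1) (b c : ℂ × ℂ) :
    det2 b c = det2 l b * det2 (-conj l.2, conj l.1) c -
      det2 (-conj l.2, conj l.1) b * det2 l c := by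
  have h : l.1 * conj l.1 + l.2 * conj l.2 = 1 := by
    rw [Complex.mul_conj, Complex.mul_conj, Complex.normSq_eq_norm_sq, Complex.normSq_eq_norm_sq]
    exact_mod_cast hl
  calc det2 b c = (l.1 * conj l.1 + l.2 * conj l.2) * det2 b c := by rw [h, one_mul]
    _ = _ := by simp only [det2]; ring

lemma liftLog_le_of_zero (hε0 : 0 < ε) (ha : AnalyticAt ℂ a z₀) (h0 : a z₀ ≠ 0)
    {v₀ : OnePoint ℂ} (hv₀ : v₀ ∈ V) (hz : det2 (rep v₀) (a z₀) = 0)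
    (hV : ∀ v ∈ V, v ≠ v₀ → det2 (rep v) (a z₀) ≠ 0)
    (hne : ¬ ∀ᶠ z in 𝓝 z₀, det2 (rep v₀) (a z) = 0) :
    ∃ C, ∀ᶠ z in 𝓝 z₀, wronskian a z ≠ 0 → det2 (rep v₀) (a z) ≠ 0 →
      liftLog V ε a z ≤ (ε - 1) * Real.log ‖z - z₀‖ + C := by
  classical
  have hcont : ContinuousAt (fun z => ((1 - ε) * V.card / 2 - 1) * Real.log (nsq (a z)) -
      (1 - ε) * ∑ v ∈ V.erase v₀, Real.log ‖det2 (rep v) (a z)‖) z₀ :=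
    (continuousAt_const.mul (continuousAt_log_nsq ha h0)).sub (continuousAt_const.mul
      (tendsto_finsetSum _ fun v hv => (continuousAt_log_det2 ha
        (hV v (Finset.mem_of_mem_erase hv) (Finset.ne_of_mem_erase hv))).tendsto))
  obtain ⟨C, hC⟩ := exists_eventually_le hcont
  set l := rep v₀ with hl
  set m : ℂ × ℂ := (-conj l.2, conj l.1) with hm
  have hdet : AnalyticAt ℂ (fun z => det2 l (a z)) z₀ := analyticAt_det2 analyticAt_const ha
  obtain ⟨C₁, hC₁⟩ := log_norm_le_of_zero hdet hz
  obtain ⟨K, hK0, hK⟩ := norm_sub_mul_norm_deriv_le hdet hne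
  -- the Wronskian is bounded by a multiple of `|L| / |z - z₀|`
  have hcb : ContinuousAt (fun z => ‖z - z₀‖ * ‖det2 m (deriv a z)‖ + ‖det2 m (a z)‖ * K) z₀ := by
    have h1 := (analyticAt_det2 (analyticAt_const (v := m)) ha).continuousAt
    have h2 := (analyticAt_det2 (analyticAt_const (v := m)) ha.deriv).continuousAt
    fun_prop
  obtain ⟨C₂, hC₂⟩ := exists_eventually_le hcb
  refine ⟨C + ε * C₁ + Real.log (max C₂ 1), ?_⟩
  filter_upwards [hC, hC₁, hK, hC₂, ha.eventually_analyticAt] with z h1 h2 h3 h4 h5 hW hd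
  have hzz : z - z₀ ≠ 0 := by
    intro h
    rw [sub_eq_zero] at h
    exact hd (h ▸ hz)
  have hpos := norm_pos_iff.2 hzz
  have hdpos := norm_pos_iff.2 hd
  have hmpos : 0 < max C₂ 1 := lt_max_of_lt_right one_pos
  rw [(hasDerivAt_det2_const l h5).deriv] at h3
  have hWle : ‖z - z₀‖ * ‖wronskian a z‖ ≤ max C₂ 1 * ‖det2 l (a z)‖ := by
    have e : wronskian a z = det2 l (a z) * det2 m (deriv a z) - det2 m (a z) * det2 l (deriv a z) :=
      wronskian_eq (nsq_rep v₀) _ _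
    calc ‖z - z₀‖ * ‖wronskian a z‖
        ≤ ‖z - z₀‖ * (‖det2 l (a z)‖ * ‖det2 m (deriv a z)‖ +
            ‖det2 m (a z)‖ * ‖det2 l (deriv a z)‖) := by
          rw [e]; gcongr
          refine (norm_sub_le _ _).trans_eq ?_
          rw [norm_mul, norm_mul]
      _ = ‖det2 l (a z)‖ * (‖z - z₀‖ * ‖det2 m (deriv a z)‖) +
            ‖det2 m (a z)‖ * (‖z - z₀‖ * ‖det2 l (deriv a z)‖) := by ring
      _ ≤ ‖det2 l (a z)‖ * (‖z - z₀‖ * ‖det2 m (deriv a z)‖) +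
            ‖det2 m (a z)‖ * (K * ‖det2 l (a z)‖) := by gcongr
      _ = (‖z - z₀‖ * ‖det2 m (deriv a z)‖ + ‖det2 m (a z)‖ * K) * ‖det2 l (a z)‖ := by ring
      _ ≤ max C₂ 1 * ‖det2 l (a z)‖ := by gcongr; exact h4.trans (le_max_left _ _)
  have hlog := Real.log_le_log (mul_pos hpos (norm_pos_iff.2 hW)) hWle
  rw [Real.log_mul hpos.ne' (norm_ne_zero_iff.2 hW), Real.log_mul hmpos.ne' hdpos.ne'] at hlog
  have h2' := mul_le_mul_of_nonneg_left (h2 hd) hε0.le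
  unfold liftLog
  rw [← Finset.add_sum_erase V _ hv₀]
  linarith

end LiftLog

/-! ### The spherical derivative relative to the induced metric -/

section Surface

variable {S : Type*} [TopologicalSpace S] [ChartedSpace ℂ S]

/-- The spherical derivative of `g`, measured in the metric induced by `X`. This definition makes no
reference to a coordinate. -/
def relSpeed (X : S → E4) (g : S → OnePoint ℂ) (p : S) : ℝ :=
  limUnder (𝓝[≠] p) fun q => Real.sqrt (chordSq (g q) (g p)) / ‖X q - X p‖

/-- In the coordinate given by the chart at `q`, near `z`, the curve `a` is a lift of `g`, and the
metric induced by `X` is `e^l |dz|`. -/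
structure LiftAt (X : S → E4) (g : S → OnePoint ℂ) (q : S) (a : ℂ → ℂ × ℂ) (l : ℂ → ℝ) (z : ℂ) :
    Prop where
  mem : z ∈ (chartAt ℂ q).target
  lift : IsLift (g ∘ (chartAt ℂ q).symm) a z
  conf : ∀ᶠ w in 𝓝 z, ConfAt (X ∘ (chartAt ℂ q).symm) (l w) w

variable {X : S → E4} {g gh : S → OnePoint ℂ} {q : S} {a b : ℂ → ℂ × ℂ} {l : ℂ → ℝ} {z : ℂ}

lemma LiftAt.eventually (h : LiftAt X g q a l z) : ∀ᶠ w in 𝓝 z, LiftAt X g q a l w := by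
  filter_upwards [(chartAt ℂ q).open_target.mem_nhds h.mem, h.lift.eventually,
    h.conf.eventually_nhds] with w h1 h2 h3 using ⟨h1, h2, h3⟩

lemma LiftAt.relSpeed_eq (h : LiftAt X g q a l z) :
    relSpeed X g ((chartAt ℂ q).symm z) =
      ‖wronskian a z‖ / (nsq (a z) * Real.exp (l z)) := by
  set e := chartAt ℂ q with he
  have hN := nsq_pos h.lift.ne
  obtain ⟨hY, hYn⟩ := h.conf.self_of_nhds
  set Y := X ∘ e.symm with hYdef
  have hsrc : e.symm z ∈ e.source := e.map_target h.mem
  -- difference quotients of the lift and of the immersion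
  have hdet : Tendsto (fun w => ‖det2 (a w) (a z)‖ / ‖w - z‖) (𝓝[≠] z) (𝓝 ‖wronskian a z‖) := by
    have h1 := (hasDerivAt_det2_const (a z) h.lift.an)
    rw [hasDerivAt_iff_tendsto_slope] at h1
    refine h1.norm.congr' ?_
    filter_upwards with w
    have h0 : det2 (a z) (a z) = 0 := by simp [det2]; ring
    rw [slope_def_module, h0, sub_zero, norm_smul, norm_inv, det2_swap, norm_neg]
    field_simp
  have hXq : Tendsto (fun w => ‖Y w - Y z‖ / ‖w - z‖) (𝓝[≠] z) (𝓝 (Real.exp (l z))) := by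
    have ho := hY.hasFDerivAt.isLittleO
    have h1 : Tendsto (fun w => ‖Y w - Y z - fderiv ℝ Y z (w - z)‖ / ‖w - z‖) (𝓝[≠] z) (𝓝 0) := by
      have := (ho.norm_norm.tendsto_div_nhds_zero).mono_left (nhdsWithin_le_nhds (s := {z}ᶜ))
      exact this
    have h2 : Tendsto (fun w => ‖Y w - Y z‖ / ‖w - z‖ - Real.exp (l z)) (𝓝[≠] z) (𝓝 0) := by
      refine squeeze_zero_norm' ?_ h1
      filter_upwards [self_mem_nhdsWithin] with w hw
      have hpos : 0 < ‖w - z‖ := norm_pos_iff.2 (sub_ne_zero.2 hw)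
      have e1 : ‖Y w - Y z‖ / ‖w - z‖ - Real.exp (l z) =
          (‖Y w - Y z‖ - ‖fderiv ℝ Y z (w - z)‖) / ‖w - z‖ := by
        rw [hYn]; field_simp
      rw [e1, norm_div, norm_norm, Real.norm_eq_abs]
      gcongr
      exact abs_norm_sub_norm_le _ _
    simpa using h2.add_const (Real.exp (l z))
  have hnsq : Tendsto (fun w => Real.sqrt (nsq (a w) * nsq (a z))) (𝓝[≠] z) (𝓝 (nsq (a z))) := by
    have hc : ContinuousAt (fun w => nsq (a w)) z := by
      have := h.lift.an.continuousAt
      unfold nsq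
      fun_prop
    have h2 : ContinuousAt (fun w => Real.sqrt (nsq (a w) * nsq (a z))) z :=
      (hc.mul continuousAt_const).sqrt
    have := h2.tendsto.mono_left (nhdsWithin_le_nhds (s := {z}ᶜ))
    rwa [Real.sqrt_mul_self hN.le] at this
  have hlim : Tendsto (fun w => Real.sqrt (chordSq (g (e.symm w)) (g (e.symm z))) / ‖Y w - Y z‖)
      (𝓝[≠] z) (𝓝 (‖wronskian a z‖ / (nsq (a z) * Real.exp (l z)))) := by
    refine (hdet.div (hnsq.mul hXq) (mul_pos hN (Real.exp_pos _)).ne').congr' ?_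
    filter_upwards [self_mem_nhdsWithin, nhdsWithin_le_nhds h.lift.eventually] with w hw hlw
    have hpos : 0 < ‖w - z‖ := norm_pos_iff.2 (sub_ne_zero.2 hw)
    have hNw := nsq_pos hlw.ne
    have hsq := hlw.norm_det2_sq' h.lift
    have hs : Real.sqrt (chordSq (g (e.symm w)) (g (e.symm z))) =
        ‖det2 (a w) (a z)‖ / Real.sqrt (nsq (a w) * nsq (a z)) := by
      have : chordSq (g (e.symm w)) (g (e.symm z)) =
          ‖det2 (a w) (a z)‖ ^ 2 / (nsq (a w) * nsq (a z)) := by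
        rw [hsq]
        simp only [Function.comp_apply]
        field_simp
        rfl
      rw [this, Real.sqrt_div (sq_nonneg _), Real.sqrt_sq (norm_nonneg _)]
    have hsN : 0 < Real.sqrt (nsq (a w) * nsq (a z)) := Real.sqrt_pos.2 (mul_pos hNw hN)
    simp only [Pi.div_apply]
    rw [hs]
    rcases eq_or_ne ‖Y w - Y z‖ 0 with h0 | h0
    · rw [h0]; simp
    · field_simp
  -- transport to the surface
  have hes : Tendsto e.symm (𝓝[≠] z) (𝓝[≠] (e.symm z)) := by
    refine tendsto_nhdsWithin_iff.2
      ⟨(e.continuousAt_symm h.mem).tendsto.mono_left nhdsWithin_le_nhds, ?_⟩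
    filter_upwards [self_mem_nhdsWithin, nhdsWithin_le_nhds (e.open_target.mem_nhds h.mem)]
      with w hw hwt hcon
    exact hw (e.symm.injOn hwt h.mem hcon)
  have het : Tendsto e (𝓝[≠] (e.symm z)) (𝓝[≠] z) := by
    refine tendsto_nhdsWithin_iff.2 ⟨?_, ?_⟩
    · have := (e.continuousAt hsrc).tendsto
      rw [e.right_inv h.mem] at this
      exact this.mono_left nhdsWithin_le_nhds
    · filter_upwards [self_mem_nhdsWithin, nhdsWithin_le_nhds (e.open_source.mem_nhds hsrc)]
        with x hx hxs hcon
      refine hx (e.injOn hxs hsrc ?_)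
      rw [e.right_inv h.mem]; exact hcon
  have hne : (𝓝[≠] (e.symm z)).NeBot := hes.neBot
  refine Tendsto.limUnder_eq ((hlim.comp het).congr' ?_)
  filter_upwards [nhdsWithin_le_nhds (e.open_source.mem_nhds hsrc)] with x hx
  simp [hYdef, e.left_inv hx]

/-- The logarithm of the spherical derivative of `g`, relative to the metric induced by `X` and
weighted with powers of the chordal distances to the points of `V`. -/
def gaussLog (X : S → E4) (g : S → OnePoint ℂ) (V : Finset (OnePoint ℂ)) (ε : ℝ) (p : S) : ℝ :=
  Real.log (relSpeed X g p) - (1 - ε) / 2 * ∑ v ∈ V, Real.log (chordSq v (g p))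

lemma LiftAt.gaussLog_eq (h : LiftAt X g q a l z) {V : Finset (OnePoint ℂ)}
    (hW : wronskian a z ≠ 0) (hV : ∀ v ∈ V, det2 (rep v) (a z) ≠ 0) (ε : ℝ) :
    gaussLog X g V ε ((chartAt ℂ q).symm z) + l z = liftLog V ε a z := by
  have hN := nsq_pos h.lift.ne
  have hsum : ∑ v ∈ V, Real.log (chordSq v (g ((chartAt ℂ q).symm z))) =
      ∑ v ∈ V, (2 * Real.log ‖det2 (rep v) (a z)‖ - Real.log (nsq (a z))) := by
    refine Finset.sum_congr rfl fun v hv => ?_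
    have hd := norm_ne_zero_iff.2 (hV v hv)
    have : chordSq v (g ((chartAt ℂ q).symm z)) = ‖det2 (rep v) (a z)‖ ^ 2 / nsq (a z) := by
      rw [h.lift.norm_det2_sq]; simp only [Function.comp_apply]; field_simp
    rw [this, Real.log_div (pow_ne_zero _ hd) hN.ne', Real.log_pow]
    norm_num
  rw [gaussLog, hsum, h.relSpeed_eq, Real.log_div (norm_ne_zero_iff.2 hW)
    (mul_pos hN (Real.exp_pos _)).ne', Real.log_mul hN.ne' (Real.exp_pos _).ne', Real.log_exp,
    Finset.sum_sub_distrib, Finset.sum_const, ← Finset.mul_sum, nsmul_eq_mul, liftLog]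
  ring

end Surface

section Surface

variable {S : Type*} [TopologicalSpace S]

/-! ### The metrics attached to two maps sharing values -/

/-- The maps `g` and `gh` share each of the values in `V`. -/
def Shares (V : Finset (OnePoint ℂ)) (g gh : S → OnePoint ℂ) : Prop :=
  ∀ v ∈ V, ∀ x, g x = v ↔ gh x = v

/-- The points where one of the maps is branched or the two maps agree. -/
def singSet (X : S → E4) (g gh : S → OnePoint ℂ) : Set S :=
  {p | g p = gh p ∨ relSpeed X g p = 0 ∨ relSpeed X gh p = 0}

/-- The logarithm, relative to the metric induced by `X`, of the product of the chordal distance of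
`g` and `gh` with the powers `α` and `β` of the weighted spherical derivatives of `g` and `gh`. -/
def flatLog (X : S → E4) (g gh : S → OnePoint ℂ) (V : Finset (OnePoint ℂ)) (ε α β : ℝ) (p : S) : ℝ :=
  Real.log (chordSq (g p) (gh p)) / 2 + (α * gaussLog X g V ε p + β * gaussLog X gh V ε p)

/-- The sum of the powers, with exponent `2 δ`, of the chordal distances of `y` to the points
of `V`. -/
def chordPow (V : Finset (OnePoint ℂ)) (δ : ℝ) (y : OnePoint ℂ) : ℝ := ∑ v ∈ V, chordSq v y ^ δ

/-- The logarithm, relative to the metric induced by `X`, of a negatively curved metric: a bounded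
correction term is added to `flatLog`. -/
def curvLog (X : S → E4) (g gh : S → OnePoint ℂ) (V : Finset (OnePoint ℂ)) (δ η α β : ℝ) (p : S) :
    ℝ :=
  flatLog X g gh V δ α β p + η * (chordPow V δ (g p) + chordPow V δ (gh p))

lemma chordPow_nonneg (V : Finset (OnePoint ℂ)) (δ : ℝ) (y : OnePoint ℂ) : 0 ≤ chordPow V δ y :=
  Finset.sum_nonneg fun _ _ => Real.rpow_nonneg (chordSq_nonneg _ _) _

lemma chordPow_le (V : Finset (OnePoint ℂ)) {δ : ℝ} (hδ : 0 ≤ δ) (y : OnePoint ℂ) :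
    chordPow V δ y ≤ V.card := by
  calc chordPow V δ y ≤ ∑ v ∈ V, (1 : ℝ) := Finset.sum_le_sum fun v _ =>
        Real.rpow_le_one (chordSq_nonneg _ _) (chordSq_le_one _ _) hδ
    _ = V.card := by simp

variable {X : S → E4} {g gh : S → OnePoint ℂ} {V : Finset (OnePoint ℂ)} {q : S}
  {a b : ℂ → ℂ × ℂ} {l : ℂ → ℝ} {z : ℂ} {ε δ η α β : ℝ}

lemma flatLog_le_curvLog (hδε : δ ≤ ε) (hα : 0 ≤ α) (hβ : 0 ≤ β) (hη : 0 ≤ η) (p : S) :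
    flatLog X g gh V ε α β p ≤ curvLog X g gh V δ η α β p := by
  have key : ∀ f : S → OnePoint ℂ, gaussLog X f V ε p ≤ gaussLog X f V δ p := by
    intro f
    have : ∑ v ∈ V, Real.log (chordSq v (f p)) ≤ 0 := Finset.sum_nonpos fun v _ =>
      Real.log_nonpos (chordSq_nonneg _ _) (chordSq_le_one _ _)
    unfold gaussLog
    nlinarith
  have h1 := mul_le_mul_of_nonneg_left (key g) hα
  have h2 := mul_le_mul_of_nonneg_left (key gh) hβ
  have h3 := mul_nonneg hη (add_nonneg (chordPow_nonneg V δ (g p)) (chordPow_nonneg V δ (gh p)))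
  unfold curvLog flatLog
  linarith

lemma notMem_of_notMem_singSet (hV : Shares V g gh) {p : S} (hp : p ∉ singSet X g gh) :
    g p ∉ V ∧ gh p ∉ V := by
  constructor
  · intro hv
    exact hp (Or.inl ((hV _ hv p).1 rfl).symm)
  · intro hv
    exact hp (Or.inl ((hV _ hv p).2 rfl))

variable [ChartedSpace ℂ S]

lemma mem_singSet_iff (h : LiftAt X g q a l z) (k : LiftAt X gh q b l z) :
    (chartAt ℂ q).symm z ∈ singSet X g gh ↔
      det2 (a z) (b z) = 0 ∨ wronskian a z = 0 ∨ wronskian b z = 0 := by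
  have h1 := (mul_pos (nsq_pos h.lift.ne) (Real.exp_pos (l z))).ne'
  have h2 := (mul_pos (nsq_pos k.lift.ne) (Real.exp_pos (l z))).ne'
  change _ ∨ _ ∨ _ ↔ _
  rw [h.relSpeed_eq, k.relSpeed_eq, h.lift.det2_eq_zero_iff' k.lift, div_eq_zero_iff,
    div_eq_zero_iff, norm_eq_zero, norm_eq_zero]
  simp only [h1, h2, or_false, Function.comp_apply]

lemma eventually_notMem_singSet (h : LiftAt X g q a l z) (k : LiftAt X gh q b l z)
    (hz : (chartAt ℂ q).symm z ∉ singSet X g gh) :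
    ∀ᶠ w in 𝓝 z, (chartAt ℂ q).symm w ∉ singSet X g gh := by
  rw [mem_singSet_iff h k] at hz
  push Not at hz
  filter_upwards [h.eventually, k.eventually,
    (analyticAt_det2 h.lift.an k.lift.an).continuousAt.eventually_ne hz.1,
    (analyticAt_wronskian h.lift.an).continuousAt.eventually_ne hz.2.1,
    (analyticAt_wronskian k.lift.an).continuousAt.eventually_ne hz.2.2] with w hw kw h1 h2 h3
  rw [mem_singSet_iff hw kw]
  push Not
  exact ⟨h1, h2, h3⟩

lemma LiftAt.det2_ne (h : LiftAt X g q a l z) (hz : g ((chartAt ℂ q).symm z) ∉ V) :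
    ∀ v ∈ V, det2 (rep v) (a z) ≠ 0 := by
  intro v hv h0
  rw [h.lift.det2_eq_zero_iff] at h0
  exact hz (by rw [Function.comp_apply] at h0; rwa [h0])

lemma flatLog_eq (hV : Shares V g gh) (hαβ : α + β = 1) (h : LiftAt X g q a l z)
    (k : LiftAt X gh q b l z) (hz : (chartAt ℂ q).symm z ∉ singSet X g gh) :
    flatLog X g gh V ε α β ((chartAt ℂ q).symm z) + l z =
      Real.log ‖det2 (a z) (b z)‖ - (Real.log (nsq (a z)) + Real.log (nsq (b z))) / 2 +
        (α * liftLog V ε a z + β * liftLog V ε b z) := by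
  obtain ⟨hVa, hVb⟩ := notMem_of_notMem_singSet hV hz
  rw [mem_singSet_iff h k] at hz
  push Not at hz
  obtain ⟨hd, hWa, hWb⟩ := hz
  have hN := nsq_pos h.lift.ne
  have hM := nsq_pos k.lift.ne
  rw [← h.gaussLog_eq hWa (h.det2_ne hVa) ε, ← k.gaussLog_eq hWb (k.det2_ne hVb) ε]
  have hlog : Real.log (chordSq (g ((chartAt ℂ q).symm z)) (gh ((chartAt ℂ q).symm z))) =
      2 * Real.log ‖det2 (a z) (b z)‖ - (Real.log (nsq (a z)) + Real.log (nsq (b z))) := by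
    have : chordSq (g ((chartAt ℂ q).symm z)) (gh ((chartAt ℂ q).symm z)) =
        ‖det2 (a z) (b z)‖ ^ 2 / (nsq (a z) * nsq (b z)) := by
      rw [h.lift.norm_det2_sq' k.lift]; simp only [Function.comp_apply]; field_simp
    rw [this, Real.log_div (pow_ne_zero _ (norm_ne_zero_iff.2 hd)) (mul_pos hN hM).ne',
      Real.log_mul hN.ne' hM.ne', Real.log_pow]
    norm_num
  rw [flatLog, hlog]
  linear_combination (-l z) * hαβ

/-- Up to multiples of `log |a|` and `log |b|`, the function `flatLog` is harmonic. -/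
lemma flatLog_isReHol (hV : Shares V g gh) (hαβ : α + β = 1) (h : LiftAt X g q a l z)
    (k : LiftAt X gh q b l z) (hz : (chartAt ℂ q).symm z ∉ singSet X g gh) :
    ∃ u : ℂ → ℝ, IsReHol u z ∧ ∀ᶠ w in 𝓝 z,
      flatLog X g gh V ε α β ((chartAt ℂ q).symm w) + l w = u w +
        ((α * ((1 - ε) * V.card - 2) - 1) / 2 * Real.log (nsq (a w)) +
          (β * ((1 - ε) * V.card - 2) - 1) / 2 * Real.log (nsq (b w))) := by
  obtain ⟨hVa, hVb⟩ := notMem_of_notMem_singSet hV hz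
  have hz' := hz
  rw [mem_singSet_iff h k] at hz'
  push Not at hz'
  obtain ⟨hd, hWa, hWb⟩ := hz'
  have key : ∀ {f : S → OnePoint ℂ} {c : ℂ → ℂ × ℂ}, LiftAt X f q c l z → wronskian c z ≠ 0 →
      f ((chartAt ℂ q).symm z) ∉ V → IsReHol (fun w => Real.log ‖wronskian c w‖ +
        (-(1 - ε)) * ∑ v ∈ V, Real.log ‖det2 (rep v) (c w)‖) z := fun {f c} hc hW hf =>
    (IsReHol.log_norm (analyticAt_wronskian hc.lift.an) hW).add ((IsReHol.sum V fun v hv =>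
      IsReHol.log_norm (analyticAt_det2 analyticAt_const hc.lift.an)
        (hc.det2_ne hf v hv)).const_mul _)
  refine ⟨_, (IsReHol.log_norm (analyticAt_det2 h.lift.an k.lift.an) hd).add
    (((key h hWa hVa).const_mul α).add ((key k hWb hVb).const_mul β)), ?_⟩
  filter_upwards [h.eventually, k.eventually, eventually_notMem_singSet h k hz] with w hw kw hzw
  rw [flatLog_eq hV hαβ hw kw hzw]
  unfold liftLog
  ring

lemma exp_two_mul_liftLog (h : LiftAt X g q a l z) (hW : wronskian a z ≠ 0)
    (hz : g ((chartAt ℂ q).symm z) ∉ V) :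
    Real.exp (2 * liftLog V δ a z) = ‖wronskian a z‖ ^ 2 / nsq (a z) ^ 2 *
      ∏ v ∈ V, chordSq v (g ((chartAt ℂ q).symm z)) ^ (-(1 - δ)) := by
  have hN := nsq_pos h.lift.ne
  have hWpos := norm_pos_iff.2 hW
  have hx : ∀ v ∈ V, chordSq v (g ((chartAt ℂ q).symm z)) ^ (-(1 - δ)) =
      Real.exp (-(1 - δ) * (2 * Real.log ‖det2 (rep v) (a z)‖ - Real.log (nsq (a z)))) := by
    intro v hv
    have hd := norm_pos_iff.2 (h.det2_ne hz v hv)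
    have : chordSq v (g ((chartAt ℂ q).symm z)) = ‖det2 (rep v) (a z)‖ ^ 2 / nsq (a z) := by
      rw [h.lift.norm_det2_sq]; simp only [Function.comp_apply]; field_simp
    rw [this, Real.rpow_def_of_pos (by positivity), Real.log_div (by positivity) hN.ne',
      Real.log_pow]
    congr 1; push_cast; ring
  rw [Finset.prod_congr rfl hx, ← Real.exp_sum, ← Finset.mul_sum, Finset.sum_sub_distrib,
    Finset.sum_const, ← Finset.mul_sum, nsmul_eq_mul]
  have hK : ‖wronskian a z‖ ^ 2 / nsq (a z) ^ 2 =
      Real.exp (2 * Real.log ‖wronskian a z‖ - 2 * Real.log (nsq (a z))) := by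
    rw [Real.exp_sub, mul_comm 2, mul_comm 2, Real.exp_mul, Real.exp_mul, Real.exp_log hWpos,
      Real.exp_log hN]
    norm_num
  rw [hK, ← Real.exp_add]
  congr 1
  unfold liftLog
  ring

/-- The curvature estimate: the metric given by `curvLog` has curvature bounded above by a negative
constant. -/
lemma exists_curvLog_hasLap (hVne : V.Nonempty) (hV : Shares V g gh) (hα : 0 ≤ α) (hβ : 0 ≤ β)
    (hαβ : α + β = 1) (hδ : 0 < δ) (hδ1 : δ ≤ 1) (hη : 0 < η)
    (hκa : 2 * η * V.card * (δ + δ ^ 2) ≤ α * ((1 - δ) * V.card - 2) - 1)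
    (hκb : 2 * η * V.card * (δ + δ ^ 2) ≤ β * ((1 - δ) * V.card - 2) - 1) :
    ∃ c > 0, ∀ (q : S) (a b : ℂ → ℂ × ℂ) (l : ℂ → ℝ) (z : ℂ), LiftAt X g q a l z →
      LiftAt X gh q b l z → (chartAt ℂ q).symm z ∉ singSet X g gh →
      ∃ G L, HasLap (fun w => curvLog X g gh V δ η α β ((chartAt ℂ q).symm w) + l w) G z L ∧
        c * Real.exp (2 * (curvLog X g gh V δ η α β ((chartAt ℂ q).symm z) + l z)) ≤ L := by
  obtain ⟨C, hC, hprod⟩ := exists_prod_le_sum V hVne (m := 1 - δ) (by linarith)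
  refine ⟨4 * η * δ ^ 2 / C * Real.exp (-(4 * η * V.card)), by positivity, ?_⟩
  intro q a b l z h k hz
  obtain ⟨hVa, hVb⟩ := notMem_of_notMem_singSet hV hz
  obtain ⟨u, hu, hflat⟩ := flatLog_isReHol (ε := δ) hV hαβ h k hz
  have heq := flatLog_eq (ε := δ) hV hαβ h k hz
  have hz' := hz
  rw [mem_singSet_iff h k] at hz'
  push Not at hz'
  obtain ⟨hd, hWa, hWb⟩ := hz'
  obtain ⟨Gu, hGu⟩ := hu.exists_hasLap
  obtain ⟨Ga, La, hLa, hLa'⟩ := hasLap_curvature h.lift.an V (h.det2_ne hVa) h.lift.ne hδ hη hκa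
  obtain ⟨Gb, Lb, hLb, hLb'⟩ := hasLap_curvature k.lift.an V (k.det2_ne hVb) k.lift.ne hδ hη hκb
  have hchord : ∀ {f : S → OnePoint ℂ} {c : ℂ → ℂ × ℂ} {w : ℂ}, LiftAt X f q c l w →
      ∀ v, ‖det2 (rep v) (c w)‖ ^ 2 / nsq (c w) = chordSq v (f ((chartAt ℂ q).symm w)) :=
    fun {f c w} hc v => by
      have := nsq_pos hc.lift.ne
      rw [hc.lift.norm_det2_sq]; simp only [Function.comp_apply]; field_simp
  refine ⟨_, _, (hGu.add (hLa.add hLb)).congr ?_, ?_⟩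
  · filter_upwards [h.eventually, k.eventually, hflat] with w hw kw hfw
    simp only [hchord hw, hchord kw]
    unfold curvLog chordPow
    linarith
  · set y := g ((chartAt ℂ q).symm z) with hy
    set yh := gh ((chartAt ℂ q).symm z) with hyh
    simp only [hchord h, hchord k, show δ - 1 = -(1 - δ) by ring] at hLa' hLb'
    have hPa := exp_two_mul_liftLog (δ := δ) h hWa hVa
    have hPb := exp_two_mul_liftLog (δ := δ) k hWb hVb
    rw [← hy] at hPa
    rw [← hyh] at hPb hLb'
    set Ka := ‖wronskian a z‖ ^ 2 / nsq (a z) ^ 2 with hKa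
    set Kb := ‖wronskian b z‖ ^ 2 / nsq (b z) ^ 2 with hKb
    have hKa0 : 0 ≤ Ka := by positivity
    have hKb0 : 0 ≤ Kb := by positivity
    have h1 : 4 * η * δ ^ 2 / C * Real.exp (2 * liftLog V δ a z) ≤ La := by
      refine le_trans ?_ hLa'
      rw [hPa, div_mul_eq_mul_div, div_le_iff₀ hC]
      have := mul_le_mul_of_nonneg_left (hprod y hVa) (show 0 ≤ 4 * η * δ ^ 2 * Ka by positivity)
      linarith
    have h2 : 4 * η * δ ^ 2 / C * Real.exp (2 * liftLog V δ b z) ≤ Lb := by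
      refine le_trans ?_ hLb'
      rw [hPb, div_mul_eq_mul_div, div_le_iff₀ hC]
      have := mul_le_mul_of_nonneg_left (hprod yh hVb) (show 0 ≤ 4 * η * δ ^ 2 * Kb by positivity)
      linarith
    have hcl : Real.log (chordSq y yh) ≤ 0 :=
      Real.log_nonpos (chordSq_nonneg _ _) (chordSq_le_one _ _)
    have hA := h.gaussLog_eq hWa (h.det2_ne hVa) δ
    have hB := k.gaussLog_eq hWb (k.det2_ne hVb) δ
    have hexpo : 2 * (curvLog X g gh V δ η α β ((chartAt ℂ q).symm z) + l z) ≤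
        (α * (2 * liftLog V δ a z) + β * (2 * liftLog V δ b z)) + 4 * η * V.card := by
      have e1 := mul_le_mul_of_nonneg_left (chordPow_le V hδ.le y) hη.le
      have e2 := mul_le_mul_of_nonneg_left (chordPow_le V hδ.le yh) hη.le
      have e3 : flatLog X g gh V δ α β ((chartAt ℂ q).symm z) + l z =
          Real.log (chordSq y yh) / 2 + (α * liftLog V δ a z + β * liftLog V δ b z) := by
        rw [← hA, ← hB, flatLog]
        linear_combination (-l z) * hαβ
      unfold curvLog
      rw [← hy, ← hyh]
      linarith
    have hconv : Real.exp (α * (2 * liftLog V δ a z) + β * (2 * liftLog V δ b z)) ≤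
        Real.exp (2 * liftLog V δ a z) + Real.exp (2 * liftLog V δ b z) := by
      have := convexOn_exp.2 (Set.mem_univ (2 * liftLog V δ a z))
        (Set.mem_univ (2 * liftLog V δ b z)) hα hβ hαβ
      simp only [smul_eq_mul] at this
      have e1 := Real.exp_pos (2 * liftLog V δ a z)
      have e2 := Real.exp_pos (2 * liftLog V δ b z)
      nlinarith
    calc 4 * η * δ ^ 2 / C * Real.exp (-(4 * η * V.card)) *
          Real.exp (2 * (curvLog X g gh V δ η α β ((chartAt ℂ q).symm z) + l z))
        ≤ 4 * η * δ ^ 2 / C * Real.exp (-(4 * η * V.card)) *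
          Real.exp ((α * (2 * liftLog V δ a z) + β * (2 * liftLog V δ b z)) + 4 * η * V.card) := by
          gcongr
      _ = 4 * η * δ ^ 2 / C *
          Real.exp (α * (2 * liftLog V δ a z) + β * (2 * liftLog V δ b z)) := by
          rw [mul_assoc, ← Real.exp_add]; congr 2; ring
      _ ≤ 4 * η * δ ^ 2 / C *
          (Real.exp (2 * liftLog V δ a z) + Real.exp (2 * liftLog V δ b z)) := by gcongr
      _ ≤ 0 + (La + Lb) := by linarith

/-- Near a point of `singSet`, the pseudometric given by `flatLog` vanishes at a definite rate. At a
shared value the zero of the chordal distance of the two maps compensates the poles of the weighted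
spherical derivatives, up to the order `ε`. -/
lemma flatLog_le_of_mem (hV : Shares V g gh) (hαβ : α + β = 1) (hα : 0 < α) (hβ : 0 < β)
    (hε : 0 < ε) {e₀ : ℝ} (h1 : e₀ ≤ ε) (h2 : e₀ ≤ α) (h3 : e₀ ≤ β)
    (h : LiftAt X g q a l z) (k : LiftAt X gh q b l z)
    (hA : ∀ v ∈ V, ¬ ∀ᶠ w in 𝓝 z, det2 (rep v) (a w) = 0)
    (hB : ∀ v ∈ V, ¬ ∀ᶠ w in 𝓝 z, det2 (rep v) (b w) = 0)
    (hz : (chartAt ℂ q).symm z ∈ singSet X g gh) :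
    ∃ C, ∀ᶠ w in 𝓝 z, (chartAt ℂ q).symm w ∉ singSet X g gh →
      flatLog X g gh V ε α β ((chartAt ℂ q).symm w) + l w ≤ e₀ * Real.log ‖w - z‖ + C := by
  set e := chartAt ℂ q with he
  have hsmall : ∀ᶠ w in 𝓝 z, Real.log ‖w - z‖ ≤ 0 := by
    filter_upwards [Metric.ball_mem_nhds z one_pos] with w hw
    refine Real.log_nonpos (norm_nonneg _) ?_
    rw [Metric.mem_ball, dist_eq_norm] at hw
    exact hw.le
  have hdetan := analyticAt_det2 h.lift.an k.lift.an
  have hcont : ContinuousAt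
      (fun w => -(Real.log (nsq (a w)) + Real.log (nsq (b w))) / 2) z :=
    (((continuousAt_log_nsq h.lift.an h.lift.ne).add
      (continuousAt_log_nsq k.lift.an k.lift.ne)).neg).div_const 2
  obtain ⟨CN, hCN⟩ := exists_eventually_le hcont
  have hdet0 : ∀ w, g (e.symm w) = gh (e.symm w) → LiftAt X g q a l w → LiftAt X gh q b l w →
      det2 (a w) (b w) = 0 := fun w hw h k => (h.lift.det2_eq_zero_iff' k.lift).2 hw
  -- the three estimates that are combined in each of the cases below
  have combine : ∀ (A B D : ℂ → ℝ) (C : ℝ),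
      (∀ᶠ w in 𝓝 z, e.symm w ∉ singSet X g gh → liftLog V ε a w ≤ A w) →
      (∀ᶠ w in 𝓝 z, e.symm w ∉ singSet X g gh → liftLog V ε b w ≤ B w) →
      (∀ᶠ w in 𝓝 z, e.symm w ∉ singSet X g gh → Real.log ‖det2 (a w) (b w)‖ ≤ D w) →
      (∀ᶠ w in 𝓝 z, D w + (α * A w + β * B w) ≤ e₀ * Real.log ‖w - z‖ + C) →
      ∃ C, ∀ᶠ w in 𝓝 z, e.symm w ∉ singSet X g gh →
        flatLog X g gh V ε α β (e.symm w) + l w ≤ e₀ * Real.log ‖w - z‖ + C := by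
    intro A B D C hA hB hD hC
    refine ⟨C + CN, ?_⟩
    filter_upwards [hA, hB, hD, hC, hCN, h.eventually, k.eventually] with w wA wB wD wC wN wh wk hw
    rw [flatLog_eq hV hαβ wh wk hw]
    have e1 := mul_le_mul_of_nonneg_left (wA hw) hα.le
    have e2 := mul_le_mul_of_nonneg_left (wB hw) hβ.le
    have e3 := wD hw
    linarith
  have hWa : ∀ᶠ w in 𝓝 z, e.symm w ∉ singSet X g gh → wronskian a w ≠ 0 := by
    filter_upwards [h.eventually, k.eventually] with w wh wk hw h0
    exact hw ((mem_singSet_iff wh wk).2 (Or.inr (Or.inl h0)))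
  have hWb : ∀ᶠ w in 𝓝 z, e.symm w ∉ singSet X g gh → wronskian b w ≠ 0 := by
    filter_upwards [h.eventually, k.eventually] with w wh wk hw h0
    exact hw ((mem_singSet_iff wh wk).2 (Or.inr (Or.inr h0)))
  have hDne : ∀ᶠ w in 𝓝 z, e.symm w ∉ singSet X g gh → det2 (a w) (b w) ≠ 0 := by
    filter_upwards [h.eventually, k.eventually] with w wh wk hw h0
    exact hw ((mem_singSet_iff wh wk).2 (Or.inl h0))
  by_cases hval : ∃ v₀ ∈ V, g (e.symm z) = v₀
  · obtain ⟨v₀, hv₀, hgv⟩ := hval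
    have hghv := (hV v₀ hv₀ _).1 hgv
    have oth : ∀ {f : S → OnePoint ℂ} {c : ℂ → ℂ × ℂ}, LiftAt X f q c l z → f (e.symm z) = v₀ →
        det2 (rep v₀) (c z) = 0 ∧ ∀ v ∈ V, v ≠ v₀ → det2 (rep v) (c z) ≠ 0 := by
      intro f c hc hf
      refine ⟨(hc.lift.det2_eq_zero_iff v₀).2 hf, fun v _ hne h0 => hne ?_⟩
      have := (hc.lift.det2_eq_zero_iff v).1 h0
      rw [← this]; exact hf
    obtain ⟨ha0, haV⟩ := oth h hgv
    obtain ⟨hb0, hbV⟩ := oth k hghv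
    obtain ⟨Ca, hCa⟩ := liftLog_le_of_zero hε h.lift.an h.lift.ne hv₀ ha0 haV (hA v₀ hv₀)
    obtain ⟨Cb, hCb⟩ := liftLog_le_of_zero hε k.lift.an k.lift.ne hv₀ hb0 hbV (hB v₀ hv₀)
    obtain ⟨Cd, hCd⟩ := log_norm_le_of_zero hdetan (hdet0 z (hgv.trans hghv.symm) h k)
    refine combine (fun w => (ε - 1) * Real.log ‖w - z‖ + Ca)
      (fun w => (ε - 1) * Real.log ‖w - z‖ + Cb) (fun w => Real.log ‖w - z‖ + Cd)
      (Cd + α * Ca + β * Cb) ?_ ?_ ?_ ?_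
    · filter_upwards [hCa, hWa, h.eventually] with w h1 h2 wh hw
      exact h1 (h2 hw) (wh.det2_ne (notMem_of_notMem_singSet hV hw).1 v₀ hv₀)
    · filter_upwards [hCb, hWb, k.eventually] with w h1 h2 wk hw
      exact h1 (h2 hw) (wk.det2_ne (notMem_of_notMem_singSet hV hw).2 v₀ hv₀)
    · filter_upwards [hCd, hDne] with w h1 h2 hw using h1 (h2 hw)
    · filter_upwards [hsmall] with w hw
      have e1 : Real.log ‖w - z‖ + Cd + (α * ((ε - 1) * Real.log ‖w - z‖ + Ca) +
          β * ((ε - 1) * Real.log ‖w - z‖ + Cb)) =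
          ε * Real.log ‖w - z‖ + (Cd + α * Ca + β * Cb) := by
        linear_combination ((ε - 1) * Real.log ‖w - z‖) * hαβ
      rw [e1]
      nlinarith
  · push Not at hval
    have hgV : g (e.symm z) ∉ V := fun hv => hval _ hv rfl
    have hghV : gh (e.symm z) ∉ V := fun hv => hval _ hv ((hV _ hv _).2 rfl)
    obtain ⟨⟨Ca, hCa⟩, hCa'⟩ := liftLog_le_of_ne (ε := ε) h.lift.an h.lift.ne (h.det2_ne hgV)
    obtain ⟨⟨Cb, hCb⟩, hCb'⟩ := liftLog_le_of_ne (ε := ε) k.lift.an k.lift.ne (k.det2_ne hghV)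
    obtain ⟨Cd, hCd⟩ := log_norm_le hdetan
    have hA' : ∀ᶠ w in 𝓝 z, e.symm w ∉ singSet X g gh → liftLog V ε a w ≤ Ca := by
      filter_upwards [hCa, hWa] with w h1 h2 hw using h1 (h2 hw)
    have hB' : ∀ᶠ w in 𝓝 z, e.symm w ∉ singSet X g gh → liftLog V ε b w ≤ Cb := by
      filter_upwards [hCb, hWb] with w h1 h2 hw using h1 (h2 hw)
    have hD' : ∀ᶠ w in 𝓝 z, e.symm w ∉ singSet X g gh → Real.log ‖det2 (a w) (b w)‖ ≤ Cd := by
      filter_upwards [hCd, hDne] with w h1 h2 hw using h1 (h2 hw)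
    rcases (mem_singSet_iff h k).1 hz with hd | hW | hW
    · obtain ⟨Cd, hCd⟩ := log_norm_le_of_zero hdetan hd
      refine combine (fun _ => Ca) (fun _ => Cb) (fun w => Real.log ‖w - z‖ + Cd)
        (Cd + α * Ca + β * Cb) hA' hB' ?_ ?_
      · filter_upwards [hCd, hDne] with w h1 h2 hw using h1 (h2 hw)
      · filter_upwards [hsmall] with w hw
        nlinarith
    · obtain ⟨Ca, hCa⟩ := hCa' hW
      refine combine (fun w => Real.log ‖w - z‖ + Ca) (fun _ => Cb) (fun _ => Cd)
        (Cd + α * Ca + β * Cb) ?_ hB' hD' ?_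
      · filter_upwards [hCa, hWa] with w h1 h2 hw using h1 (h2 hw)
      · filter_upwards [hsmall] with w hw
        nlinarith
    · obtain ⟨Cb, hCb⟩ := hCb' hW
      refine combine (fun _ => Ca) (fun w => Real.log ‖w - z‖ + Cb) (fun _ => Cd)
        (Cd + α * Ca + β * Cb) hA' ?_ hD' ?_
      · filter_upwards [hCb, hWb] with w h1 h2 hw using h1 (h2 hw)
      · filter_upwards [hsmall] with w hw
        nlinarith

end Surface

section Surface

variable {S : Type*} [TopologicalSpace S] [ChartedSpace ℂ S]

/-! ### The identity theorem for maps to the sphere -/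

/-- The map `g` to the Riemann sphere is holomorphic: near each point it has holomorphic homogeneous
coordinates without common zeros. -/
def HasLifts (g : S → OnePoint ℂ) : Prop :=
  ∀ p, ∃ a, IsLift (g ∘ (chartAt ℂ p).symm) a (chartAt ℂ p p)

variable {X : S → E4} {g gh : S → OnePoint ℂ} {q : S} {a b : ℂ → ℂ × ℂ} {l : ℂ → ℝ}

lemma HasLifts.const (v : OnePoint ℂ) : HasLifts (fun _ : S => v) := fun _ =>
  ⟨_, IsLift.const v _⟩

lemma IsLift.eventually_eq_iff {p : S} (ha : IsLift (g ∘ (chartAt ℂ p).symm) a (chartAt ℂ p p))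
    (hb : IsLift (gh ∘ (chartAt ℂ p).symm) b (chartAt ℂ p p)) :
    (∀ᶠ z in 𝓝 (chartAt ℂ p p), det2 (a z) (b z) = 0) ↔ ∀ᶠ x in 𝓝 p, g x = gh x := by
  rw [← (chartAt ℂ p).eventually_nhds' _ (mem_chart_source ℂ p)]
  refine eventually_congr ?_
  filter_upwards [ha.eventually, hb.eventually] with z h k
  exact h.det2_eq_zero_iff' k

lemma HasLifts.eventually_eq_or_ne (hg : HasLifts g) (hgh : HasLifts gh) (p : S) :
    (∀ᶠ x in 𝓝 p, g x = gh x) ∨ ∀ᶠ x in 𝓝 p, x ≠ p → g x ≠ gh x := by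
  obtain ⟨a, ha⟩ := hg p
  obtain ⟨b, hb⟩ := hgh p
  refine ((analyticAt_det2 ha.an hb.an).eventually_eq_zero_or_eventually_ne_zero).imp
    (ha.eventually_eq_iff hb).1 fun h => ?_
  rw [eventually_nhdsWithin_iff] at h
  rw [← (chartAt ℂ p).eventually_nhds' _ (mem_chart_source ℂ p)]
  filter_upwards [ha.eventually, hb.eventually, h,
    (chartAt ℂ p).open_target.mem_nhds (mem_chart_target ℂ p)] with z h k h0 hz hne heq
  refine h0 ?_ ((h.det2_eq_zero_iff' k).2 heq)
  rintro rfl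
  exact hne ((chartAt ℂ p).left_inv (mem_chart_source ℂ p))

lemma HasLifts.not_eventually_eq [ConnectedSpace S] (hg : HasLifts g) (hgh : HasLifts gh)
    (hne : g ≠ gh) (p : S) : ¬ ∀ᶠ x in 𝓝 p, g x = gh x := by
  intro hp
  have hclopen : IsClopen {p | ∀ᶠ x in 𝓝 p, g x = gh x} := by
    refine ⟨⟨?_⟩, isOpen_setOfPred_eventually_nhds⟩
    rw [isOpen_iff_mem_nhds]
    intro x hx
    filter_upwards [((hg.eventually_eq_or_ne hgh x).resolve_left hx)] with y hy hyU
    by_cases h : y = x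
    · exact hx (h ▸ hyU)
    · exact hy h hyU.self_of_nhds
  have := hclopen.eq_univ ⟨p, hp⟩
  refine hne (funext fun x => ?_)
  have hx : x ∈ {p | ∀ᶠ x in 𝓝 p, g x = gh x} := this ▸ Set.mem_univ x
  exact Eventually.self_of_nhds (p := fun x => g x = gh x) hx

lemma HasLifts.not_eventually_det2_eq_zero [ConnectedSpace S] (hg : HasLifts g)
    (hnc : ¬ IsConst g) (ha : IsLift (g ∘ (chartAt ℂ q).symm) a (chartAt ℂ q q))
    (v : OnePoint ℂ) : ¬ ∀ᶠ z in 𝓝 (chartAt ℂ q q), det2 (rep v) (a z) = 0 := by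
  intro h
  refine (HasLifts.const v).not_eventually_eq hg ?_ q
    ((IsLift.eventually_eq_iff (g := fun _ => v) (IsLift.const v _) ha).1 h)
  rintro rfl
  exact hnc ⟨v, fun _ => rfl⟩

lemma HasLifts.not_eventually_wronskian_eq_zero [ConnectedSpace S] (hg : HasLifts g)
    (hnc : ¬ IsConst g) (ha : IsLift (g ∘ (chartAt ℂ q).symm) a (chartAt ℂ q q)) :
    ¬ ∀ᶠ z in 𝓝 (chartAt ℂ q q), wronskian a z = 0 := by
  intro hW
  refine hg.not_eventually_det2_eq_zero hnc ha (g q) ?_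
  set z₀ := chartAt ℂ q q with hz₀
  set v := rep (g q) with hv
  set m : ℂ × ℂ := (-conj v.2, conj v.1) with hm
  have hv1 : nsq v = 1 := nsq_rep _
  have h0 : det2 v (a z₀) = 0 := by
    rw [hv, ha.det2_eq_zero_iff]
    simp [hz₀]
  have hk0 : det2 m (a z₀) ≠ 0 := by
    intro hk
    have h1 := norm_det2_sq_add v (a z₀)
    have h2 : v.1 * conj (a z₀).1 + v.2 * conj (a z₀).2 = -conj (det2 m (a z₀)) := by
      simp [det2, hm]
    rw [h0, h2, hk, hv1] at h1
    have := nsq_pos ha.ne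
    simp at h1
    linarith
  have hv' := fun {z} (h : AnalyticAt ℂ a z) => hasDerivAt_det2_const v h
  have hm' := fun {z} (h : AnalyticAt ℂ a z) => hasDerivAt_det2_const m h
  have hkc : ContinuousAt (fun z => det2 m (a z)) z₀ := (hm' ha.an).continuousAt
  -- the Wronskian is the numerator of the derivative of the quotient of the coordinates of `a`
  obtain ⟨ρ, hρ, hball⟩ := Metric.eventually_nhds_iff_ball.1
    (hW.and (ha.an.eventually_analyticAt.and (hkc.eventually_ne hk0)))
  have hd : ∀ z ∈ Metric.ball z₀ ρ, HasDerivAt (fun z => det2 v (a z) / det2 m (a z)) 0 z := by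
    intro z hz
    obtain ⟨h1, h2, h3⟩ := hball z hz
    refine ((hv' h2).div (hm' h2) h3).congr_deriv ?_
    have := wronskian_eq hv1 (a z) (deriv a z)
    rw [wronskian] at h1
    rw [h1] at this
    rw [div_eq_zero_iff]
    left
    linear_combination this
  filter_upwards [Metric.ball_mem_nhds z₀ hρ] with z hz
  have hconst := Metric.isOpen_ball.is_const_of_deriv_eq_zero
    (convex_ball z₀ ρ).isPreconnected
    (fun z hz => (hd z hz).differentiableAt.differentiableWithinAt)
    (fun z hz => (hd z hz).deriv) hz (Metric.mem_ball_self hρ)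
  simp only [h0, zero_div] at hconst
  exact (div_eq_zero_iff.1 hconst).resolve_right (hball z hz).2.2

/-- The singular set of two different nonconstant maps is discrete. -/
lemma eventually_nhdsNE_notMem_singSet [ConnectedSpace S] (hg : HasLifts g) (hgh : HasLifts gh)
    (hne : g ≠ gh) (hg' : ¬ IsConst g) (hgh' : ¬ IsConst gh)
    (h : LiftAt X g q a l (chartAt ℂ q q)) (k : LiftAt X gh q b l (chartAt ℂ q q)) :
    ∀ᶠ z in 𝓝[≠] (chartAt ℂ q q), (chartAt ℂ q).symm z ∉ singSet X g gh := by
  have h1 := (analyticAt_det2 h.lift.an k.lift.an).eventually_eq_zero_or_eventually_ne_zero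
    |>.resolve_left fun h0 => hg.not_eventually_eq hgh hne q ((h.lift.eventually_eq_iff k.lift).1 h0)
  have h2 := (analyticAt_wronskian h.lift.an).eventually_eq_zero_or_eventually_ne_zero
    |>.resolve_left (hg.not_eventually_wronskian_eq_zero hg' h.lift)
  have h3 := (analyticAt_wronskian k.lift.an).eventually_eq_zero_or_eventually_ne_zero
    |>.resolve_left (hgh.not_eventually_wronskian_eq_zero hgh' k.lift)
  filter_upwards [h1, h2, h3, nhdsWithin_le_nhds h.eventually, nhdsWithin_le_nhds k.eventually]
    with z z1 z2 z3 zh zk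
  rw [mem_singSet_iff zh zk]
  push Not
  exact ⟨z1, z2, z3⟩

/-! ### Flat metrics from shared values -/

/-- The functions `t` and `r` describe the metrics `e^t ds` and `e^r ds`, where `ds` is induced by
`X`. For a local lift `a` of `g`, the first one is, up to a flat metric, the `κ`-th power of `|a|`,
and at points of `E` it vanishes at least to the order `e₀`. The second one is larger, and its
curvature is bounded above by `-c`. -/
structure IsBlock (X : S → E4) (g : S → OnePoint ℂ) (E : Set S) (t r : S → ℝ) (κ e₀ c : ℝ) :
    Prop where
  le : ∀ x, t x ≤ r x
  regular : ∀ q ∉ E, ∀ a l, LiftAt X g q a l (chartAt ℂ q q) →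
    (∃ u, IsReHol u (chartAt ℂ q q) ∧ ∀ᶠ z in 𝓝 (chartAt ℂ q q),
      t ((chartAt ℂ q).symm z) + l z = u z + κ / 2 * Real.log (nsq (a z))) ∧
    ∀ᶠ z in 𝓝 (chartAt ℂ q q), (chartAt ℂ q).symm z ∉ E ∧
      ∃ G L, HasLap (fun z => r ((chartAt ℂ q).symm z) + l z) G z L ∧
        c * Real.exp (2 * (r ((chartAt ℂ q).symm z) + l z)) ≤ L
  singular : ∀ q ∈ E, ∀ a l, LiftAt X g q a l (chartAt ℂ q q) →
    ∃ C, ∀ᶠ z in 𝓝 (chartAt ℂ q q), (chartAt ℂ q).symm z ∉ E →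
      t ((chartAt ℂ q).symm z) + l z ≤ e₀ * Real.log ‖z - chartAt ℂ q q‖ + C

/-- Two different maps sharing more than `Q > 4` values give a block of weight `Q - 4`. The weights
of the two spherical derivatives are chosen in such a way that the second map does not contribute to
the curvature. -/
lemma exists_isBlock [ConnectedSpace S] (X : S → E4) (hg : HasLifts g) (hgh : HasLifts gh)
    (hg' : ¬ IsConst g) (hgh' : ¬ IsConst gh)
    {V : Finset (OnePoint ℂ)} (hV : Shares V g gh) {Q : ℝ} (hQ : 4 < Q) (hQV : Q < V.card) :
    ∃ t r c, 0 < c ∧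
      IsBlock X g (singSet X g gh) t r (Q - 4) (min (1 - Q / V.card) (1 / (Q - 2))) c := by
  set n : ℝ := (V.card : ℝ) with hn
  have hn0 : 0 < n := by linarith
  set ε := 1 - Q / n with hε
  set β := 1 / (Q - 2) with hβ
  set α := (Q - 3) / (Q - 2) with hα
  have hQ2 : 0 < Q - 2 := by linarith
  have hε0 : 0 < ε := by rw [hε, sub_pos, div_lt_one hn0]; exact hQV
  have hε1 : ε ≤ 1 := by rw [hε]; have : 0 ≤ Q / n := by positivity
                         linarith
  have hβ0 : 0 < β := by positivity
  have hβα : β ≤ α := by rw [hβ, hα]; gcongr; linarith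
  have hα0 : 0 < α := hβ0.trans_le hβα
  have hαβ : α + β = 1 := by rw [hα, hβ]; field_simp; ring
  have hεn : (1 - ε) * n = Q := by rw [hε]; field_simp; ring
  have hκα : α * ((1 - ε) * n - 2) - 1 = Q - 4 := by rw [hεn, hα]; field_simp; ring
  have hκβ : β * ((1 - ε) * n - 2) - 1 = 0 := by rw [hεn, hβ]; field_simp; ring
  set δ := ε / 2 with hδ
  have hδ0 : 0 < δ := by positivity
  have hδn : Q < (1 - δ) * n := by
    have : (1 - δ) * n = (1 - ε) * n + ε / 2 * n := by rw [hδ]; ring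
    rw [this, hεn]
    have : 0 < ε / 2 * n := by positivity
    linarith
  have hpos : 0 < β * ((1 - δ) * n - 2) - 1 := by
    have : β * (Q - 2) < β * ((1 - δ) * n - 2) := by gcongr
    rw [hεn] at hκβ
    linarith
  set η := (β * ((1 - δ) * n - 2) - 1) / (2 * n * (δ + δ ^ 2)) with hη
  have hη0 : 0 < η := by positivity
  have hηeq : 2 * η * n * (δ + δ ^ 2) = β * ((1 - δ) * n - 2) - 1 := by rw [hη]; field_simp
  have hηα : 2 * η * n * (δ + δ ^ 2) ≤ α * ((1 - δ) * n - 2) - 1 := by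
    rw [hηeq]
    have : 0 ≤ (1 - δ) * n - 2 := by linarith
    have := mul_le_mul_of_nonneg_right hβα this
    linarith
  have hVne : V.Nonempty := by
    rw [← Finset.card_pos]
    have h : (0 : ℝ) < (V.card : ℝ) := hn0
    exact Nat.cast_pos.1 h
  obtain ⟨c, hc, hcurv⟩ := exists_curvLog_hasLap (X := X) hVne hV hα0.le hβ0.le hαβ hδ0
    (by linarith) hη0 hηα hηeq.le
  refine ⟨flatLog X g gh V ε α β, curvLog X g gh V δ η α β, c, hc, ?_, ?_, ?_⟩
  · exact fun x => flatLog_le_curvLog (by linarith) hα0.le hβ0.le hη0.le x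
  · intro q hq a l h
    obtain ⟨b, hb⟩ := hgh q
    have k : LiftAt X gh q b l (chartAt ℂ q q) := ⟨h.mem, hb, h.conf⟩
    have hz : (chartAt ℂ q).symm (chartAt ℂ q q) ∉ singSet X g gh := by
      rwa [(chartAt ℂ q).left_inv (mem_chart_source ℂ q)]
    constructor
    · obtain ⟨u, hu, hev⟩ := flatLog_isReHol (ε := ε) hV hαβ h k hz
      refine ⟨u, hu, hev.mono fun z hz => ?_⟩
      rw [hz, hκα, hκβ]; ring
    · filter_upwards [h.eventually, k.eventually, eventually_notMem_singSet h k hz] with z zh zk hz'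
      exact ⟨hz', hcurv q a b l z zh zk hz'⟩
  · intro q hq a l h
    obtain ⟨b, hb⟩ := hgh q
    have k : LiftAt X gh q b l (chartAt ℂ q q) := ⟨h.mem, hb, h.conf⟩
    refine flatLog_le_of_mem hV hαβ hα0 hβ0 hε0 (min_le_left _ _)
      ((min_le_right _ _).trans hβα) (min_le_right _ _) h k
      (fun v _ => hg.not_eventually_det2_eq_zero hg' h.lift v)
      (fun v _ => hgh.not_eventually_det2_eq_zero hgh' hb v) ?_
    rwa [(chartAt ℂ q).left_inv (mem_chart_source ℂ q)]

/-- If the metric `e^t ds` vanishes on `E` to the order `e₀`, it is locally bounded. -/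
lemma IsBlock.exists_le {E : Set S} {t r : S → ℝ} {κ e₀ c : ℝ} (H : IsBlock X g E t r κ e₀ c)
    (he : 0 ≤ e₀) (h : LiftAt X g q a l (chartAt ℂ q q)) :
    ∃ C, ∀ᶠ z in 𝓝 (chartAt ℂ q q), (chartAt ℂ q).symm z ∉ E →
      t ((chartAt ℂ q).symm z) + l z ≤ C := by
  by_cases hq : q ∈ E
  · obtain ⟨C, hC⟩ := H.singular q hq a l h
    refine ⟨C, ?_⟩
    filter_upwards [hC, Metric.ball_mem_nhds _ one_pos] with z hz hz1 hzE
    have : Real.log ‖z - chartAt ℂ q q‖ ≤ 0 := by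
      rw [Metric.mem_ball, dist_eq_norm] at hz1
      exact Real.log_nonpos (norm_nonneg _) hz1.le
    have := mul_nonpos_of_nonneg_of_nonpos he this
    linarith [hz hzE]
  · obtain ⟨⟨u, hu, hev⟩, -⟩ := H.regular q hq a l h
    obtain ⟨G, hG⟩ := hu.exists_hasLap
    obtain ⟨C, hC⟩ := exists_eventually_le
      (hG.continuousAt.add (continuousAt_const.mul (continuousAt_log_nsq h.lift.an h.lift.ne)) :
        ContinuousAt (fun z => u z + κ / 2 * Real.log (nsq (a z))) (chartAt ℂ q q))
    exact ⟨C, by filter_upwards [hev, hC] with z h1 h2 _ using h1.trans_le h2⟩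

/-- The metric `e^t ds` gives rise to a flat metric which grows fast at points of `E`: the `p`-th
power of `e^t ds` is, up to a flat factor, the metric `ds`, so that a combination of the two metrics
is flat. -/
structure IsFlatPower (X : S → E4) (E : Set S) (t r : S → ℝ) (p c : ℝ) : Prop where
  le : ∀ x, t x ≤ r x
  regular : ∀ q ∉ E, ∃ l : ℂ → ℝ,
    IsReHol (fun z => p * (t ((chartAt ℂ q).symm z) + l z) - l z) (chartAt ℂ q q) ∧
    ∀ᶠ z in 𝓝 (chartAt ℂ q q), ConfAt (X ∘ (chartAt ℂ q).symm) (l z) z ∧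
      (chartAt ℂ q).symm z ∉ E ∧
      ∃ G L, HasLap (fun z => r ((chartAt ℂ q).symm z) + l z) G z L ∧
        c * Real.exp (2 * (r ((chartAt ℂ q).symm z) + l z)) ≤ L
  singular : ∀ q ∈ E, ∃ (l : ℂ → ℝ) (C : ℝ), ∀ᶠ z in 𝓝 (chartAt ℂ q q),
    ConfAt (X ∘ (chartAt ℂ q).symm) (l z) z ∧ ((chartAt ℂ q).symm z ∉ E →
      p * (t ((chartAt ℂ q).symm z) + l z) - l z ≤ (1 - p) * Real.log ‖z - chartAt ℂ q q‖ + C)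

/-- The flat metric is `σ` with `ds = σ^(1 - p) (e^t ds)^p`. -/
lemma IsFlatPower.isFlatPair {E : Set S} {t r : S → ℝ} {p c : ℝ} (H : IsFlatPower X E t r p c)
    (hp : p < 1) :
    IsFlatPair X E (fun x => -(p / (1 - p)) * t x) (fun x => r x + p / (1 - p) * t x) c := by
  have hp' : 0 < 1 - p := by linarith
  constructor
  · intro q hq
    obtain ⟨l, hu, hev⟩ := H.regular q hq
    obtain ⟨F, hF, hFu⟩ := hu.const_mul (-(1 - p)⁻¹)
    refine ⟨l, F, hF, ?_⟩
    have hkey : ∀ z, -(1 - p)⁻¹ * (p * (t ((chartAt ℂ q).symm z) + l z) - l z) =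
        l z + -(p / (1 - p)) * t ((chartAt ℂ q).symm z) := by
      intro z; field_simp; ring
    filter_upwards [hev, hF.eventually_analyticAt, hFu.eventuallyEq_nhds]
      with z ⟨h1, h2, G, L, hL, hcL⟩ h3 h4
    have hz : l z + -(p / (1 - p)) * t ((chartAt ℂ q).symm z) = (F z).re := by
      rw [← hkey]; exact h4.self_of_nhds
    refine ⟨h2, h1, hz, _, _, (hL.add ((HasLap.re h3).const_mul (-1))).congr ?_, ?_⟩
    · filter_upwards [h4] with w hw
      rw [hkey] at hw
      rw [← hw]; ring
    · rw [← hz]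
      refine le_trans (le_of_eq ?_) (hcL.trans (by simp))
      congr 3
      ring
  · intro q hq
    obtain ⟨l, C, hev⟩ := H.singular q hq
    refine ⟨l, (1 - p)⁻¹ * C, ?_⟩
    filter_upwards [hev] with z ⟨h1, h2⟩
    refine ⟨h1, fun hz => ?_⟩
    have h3 := mul_le_mul_of_nonneg_left (h2 hz) (inv_pos.2 hp').le
    have e1 : (1 - p)⁻¹ * (p * (t ((chartAt ℂ q).symm z) + l z) - l z) =
        -(l z + -(p / (1 - p)) * t ((chartAt ℂ q).symm z)) := by
      field_simp; ring
    have e2 : (1 - p)⁻¹ * ((1 - p) * Real.log ‖z - chartAt ℂ q q‖ + C) =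
        Real.log ‖z - chartAt ℂ q q‖ + (1 - p)⁻¹ * C := by
      field_simp
    rw [e1, e2] at h3
    linarith

lemma IsFlatPower.not_isCompleteSurface [IsManifold 𝓘(ℂ) ω S] [T2Space S] {E : Set S} {t r : S → ℝ}
    {p c : ℝ} (H : IsFlatPower X E t r p c) (hc : 0 < c) (hp0 : 0 < p) (hp : p < 1) {x₀ : S}
    (hx₀ : x₀ ∉ E) : ¬ IsCompleteSurface X := by
  refine (H.isFlatPair hp).not_isCompleteSurface hc hp0 hp (fun x _ => ?_) hx₀
  have hp' : 0 < 1 - p := by linarith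
  have h1 := mul_le_mul_of_nonneg_left (H.le x) hp0.le
  have e1 : p * (t x + p / (1 - p) * t x) = - (-(p / (1 - p)) * t x) := by field_simp; ring
  rw [← e1]
  linarith

section Combination

variable {g₁ g₂ : S → OnePoint ℂ} {E₁ E₂ : Set S} {t₁ r₁ t₂ r₂ : S → ℝ}
  {κ₁ κ₂ e₁ e₂ c₁ c₂ : ℝ}

/-- Near each point, `g₁` and `g₂` have lifts `a` and `b` such that the metric induced by `X` is
`|a| |b| |dz|`. -/
def HasLiftPairs (X : S → E4) (g₁ g₂ : S → OnePoint ℂ) : Prop :=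
  ∀ q, ∃ a b l, LiftAt X g₁ q a l (chartAt ℂ q q) ∧ LiftAt X g₂ q b l (chartAt ℂ q q) ∧
    ∀ z, l z = Real.log (nsq (a z)) / 2 + Real.log (nsq (b z)) / 2

lemma eventually_log_norm_sub_nonpos (z₀ : ℂ) : ∀ᶠ z in 𝓝 z₀, Real.log ‖z - z₀‖ ≤ 0 := by
  filter_upwards [Metric.ball_mem_nhds z₀ one_pos] with z hz
  rw [Metric.mem_ball, dist_eq_norm] at hz
  exact Real.log_nonpos (norm_nonneg _) hz.le

/-- The weights `1 / κ₁` and `1 / κ₂` turn the powers of `|a|` and `|b|` into the metric `ds`. -/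
lemma IsBlock.combine (hX : HasLiftPairs X g₁ g₂) (H₁ : IsBlock X g₁ E₁ t₁ r₁ κ₁ e₁ c₁)
    (H₂ : IsBlock X g₂ E₂ t₂ r₂ κ₂ e₂ c₂) (hκ₁ : 0 < κ₁) (hκ₂ : 0 < κ₂) (he₁ : 0 ≤ e₁)
    (he₂ : 0 ≤ e₂) (hc₁ : 0 < c₁) (hc₂ : 0 < c₂) {p : ℝ} (hp : p = 1 / κ₁ + 1 / κ₂) (h₁ : 1 - p ≤ 1 / κ₁ * e₁)
    (h₂ : 1 - p ≤ 1 / κ₂ * e₂) :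
    IsFlatPower X (E₁ ∪ E₂) (fun x => 1 / κ₁ / p * t₁ x + 1 / κ₂ / p * t₂ x)
      (fun x => 1 / κ₁ / p * r₁ x + 1 / κ₂ / p * r₂ x) p (min c₁ c₂) := by
  set s₁ := 1 / κ₁ with hs₁
  set s₂ := 1 / κ₂ with hs₂
  have hs₁0 : 0 < s₁ := by positivity
  have hs₂0 : 0 < s₂ := by positivity
  have hp0 : 0 < p := by rw [hp]; positivity
  have hw : s₁ / p + s₂ / p = 1 := by rw [hp]; field_simp
  have hw₁ : 0 ≤ s₁ / p := by positivity
  have hw₂ : 0 ≤ s₂ / p := by positivity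
  have hcomb : ∀ x y m : ℝ, p * (s₁ / p * x + s₂ / p * y + m) = s₁ * (x + m) + s₂ * (y + m) := by
    intro x y m
    have : p * m = s₁ * m + s₂ * m := by rw [hp]; ring
    field_simp
    linarith
  constructor
  · intro x
    have := H₁.le x
    have := H₂.le x
    gcongr
  · intro q hq
    obtain ⟨a, b, l, ha, hb, hl⟩ := hX q
    obtain ⟨⟨u₁, hu₁, hev₁⟩, hr₁⟩ := H₁.regular q (fun h => hq (Or.inl h)) a l ha
    obtain ⟨⟨u₂, hu₂, hev₂⟩, hr₂⟩ := H₂.regular q (fun h => hq (Or.inr h)) b l hb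
    refine ⟨l, ((hu₁.const_mul s₁).add (hu₂.const_mul s₂)).congr ?_, ?_⟩
    · filter_upwards [hev₁, hev₂] with z h1 h2
      rw [hcomb, h1, h2, hl, hs₁, hs₂]
      field_simp
      ring
    · filter_upwards [ha.conf, hr₁, hr₂] with z hz ⟨hE₁, G₁, L₁, hL₁, hL₁'⟩ ⟨hE₂, G₂, L₂, hL₂, hL₂'⟩
      refine ⟨hz, fun h => h.elim hE₁ hE₂, _, _,
        ((hL₁.const_mul (s₁ / p)).add (hL₂.const_mul (s₂ / p))).congr
          (Eventually.of_forall fun w => ?_), ?_⟩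
      · linear_combination (l w) * hw
      · have hconv := convexOn_exp.2 (Set.mem_univ (2 * (r₁ ((chartAt ℂ q).symm z) + l z)))
          (Set.mem_univ (2 * (r₂ ((chartAt ℂ q).symm z) + l z))) hw₁ hw₂ hw
        simp only [smul_eq_mul] at hconv
        have hc : 0 < min c₁ c₂ := lt_min hc₁ hc₂
        calc min c₁ c₂ * Real.exp (2 * (s₁ / p * r₁ ((chartAt ℂ q).symm z) +
              s₂ / p * r₂ ((chartAt ℂ q).symm z) + l z))
            = min c₁ c₂ * Real.exp (s₁ / p * (2 * (r₁ ((chartAt ℂ q).symm z) + l z)) +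
              s₂ / p * (2 * (r₂ ((chartAt ℂ q).symm z) + l z))) := by
              congr 2; linear_combination (-2 * l z) * hw
          _ ≤ min c₁ c₂ * (s₁ / p * Real.exp (2 * (r₁ ((chartAt ℂ q).symm z) + l z)) +
              s₂ / p * Real.exp (2 * (r₂ ((chartAt ℂ q).symm z) + l z))) := by gcongr
          _ = s₁ / p * (min c₁ c₂ * Real.exp (2 * (r₁ ((chartAt ℂ q).symm z) + l z))) +
              s₂ / p * (min c₁ c₂ * Real.exp (2 * (r₂ ((chartAt ℂ q).symm z) + l z))) := by ring
          _ ≤ s₁ / p * L₁ + s₂ / p * L₂ := by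
              gcongr
              · refine le_trans ?_ hL₁'
                gcongr
                exact min_le_left _ _
              · refine le_trans ?_ hL₂'
                gcongr
                exact min_le_right _ _
  · intro q hq
    obtain ⟨a, b, l, ha, hb, hl⟩ := hX q
    have hlc : ContinuousAt (fun z => -l z) (chartAt ℂ q q) := by
      simp only [hl]
      exact (((continuousAt_log_nsq ha.lift.an ha.lift.ne).div_const 2).add
        ((continuousAt_log_nsq hb.lift.an hb.lift.ne).div_const 2)).neg
    obtain ⟨C, hC⟩ := exists_eventually_le hlc
    obtain ⟨C₁, hC₁⟩ := H₁.exists_le he₁ ha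
    obtain ⟨C₂, hC₂⟩ := H₂.exists_le he₂ hb
    rcases hq with hq | hq
    · obtain ⟨C₁, hC₁⟩ := H₁.singular q hq a l ha
      refine ⟨l, s₁ * C₁ + s₂ * C₂ + C, ?_⟩
      filter_upwards [hC, hC₁, hC₂, ha.conf, eventually_log_norm_sub_nonpos (chartAt ℂ q q)]
        with z k k₁ k₂ hz hlog
      refine ⟨hz, fun hE => ?_⟩
      rw [hcomb]
      have e1 := mul_le_mul_of_nonneg_left (k₁ fun h => hE (Or.inl h)) hs₁0.le
      have e2 := mul_le_mul_of_nonneg_left (k₂ fun h => hE (Or.inr h)) hs₂0.le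
      have e3 := mul_le_mul_of_nonpos_right h₁ hlog
      linarith
    · obtain ⟨C₂, hC₂⟩ := H₂.singular q hq b l hb
      refine ⟨l, s₁ * C₁ + s₂ * C₂ + C, ?_⟩
      filter_upwards [hC, hC₁, hC₂, ha.conf, eventually_log_norm_sub_nonpos (chartAt ℂ q q)]
        with z k k₁ k₂ hz hlog
      refine ⟨hz, fun hE => ?_⟩
      rw [hcomb]
      have e1 := mul_le_mul_of_nonneg_left (k₁ fun h => hE (Or.inl h)) hs₁0.le
      have e2 := mul_le_mul_of_nonneg_left (k₂ fun h => hE (Or.inr h)) hs₂0.le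
      have e3 := mul_le_mul_of_nonpos_right h₂ hlog
      linarith

/-- The norm of a lift of a constant map is the modulus of a holomorphic function. -/
lemma isReHol_log_nsq {v : OnePoint ℂ} {b : ℂ → ℂ × ℂ} {z : ℂ}
    (hb : IsLift (fun _ => v) b z) : IsReHol (fun w => Real.log (nsq (b w))) z := by
  set m : ℂ × ℂ := (conj (rep v).1, conj (rep v).2) with hm
  have hf : AnalyticAt ℂ (fun w => m.1 * (b w).1 + m.2 * (b w).2) z :=
    (analyticAt_const.mul hb.an_fst).add (analyticAt_const.mul hb.an_snd)
  have hone : m.1 * (rep v).1 + m.2 * (rep v).2 = 1 := by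
    rw [hm, mul_comm, mul_comm (conj _), Complex.mul_conj, Complex.mul_conj,
      Complex.normSq_eq_norm_sq, Complex.normSq_eq_norm_sq]
    exact_mod_cast nsq_rep v
  have hval : ∀ c : ℂ, ∀ d, d = c • rep v → m.1 * d.1 + m.2 * d.2 = c := by
    rintro c d rfl
    simp only [Prod.smul_fst, Prod.smul_snd, smul_eq_mul]
    linear_combination c * hone
  refine ((IsReHol.log_norm hf ?_).const_mul 2).congr ?_
  · obtain ⟨c, hc, hbc⟩ := hb.eq.self_of_nhds
    rwa [hval c _ hbc]
  · filter_upwards [hb.eq] with w ⟨c, hc, hbc⟩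
    rw [hval c _ hbc, hbc, nsq_smul, nsq_rep, mul_one, Real.log_pow]
    norm_num

/-- If `g₂` is constant, a single block suffices, because `|b|` is a flat factor. -/
lemma IsBlock.single (hX : HasLiftPairs X g₁ g₂) (H : IsBlock X g₁ E₁ t₁ r₁ κ₁ e₁ c₁)
    (hg₂ : IsConst g₂) (hκ₁ : 0 < κ₁) {p : ℝ} (hp : p = 1 / κ₁) (h₁ : 1 - p ≤ p * e₁) :
    IsFlatPower X E₁ t₁ r₁ p c₁ := by
  have hp0 : 0 < p := by rw [hp]; positivity
  obtain ⟨v, hv⟩ := hg₂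
  obtain rfl : g₂ = fun _ => v := funext hv
  refine ⟨H.le, fun q hq => ?_, fun q hq => ?_⟩
  · obtain ⟨a, b, l, ha, hb, hl⟩ := hX q
    obtain ⟨⟨u, hu, hev⟩, hr⟩ := H.regular q hq a l ha
    refine ⟨l, ((hu.const_mul p).add ((isReHol_log_nsq hb.lift).const_mul (-(1 / 2)))).congr ?_, ?_⟩
    · filter_upwards [hev] with z h1
      rw [h1, hl, hp]
      field_simp
      ring
    · filter_upwards [ha.conf, hr] with z hz hz' using ⟨hz, hz'⟩
  · obtain ⟨a, b, l, ha, hb, hl⟩ := hX q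
    have hlc : ContinuousAt (fun z => -l z) (chartAt ℂ q q) := by
      simp only [hl]
      exact (((continuousAt_log_nsq ha.lift.an ha.lift.ne).div_const 2).add
        ((continuousAt_log_nsq hb.lift.an hb.lift.ne).div_const 2)).neg
    obtain ⟨C, hC⟩ := exists_eventually_le hlc
    obtain ⟨C₁, hC₁⟩ := H.singular q hq a l ha
    refine ⟨l, p * C₁ + C, ?_⟩
    filter_upwards [hC, hC₁, ha.conf, eventually_log_norm_sub_nonpos (chartAt ℂ q q)]
      with z k k₁ hz hlog
    refine ⟨hz, fun hE => ?_⟩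
    have e1 := mul_le_mul_of_nonneg_left (k₁ hE) hp0.le
    have e3 := mul_le_mul_of_nonpos_right h₁ hlog
    linarith

end Combination

end Surface

/-! ### Minimal surfaces in conformal coordinates -/

section Conformal

variable {Y : ℂ → E4} {z : ℂ}

/-- The Laplacian of a conformal immersion is normal to the surface. -/
lemma inner_laplacian_eq_zero (hY : ContDiffAt ℝ 2 Y z)
    (hc : ∀ᶠ w in 𝓝 z, IsConformalMap (fderiv ℝ Y w)) :
    inner ℝ (Laplacian.laplacian Y z) (fderiv ℝ Y z 1) = 0 ∧
      inner ℝ (Laplacian.laplacian Y z) (fderiv ℝ Y z I) = 0 := by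
  have hD : HasFDerivAt (fderiv ℝ Y) (fderiv ℝ (fderiv ℝ Y) z) z :=
    ((hY.fderiv_right (m := 1) (by norm_num)).differentiableAt (by norm_num)).hasFDerivAt
  set D := fderiv ℝ (fderiv ℝ Y) z with hDdef
  have hsymm : D 1 I = D I 1 := (hY.isSymmSndFDerivAt (by simp)) 1 I
  have happ : ∀ h : ℂ, HasFDerivAt (fun w => fderiv ℝ Y w h) (D.flip h) z := fun h =>
    ((ContinuousLinearMap.apply ℝ E4 h).hasFDerivAt.comp z hD).congr_fderiv (by ext; simp)
  have hlap : Laplacian.laplacian Y z = D 1 1 + D I I := by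
    rw [InnerProductSpace.laplacian_eq_iteratedFDeriv_complexPlane]
    simp [iteratedFDeriv_two_apply, hDdef]
  have hi : ∀ u v m : ℂ, fderiv ℝ (fun w => inner ℝ (fderiv ℝ Y w u) (fderiv ℝ Y w v)) z m =
      inner ℝ (fderiv ℝ Y z u) (D m v) + inner ℝ (D m u) (fderiv ℝ Y z v) := by
    intro u v m
    rw [((happ u).inner ℝ (happ v)).fderiv]
    simp
  have h11 : ∀ m, inner ℝ (D m 1) (fderiv ℝ Y z 1) = inner ℝ (D m I) (fderiv ℝ Y z I) := by
    intro m
    have heq : (fun w => inner ℝ (fderiv ℝ Y w 1) (fderiv ℝ Y w 1)) =ᶠ[𝓝 z]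
        fun w => inner ℝ (fderiv ℝ Y w I) (fderiv ℝ Y w I) := by
      filter_upwards [hc] with w hw
      obtain ⟨c, -, hc⟩ := (isConformalMap_iff _).1 hw
      rw [hc, hc]; simp
    have := congrArg (fun L : ℂ →L[ℝ] ℝ => L m) (heq.fderiv_eq (𝕜 := ℝ))
    simp only [hi] at this
    rw [real_inner_comm, real_inner_comm (D m I)] at this
    linarith
  have h1I : ∀ m, inner ℝ (D m I) (fderiv ℝ Y z 1) + inner ℝ (D m 1) (fderiv ℝ Y z I) = 0 := by
    intro m
    have heq : (fun w => inner ℝ (fderiv ℝ Y w 1) (fderiv ℝ Y w I)) =ᶠ[𝓝 z] fun _ => (0 : ℝ) := by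
      filter_upwards [hc] with w hw
      obtain ⟨c, -, hc⟩ := (isConformalMap_iff _).1 hw
      simp [hc]
    have := congrArg (fun L : ℂ →L[ℝ] ℝ => L m) (heq.fderiv_eq (𝕜 := ℝ))
    simp only [hi] at this
    rw [real_inner_comm] at this
    simpa using this
  rw [hlap, inner_add_left, inner_add_left]
  have a1 := h11 1
  have a2 := h11 I
  have a3 := h1I 1
  have a4 := h1I I
  rw [hsymm] at a1 a3
  constructor <;> linarith

lemma norm_fderiv_of_isConformalMap {L : ℂ →L[ℝ] E4} (h : IsConformalMap L) :
    0 < ‖L 1‖ ∧ (∀ x, ‖L x‖ = ‖L 1‖ * ‖x‖) ∧ inner ℝ (L 1) (L I) = 0 := by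
  obtain ⟨c, hc0, hc⟩ := (isConformalMap_iff _).1 h
  have hn : ∀ x, ‖L x‖ = Real.sqrt c * ‖x‖ := fun x => by
    rw [norm_eq_sqrt_real_inner, hc, real_inner_self_eq_norm_sq, Real.sqrt_mul hc0.le,
      Real.sqrt_sq (norm_nonneg _)]
  have h1 : ‖L 1‖ = Real.sqrt c := by rw [hn]; simp
  refine ⟨by rw [h1]; exact Real.sqrt_pos.2 hc0, fun x => by rw [hn, h1], ?_⟩
  rw [hc]; simp

/-- In an isothermal coordinate, `φ` lies on the quadric, and its norm gives the metric. -/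
lemma sum_phi_sq {S : Type*} [TopologicalSpace S] {X : S → E4} {e : OpenPartialHomeomorph S ℂ} {z : ℂ}
    (h : IsConformalMap (fderiv ℝ (inChart X e) z)) :
    (phi X e z 0 - I * phi X e z 1) * (phi X e z 0 + I * phi X e z 1) =
      (phi X e z 2 + I * phi X e z 3) * (-phi X e z 2 + I * phi X e z 3) ∧
    ‖phi X e z 0 - I * phi X e z 1‖ ^ 2 + ‖phi X e z 0 + I * phi X e z 1‖ ^ 2 +
      ‖phi X e z 2 + I * phi X e z 3‖ ^ 2 + ‖-phi X e z 2 + I * phi X e z 3‖ ^ 2 =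
      ‖partialU X e z‖ ^ 2 := by
  obtain ⟨-, hn, hi⟩ := norm_fderiv_of_isConformalMap h
  have hI := hn I
  rw [Complex.norm_I, mul_one] at hI
  have hU : ‖partialU X e z‖ ^ 2 = partialU X e z 0 ^ 2 + partialU X e z 1 ^ 2 +
      partialU X e z 2 ^ 2 + partialU X e z 3 ^ 2 := by
    rw [EuclideanSpace.norm_sq_eq, Fin.sum_univ_four]; simp
  have hV : ‖partialU X e z‖ ^ 2 = partialV X e z 0 ^ 2 + partialV X e z 1 ^ 2 +
      partialV X e z 2 ^ 2 + partialV X e z 3 ^ 2 := by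
    have : ‖partialU X e z‖ = ‖partialV X e z‖ := hI.symm
    rw [this, EuclideanSpace.norm_sq_eq, Fin.sum_univ_four]; simp
  have hUV : partialU X e z 0 * partialV X e z 0 + partialU X e z 1 * partialV X e z 1 +
      partialU X e z 2 * partialV X e z 2 + partialU X e z 3 * partialV X e z 3 = 0 := by
    have : inner ℝ (partialU X e z) (partialV X e z) = 0 := hi
    rw [PiLp.inner_apply, Fin.sum_univ_four] at this
    simp only [RCLike.inner_apply, conj_trivial] at this
    linarith
  constructor
  · simp only [phi]
    apply Complex.ext
    · simp
      linarith
    · simp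
      linarith
  · simp only [phi, ← Complex.normSq_eq_norm_sq, Complex.normSq_apply]
    simp
    linarith

end Conformal

section Surface

variable {S : Type*} [TopologicalSpace S] [ChartedSpace ℂ S] {X : S → E4}

lemma IsMinimalSurface.contDiffAt (hX : IsMinimalSurface X) (p : S) {n : ℕ} :
    ∀ᶠ z in 𝓝 (chartAt ℂ p p), ContDiffAt ℝ n (inChart X (chartAt ℂ p)) z := by
  have h := (contMDiffAt_iff.1 (hX.smooth p)).2
  simp only [extChartAt, OpenPartialHomeomorph.extend, modelWithCornersSelf_partialEquiv,
    PartialEquiv.trans_refl, modelWithCornersSelf_coe, Set.range_id, contDiffWithinAt_univ] at h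
  have h' : ContDiffAt ℝ n (inChart X (chartAt ℂ p)) (chartAt ℂ p p) := h.of_le (by
    exact_mod_cast le_top)
  exact h'.eventually (by simp)

/-- The coordinate functions of a minimal surface are harmonic. -/
lemma IsMinimalSurface.harmonicAt (hX : IsMinimalSurface X) (p : S) :
    HarmonicAt (inChart X (chartAt ℂ p)) (chartAt ℂ p p) := by
  refine ⟨(hX.contDiffAt p (n := 2)).self_of_nhds, ?_⟩
  filter_upwards [hX.contDiffAt p (n := 2), (chartAt ℂ p).open_target.mem_nhds
    (mem_chart_target ℂ p)] with z hz hzt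
  have hconf : ∀ᶠ w in 𝓝 z, IsConformalMap (fderiv ℝ (inChart X (chartAt ℂ p)) w) := by
    filter_upwards [(chartAt ℂ p).open_target.mem_nhds hzt] with w hw
    exact hX.conformal _ (chart_mem_atlas ℂ p) w hw
  obtain ⟨h1, h2⟩ := inner_laplacian_eq_zero hz hconf
  have hpos := (norm_fderiv_of_isConformalMap hconf.self_of_nhds).1
  have hH := hX.minimal _ (chart_mem_atlas ℂ p) z hzt
  rw [meanCurvature, smul_eq_zero] at hH
  have hH := hH.resolve_left (by
    have : 0 < ‖partialU X (chartAt ℂ p) z‖ := hpos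
    positivity)
  rw [Submodule.starProjection_apply_eq_zero_iff, Submodule.orthogonal_orthogonal, tangentPlane,
    Submodule.mem_span_pair] at hH
  obtain ⟨s, t, hst⟩ := hH
  have h0 : inner ℝ (Laplacian.laplacian (inChart X (chartAt ℂ p)) z)
      (s • partialU X (chartAt ℂ p) z + t • partialV X (chartAt ℂ p) z) = 0 := by
    rw [inner_add_right, real_inner_smul_right, real_inner_smul_right, partialU, h1, partialV, h2]
    simp
  rw [hst] at h0
  exact inner_self_eq_zero.1 h0

/-- The forms `φᵢ` are holomorphic. -/
lemma IsMinimalSurface.analyticAt_phi (hX : IsMinimalSurface X) (p : S) (i : Fin 4) :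
    AnalyticAt ℂ (fun z => phi X (chartAt ℂ p) z i) (chartAt ℂ p p) := by
  have h := (hX.harmonicAt p).comp_CLM (EuclideanSpace.proj i : E4 →L[ℝ] ℝ)
  refine ((HarmonicAt.analyticAt_complex_partial h).div_const (c := 2)).congr ?_
  filter_upwards [hX.contDiffAt p (n := 1)] with z hz
  have hd := (hz.differentiableAt (by norm_num)).hasFDerivAt
  have := ((EuclideanSpace.proj i : E4 →L[ℝ] ℝ).hasFDerivAt.comp z hd).fderiv
  simp only [phi, partialU, partialV]
  rw [this]
  simp

/-! ### The Gauss map and its lifts -/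

lemma ratio_mul_right {c : ℂ} (hc : c ≠ 0) (a b : ℂ) : ratio (a * c) (b * c) = ratio a b := by
  unfold ratio
  by_cases hb : b = 0
  · simp [hb]
  · rw [if_neg hb, if_neg (mul_ne_zero hb hc), mul_div_mul_right _ _ hc]

/-- A factorization of the coordinates of a point of the quadric gives homogeneous coordinates of
its two components. -/
lemma quadricToSpheres_eq {w : Fin 4 → ℂ} {a b : ℂ × ℂ} (ha : a ≠ 0) (hb : b ≠ 0)
    (hA : w 0 - I * w 1 = a.1 * b.1) (hB : w 0 + I * w 1 = a.2 * b.2)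
    (hC : w 2 + I * w 3 = a.2 * b.1) (hD : -w 2 + I * w 3 = a.1 * b.2) :
    quadricToSpheres w = (ratio a.2 a.1, ratio b.2 b.1) := by
  have ha' : a.1 = 0 → a.2 ≠ 0 := fun h1 h2 => ha (Prod.ext h1 h2)
  have hb' : b.1 = 0 → b.2 ≠ 0 := fun h1 h2 => hb (Prod.ext h1 h2)
  rw [quadricToSpheres, hA, hB, hC, hD]
  refine Prod.ext ?_ ?_
  · by_cases h : b.1 = 0
    · simp only [h, mul_zero, and_self, if_true]
      exact ratio_mul_right (hb' h) _ _
    · have : ¬(a.1 * b.1 = 0 ∧ a.2 * b.1 = 0) := by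
        simp only [mul_eq_zero, h, or_false]
        exact fun h => ha' h.1 h.2
      simp only [this, if_false]
      exact ratio_mul_right h _ _
  · by_cases h : a.1 = 0
    · simp only [h, zero_mul, and_self, if_true]
      rw [mul_comm a.2, mul_comm a.2]
      exact ratio_mul_right (ha' h) _ _
    · have : ¬(a.1 * b.1 = 0 ∧ a.1 * b.2 = 0) := by
        simp only [mul_eq_zero, h, false_or]
        exact fun h => hb' h.1 h.2
      simp only [this, if_false]
      rw [mul_comm a.1, mul_comm a.1]
      exact ratio_mul_right h _ _

/-- Holomorphic functions with `A B = C D` and without common zero factor simultaneously. -/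
lemma exists_factorization {A B C D : ℂ → ℂ} {z₀ : ℂ} (hA : AnalyticAt ℂ A z₀)
    (hB : AnalyticAt ℂ B z₀) (hC : AnalyticAt ℂ C z₀) (hD : AnalyticAt ℂ D z₀)
    (hABCD : ∀ᶠ z in 𝓝 z₀, A z * B z = C z * D z)
    (hne : A z₀ ≠ 0 ∨ B z₀ ≠ 0 ∨ C z₀ ≠ 0 ∨ D z₀ ≠ 0) :
    ∃ a b : ℂ → ℂ × ℂ, AnalyticAt ℂ a z₀ ∧ AnalyticAt ℂ b z₀ ∧ a z₀ ≠ 0 ∧ b z₀ ≠ 0 ∧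
      ∀ᶠ z in 𝓝 z₀, A z = (a z).1 * (b z).1 ∧ B z = (a z).2 * (b z).2 ∧
        C z = (a z).2 * (b z).1 ∧ D z = (a z).1 * (b z).2 := by
  have hone : AnalyticAt ℂ (fun _ : ℂ => (1 : ℂ)) z₀ := analyticAt_const
  rcases hne with h | h | h | h
  · refine ⟨fun z => (1, C z / A z), fun z => (A z, D z), hone.prod (hC.div hA h), hA.prod hD,
      by simp [Prod.ext_iff], by simp [Prod.ext_iff, h], ?_⟩
    filter_upwards [hABCD, hA.continuousAt.eventually_ne h] with z h1 h2
    refine ⟨by simp, ?_, by field_simp, by simp⟩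
    field_simp
    linear_combination h1
  · refine ⟨fun z => (D z / B z, 1), fun z => (C z, B z), (hD.div hB h).prod hone, hC.prod hB,
      by simp [Prod.ext_iff], by simp [Prod.ext_iff, h], ?_⟩
    filter_upwards [hABCD, hB.continuousAt.eventually_ne h] with z h1 h2
    refine ⟨?_, by simp, by simp, by field_simp⟩
    field_simp
    linear_combination h1
  · refine ⟨fun z => (A z / C z, 1), fun z => (C z, B z), (hA.div hC h).prod hone, hC.prod hB,
      by simp [Prod.ext_iff], by simp [Prod.ext_iff, h], ?_⟩
    filter_upwards [hABCD, hC.continuousAt.eventually_ne h] with z h1 h2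
    refine ⟨by field_simp, by simp, by simp, ?_⟩
    field_simp
    linear_combination -h1
  · refine ⟨fun z => (1, B z / D z), fun z => (A z, D z), hone.prod (hB.div hD h), hA.prod hD,
      by simp [Prod.ext_iff], by simp [Prod.ext_iff, h], ?_⟩
    filter_upwards [hABCD, hD.continuousAt.eventually_ne h] with z h1 h2
    refine ⟨by simp, by field_simp, ?_, by simp⟩
    field_simp
    linear_combination -h1

/-- The forms `φᵢ` in another coordinate. -/
lemma IsMinimalSurface.phi_eq_smul [IsManifold 𝓘(ℂ) ω S] (hX : IsMinimalSurface X) {p x : S}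
    (hx : x ∈ (chartAt ℂ p).source)
    (hd : DifferentiableAt ℝ (inChart X (chartAt ℂ p)) (chartAt ℂ p x)) :
    ∃ c : ℂ, c ≠ 0 ∧
      phi X (chartAt ℂ x) (chartAt ℂ x x) = c • phi X (chartAt ℂ p) (chartAt ℂ p x) := by
  set e := chartAt ℂ p with he
  set f := chartAt ℂ x with hf
  have hxf : x ∈ f.source := mem_chart_source ℂ x
  have hft : f x ∈ f.target := mem_chart_target ℂ x
  have hfx : f.symm (f x) = x := f.left_inv hxf
  have hT : AnalyticAt ℂ (e ∘ f.symm) (f x) :=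
    analyticAt_chart_comp (contMDiffAt_chart_symm_comp (f := id) analyticAt_id hft)
      (by change f.symm (f x) ∈ e.source; rwa [hfx])
  have heq : inChart X f =ᶠ[𝓝 (f x)] inChart X e ∘ (e ∘ f.symm) := by
    have hc : ContinuousAt f.symm (f x) := f.continuousAt_symm hft
    filter_upwards [hc.eventually (e.open_source.mem_nhds (by rwa [hfx]))] with w hw
    simp [inChart, e.left_inv hw]
  have hd' : HasFDerivAt (inChart X e) (fderiv ℝ (inChart X e) (e x)) ((e ∘ f.symm) (f x)) := by
    have : (e ∘ f.symm) (f x) = e x := by simp [hfx]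
    rw [this]; exact hd.hasFDerivAt
  have hcomp := (hd'.comp (f x) (hasFDerivAt_real hT)).congr_of_eventuallyEq heq
  set T := deriv (e ∘ f.symm) (f x) with hTdef
  set L := fderiv ℝ (inChart X e) (e x) with hL
  have hfd : ∀ h, fderiv ℝ (inChart X f) (f x) h = L (T * h) := by
    intro h
    rw [hcomp.fderiv]
    simp [T]
  have hLT : ∀ h : ℂ, L h = h.re • L 1 + h.im • L I := by
    intro h
    rw [← map_smul, ← map_smul, ← map_add]
    congr 1
    apply Complex.ext <;> simp
  refine ⟨T, ?_, ?_⟩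
  · intro h0
    have h1 := (norm_fderiv_of_isConformalMap
      (hX.conformal f (chart_mem_atlas ℂ x) (f x) hft)).1
    rw [hfd, h0] at h1
    simp at h1
  · funext i
    have hI : (T * I).re = -T.im ∧ (T * I).im = T.re := by simp
    simp only [phi, partialU, partialV, hfd, Pi.smul_apply, smul_eq_mul]
    rw [hLT (T * 1), hLT (T * I), hI.1, hI.2, mul_one, ← hL]
    simp only [PiLp.add_apply, PiLp.smul_apply, smul_eq_mul]
    apply Complex.ext
    · simp; ring
    · simp; ring

/-- The two components of the Gauss map are holomorphic, and the metric is given by the norms of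
lifts of these components. -/
lemma IsMinimalSurface.hasLiftPairs [IsManifold 𝓘(ℂ) ω S] (hX : IsMinimalSurface X) :
    HasLiftPairs X (gauss₁ X) (gauss₂ X) := by
  intro p
  set e := chartAt ℂ p with he
  set z₀ := e p with hz₀
  have hz₀t : z₀ ∈ e.target := mem_chart_target ℂ p
  have hconf : ∀ z ∈ e.target, IsConformalMap (fderiv ℝ (inChart X e) z) :=
    hX.conformal e (chart_mem_atlas ℂ p)
  have hφ := hX.analyticAt_phi p
  obtain ⟨a, b, ha, hb, ha0, hb0, hev⟩ := exists_factorization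
    (A := fun z => phi X e z 0 - I * phi X e z 1) (B := fun z => phi X e z 0 + I * phi X e z 1)
    (C := fun z => phi X e z 2 + I * phi X e z 3) (D := fun z => -phi X e z 2 + I * phi X e z 3)
    ((hφ 0).sub (analyticAt_const.mul (hφ 1))) ((hφ 0).add (analyticAt_const.mul (hφ 1)))
    ((hφ 2).add (analyticAt_const.mul (hφ 3))) ((hφ 2).neg.add (analyticAt_const.mul (hφ 3)))
    (by filter_upwards [e.open_target.mem_nhds hz₀t] with z hz using (sum_phi_sq (hconf z hz)).1)
    (by
      by_contra! h
      obtain ⟨h1, h2, h3, h4⟩ := h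
      have h5 := (sum_phi_sq (hconf z₀ hz₀t)).2
      rw [h1, h2, h3, h4] at h5
      have h6 := (norm_fderiv_of_isConformalMap (hconf z₀ hz₀t)).1
      have : 0 < ‖partialU X e z₀‖ := h6
      simp at h5
      have := pow_pos this 2
      linarith)
  have hnear : ∀ᶠ z in 𝓝 z₀, z ∈ e.target ∧ a z ≠ 0 ∧ b z ≠ 0 ∧
      DifferentiableAt ℝ (inChart X e) z := by
    filter_upwards [e.open_target.mem_nhds hz₀t, ha.continuousAt.eventually_ne ha0,
      hb.continuousAt.eventually_ne hb0, hX.contDiffAt p (n := 1)] with z h1 h2 h3 h4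
      using ⟨h1, h2, h3, h4.differentiableAt (by norm_num)⟩
  have hG : ∀ᶠ z in 𝓝 z₀, gaussMap X (e.symm z) = (ratio (a z).2 (a z).1, ratio (b z).2 (b z).1) := by
    filter_upwards [hev, hnear] with z ⟨hA, hB, hC, hD⟩ ⟨hzt, haz, hbz, hdz⟩
    have hsrc := e.map_target hzt
    obtain ⟨c, hc, hphi⟩ := hX.phi_eq_smul (p := p) (x := e.symm z) hsrc
      (by rw [← he, e.right_inv hzt]; exact hdz)
    rw [← he, e.right_inv hzt] at hphi
    rw [gaussMap, hphi, quadricToSpheres_eq (a := c • a z) (b := b z) (smul_ne_zero hc haz) hbz]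
    · refine Prod.ext ?_ rfl
      simp only [Prod.smul_fst, Prod.smul_snd, smul_eq_mul]
      rw [mul_comm c, mul_comm c, ratio_mul_right hc]
    · simp only [Pi.smul_apply, Prod.smul_fst, smul_eq_mul]
      linear_combination c * hA
    · simp only [Pi.smul_apply, Prod.smul_snd, smul_eq_mul]
      linear_combination c * hB
    · simp only [Pi.smul_apply, Prod.smul_snd, smul_eq_mul]
      linear_combination c * hC
    · simp only [Pi.smul_apply, Prod.smul_fst, smul_eq_mul]
      linear_combination c * hD
  have hl : ∀ᶠ z in 𝓝 z₀, ConfAt (X ∘ e.symm)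
      (Real.log (nsq (a z)) / 2 + Real.log (nsq (b z)) / 2) z := by
    filter_upwards [hev, hnear] with z ⟨hA, hB, hC, hD⟩ ⟨hzt, haz, hbz, hdz⟩
    obtain ⟨hpos, hn, -⟩ := norm_fderiv_of_isConformalMap (hconf z hzt)
    refine ⟨hdz, fun h => ?_⟩
    change ‖fderiv ℝ (inChart X e) z h‖ = _
    rw [hn]
    congr 1
    have hsum := (sum_phi_sq (hconf z hzt)).2
    rw [hA, hB, hC, hD] at hsum
    have hprod : ‖fderiv ℝ (inChart X e) z 1‖ ^ 2 = nsq (a z) * nsq (b z) := by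
      have : ‖fderiv ℝ (inChart X e) z 1‖ = ‖partialU X e z‖ := rfl
      rw [this, ← hsum]
      simp only [norm_mul, nsq]
      ring
    have ha' := nsq_pos haz
    have hb' := nsq_pos hbz
    rw [← Real.exp_log hpos]
    congr 1
    have := congrArg Real.log hprod
    rw [Real.log_pow, Real.log_mul ha'.ne' hb'.ne'] at this
    push_cast at this
    linarith
  refine ⟨a, b, fun z => Real.log (nsq (a z)) / 2 + Real.log (nsq (b z)) / 2,
    ⟨hz₀t, ⟨ha, ha0, ?_⟩, hl⟩, ⟨hz₀t, ⟨hb, hb0, ?_⟩, hl⟩, fun _ => rfl⟩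
  · filter_upwards [hG, hnear] with z h1 h2
    change ∃ c : ℂ, c ≠ 0 ∧ a z = c • rep (gaussMap X (e.symm z)).1
    rw [h1]
    exact exists_eq_smul_rep_ratio h2.2.1
  · filter_upwards [hG, hnear] with z h1 h2
    change ∃ c : ℂ, c ≠ 0 ∧ b z = c • rep (gaussMap X (e.symm z)).2
    rw [h1]
    exact exists_eq_smul_rep_ratio h2.2.2.1

lemma HasLiftPairs.fst {g₁ g₂ : S → OnePoint ℂ} (h : HasLiftPairs X g₁ g₂) : HasLifts g₁ :=
  fun p => let ⟨a, _, _, ha, _⟩ := h p; ⟨a, ha.lift⟩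

lemma HasLiftPairs.snd {g₁ g₂ : S → OnePoint ℂ} (h : HasLiftPairs X g₁ g₂) : HasLifts g₂ :=
  fun p => let ⟨_, b, _, _, hb, _⟩ := h p; ⟨b, hb.lift⟩

lemma HasLifts.comp [IsManifold 𝓘(ℂ) ω S] {S' : Type*} [TopologicalSpace S'] [ChartedSpace ℂ S']
    [IsManifold 𝓘(ℂ) ω S'] {g : S' → OnePoint ℂ} (hg : HasLifts g) {Ψ : S → S'}
    (hΨ : ContMDiff 𝓘(ℂ) 𝓘(ℂ) ω Ψ) : HasLifts (g ∘ Ψ) := by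
  intro p
  obtain ⟨a, ha⟩ := hg (Ψ p)
  set e := chartAt ℂ p with he
  set f := chartAt ℂ (Ψ p) with hf
  have hep : e.symm (e p) = p := e.left_inv (mem_chart_source ℂ p)
  have hΨe : ContMDiffAt 𝓘(ℂ) 𝓘(ℂ) ω (Ψ ∘ e.symm) (e p) :=
    (hΨ _).comp (e p) (contMDiffAt_chart_symm_comp (f := id) analyticAt_id (mem_chart_target ℂ p))
  have hsrc : (Ψ ∘ e.symm) (e p) ∈ f.source := by
    rw [Function.comp_apply, hep]; exact mem_chart_source ℂ _
  have hT : AnalyticAt ℂ (f ∘ (Ψ ∘ e.symm)) (e p) := analyticAt_chart_comp hΨe hsrc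
  have hval : (f ∘ (Ψ ∘ e.symm)) (e p) = f (Ψ p) := by simp [hep]
  refine ⟨_, (IsLift.comp (f := f ∘ (Ψ ∘ e.symm)) (by rw [hval]; exact ha) hT).congr ?_⟩
  exact (comp_eventuallyEq_chart g
    (hΨe.continuousAt.eventually (f.open_source.mem_nhds hsrc))).symm

end Surface

/-! ### The choice of the weights -/

/-- The weights `Q = 4 + (n - 4) / x`, with `x` slightly smaller than `x₀ > 1`, lie between `4` and
`n`, and their orders of vanishing stay away from zero while `1 - x / x₀` tends to zero. -/
lemma eventually_weight {n x₀ : ℝ} (hn : 4 < n) (hx₀ : 1 < x₀) :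
    ∀ᶠ x in 𝓝[<] x₀, 1 < x ∧ x < x₀ ∧ 1 - x / x₀ ≤
      x / (n - 4) * min (1 - (4 + (n - 4) / x) / n) (1 / ((4 + (n - 4) / x) - 2)) := by
  have hn4 : 0 < n - 4 := by linarith
  have hx₀' : x₀ ≠ 0 := by linarith
  have hQ : 4 + (n - 4) / x₀ - 2 ≠ 0 := by
    have : 0 < (n - 4) / x₀ := by positivity
    linarith
  have hn0 : n ≠ 0 := by linarith
  have hc : ContinuousAt (fun x => x / (n - 4) *
      min (1 - (4 + (n - 4) / x) / n) (1 / ((4 + (n - 4) / x) - 2)) - (1 - x / x₀)) x₀ := by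
    have h1 : ContinuousAt (fun x : ℝ => (n - 4) / x) x₀ := continuousAt_const.div continuousAt_id hx₀'
    have h2 : ContinuousAt (fun x : ℝ => 1 / (4 + (n - 4) / x - 2)) x₀ :=
      continuousAt_const.div ((continuousAt_const.add h1).sub continuousAt_const) hQ
    have h3 : ContinuousAt (fun x : ℝ => 1 - (4 + (n - 4) / x) / n) x₀ :=
      continuousAt_const.sub ((continuousAt_const.add h1).div_const n)
    exact ((continuousAt_id.div_const _).mul (h3.min h2)).sub
      (continuousAt_const.sub (continuousAt_id.div_const _))
  have hpos : 0 < x₀ / (n - 4) *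
      min (1 - (4 + (n - 4) / x₀) / n) (1 / ((4 + (n - 4) / x₀) - 2)) - (1 - x₀ / x₀) := by
    rw [div_self hx₀', sub_self, sub_zero]
    refine mul_pos (by positivity) (lt_min ?_ ?_)
    · rw [sub_pos, div_lt_one (by linarith)]
      have : (n - 4) / x₀ < n - 4 := div_lt_self hn4 hx₀
      linarith
    · have : 0 < (n - 4) / x₀ := by positivity
      apply one_div_pos.2
      linarith
  filter_upwards [self_mem_nhdsWithin, nhdsWithin_le_nhds (lt_mem_nhds hx₀),
    nhdsWithin_le_nhds (hc.eventually (lt_mem_nhds hpos))] with x h1 h2 h3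
  exact ⟨h2, h1, by linarith⟩

lemma weight_mem {n x : ℝ} (hn : 4 < n) (hx : 1 < x) :
    4 < 4 + (n - 4) / x ∧ 4 + (n - 4) / x < n := by
  have h1 : 0 < (n - 4) / x := div_pos (by linarith) (by linarith)
  have h2 : (n - 4) / x < n - 4 := div_lt_self (by linarith) hx
  constructor <;> linarith

/-! ### Surfaces whose Gauss maps share values -/

section Surface

variable {S : Type*} [TopologicalSpace S] [ChartedSpace ℂ S] [T2Space S] [ConnectedSpace S]
  [IsManifold 𝓘(ℂ) ω S] {X : S → E4} {g₁ g₂ gh₁ gh₂ : S → OnePoint ℂ}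
  {V₁ V₂ : Finset (OnePoint ℂ)}

lemma not_isCompleteSurface_of_shares_of_shares (hX : HasLiftPairs X g₁ g₂) (hh₁ : HasLifts gh₁)
    (hh₂ : HasLifts gh₂) (c₁ : ¬ IsConst g₁) (c₂ : ¬ IsConst g₂) (d₁ : ¬ IsConst gh₁)
    (d₂ : ¬ IsConst gh₂) (hV₁ : Shares V₁ g₁ gh₁) (hV₂ : Shares V₂ g₂ gh₂) (ne₁ : g₁ ≠ gh₁)
    (ne₂ : g₂ ≠ gh₂) (h₁ : (4 : ℝ) < V₁.card) (h₂ : (4 : ℝ) < V₂.card)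
    (hsum : 1 / ((V₁.card : ℝ) - 4) + 1 / ((V₂.card : ℝ) - 4) < 1) : ¬ IsCompleteSurface X := by
  set n₁ : ℝ := (V₁.card : ℝ)
  set n₂ : ℝ := (V₂.card : ℝ)
  have hn₁ : 0 < n₁ - 4 := by linarith
  have hn₂ : 0 < n₂ - 4 := by linarith
  -- for weights belonging to `x`, the exponent of `IsBlock.combine` is `x / x₀`
  set x₀ := (1 / (n₁ - 4) + 1 / (n₂ - 4))⁻¹ with hx₀
  have hs0 : 0 < 1 / (n₁ - 4) + 1 / (n₂ - 4) := by positivity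
  have hx₀1 : 1 < x₀ := (one_lt_inv₀ hs0).2 hsum
  obtain ⟨x, ⟨hx1, hxx, hw₁⟩, -, -, hw₂⟩ :=
    ((eventually_weight h₁ hx₀1).and (eventually_weight h₂ hx₀1)).exists
  have hx0 : 0 < x := by linarith
  obtain ⟨hQ₁, hQ₁'⟩ := weight_mem h₁ hx1
  obtain ⟨hQ₂, hQ₂'⟩ := weight_mem h₂ hx1
  obtain ⟨t₁, r₁, b₁, hb₁, H₁⟩ := exists_isBlock X hX.fst hh₁ c₁ d₁ hV₁ hQ₁ hQ₁'
  obtain ⟨t₂, r₂, b₂, hb₂, H₂⟩ := exists_isBlock X hX.snd hh₂ c₂ d₂ hV₂ hQ₂ hQ₂'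
  have hk : ∀ m : ℝ, 1 / (4 + (m - 4) / x - 4) = x / (m - 4) := fun m => by
    rw [add_sub_cancel_left, one_div_div]
  have hp : x / x₀ = 1 / (4 + (n₁ - 4) / x - 4) + 1 / (4 + (n₂ - 4) / x - 4) := by
    rw [hk, hk, hx₀, div_inv_eq_mul]; ring
  have he : ∀ {m : ℝ}, 4 < 4 + (m - 4) / x → 4 + (m - 4) / x < m →
      0 ≤ min (1 - (4 + (m - 4) / x) / m) (1 / (4 + (m - 4) / x - 2)) := by
    intro m hQ hQ'
    refine le_min ?_ ?_
    · rw [sub_nonneg, div_le_one (by linarith)]; exact hQ'.le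
    · apply one_div_nonneg.2; linarith
  have H := H₁.combine hX H₂ (by linarith) (by linarith) (he hQ₁ hQ₁') (he hQ₂ hQ₂') hb₁ hb₂ hp
    (by rw [hk]; exact hw₁) (by rw [hk]; exact hw₂)
  obtain ⟨q⟩ : Nonempty S := inferInstance
  obtain ⟨a, b, l, ha, hb, -⟩ := hX q
  obtain ⟨a', ha'⟩ := hh₁ q
  obtain ⟨b', hb'⟩ := hh₂ q
  obtain ⟨z, hz₁, hz₂⟩ := ((eventually_nhdsNE_notMem_singSet hX.fst hh₁ ne₁ c₁ d₁ ha
    ⟨ha.mem, ha', ha.conf⟩).and (eventually_nhdsNE_notMem_singSet hX.snd hh₂ ne₂ c₂ d₂ hb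
    ⟨hb.mem, hb', hb.conf⟩)).exists
  exact H.not_isCompleteSurface (lt_min hb₁ hb₂) (by positivity)
    ((div_lt_one (by linarith)).2 hxx) (x₀ := (chartAt ℂ q).symm z) fun h => h.elim hz₁ hz₂

lemma not_isCompleteSurface_of_shares_of_isConst (hX : HasLiftPairs X g₁ g₂) (hh₁ : HasLifts gh₁)
    (c₁ : ¬ IsConst g₁) (d₁ : ¬ IsConst gh₁) (c₂ : IsConst g₂) (hV₁ : Shares V₁ g₁ gh₁)
    (ne₁ : g₁ ≠ gh₁) (h₁ : (5 : ℝ) < V₁.card) : ¬ IsCompleteSurface X := by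
  set n₁ : ℝ := (V₁.card : ℝ)
  have hn₁ : 0 < n₁ - 4 := by linarith
  have h₁' : 4 < n₁ := by linarith
  obtain ⟨x, hx1, hxx, hw₁⟩ := (eventually_weight (x₀ := n₁ - 4) h₁' (by linarith)).exists
  have hx0 : 0 < x := by linarith
  obtain ⟨hQ₁, hQ₁'⟩ := weight_mem h₁' hx1
  obtain ⟨t₁, r₁, b₁, hb₁, H₁⟩ := exists_isBlock X hX.fst hh₁ c₁ d₁ hV₁ hQ₁ hQ₁'
  have hk : x / (n₁ - 4) = 1 / (4 + (n₁ - 4) / x - 4) := by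
    rw [add_sub_cancel_left, one_div_div]
  have H := H₁.single hX c₂ (by linarith) hk hw₁
  obtain ⟨q⟩ : Nonempty S := inferInstance
  obtain ⟨a, b, l, ha, hb, -⟩ := hX q
  obtain ⟨a', ha'⟩ := hh₁ q
  obtain ⟨z, hz₁⟩ := (eventually_nhdsNE_notMem_singSet hX.fst hh₁ ne₁ c₁ d₁ ha
    ⟨ha.mem, ha', ha.conf⟩).exists
  exact H.not_isCompleteSurface hb₁ (by positivity) ((div_lt_one (by linarith)).2 hxx) hz₁

end Surface

lemma IsConst.of_comp {A B C : Type*} {f : A → B} {g : B → C} (hf : Function.Surjective f)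
    (h : IsConst (g ∘ f)) : IsConst g := by
  obtain ⟨c, hc⟩ := h
  refine ⟨c, fun b => ?_⟩
  obtain ⟨a, rfl⟩ := hf b
  exact hc a

lemma ShareValues.exists_shares {S : Type*} {g gh : S → OnePoint ℂ} {p : ℕ}
    (h : ShareValues g gh p) : ∃ V : Finset (OnePoint ℂ), V.card = p ∧ Shares V g gh := by
  obtain ⟨V, hV, h⟩ := h
  exact ⟨V, hV, fun v hv x => Set.ext_iff.1 (h v hv) x⟩

section Equiv

variable {S S' : Type*} {g : S → OnePoint ℂ} {g' : S' → OnePoint ℂ} (Ψ : S ≃ S')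

lemma Shares.symm {V : Finset (OnePoint ℂ)} (h : Shares V g (g' ∘ Ψ)) :
    Shares V g' (g ∘ Ψ.symm) := by
  intro v hv x
  simpa using (h v hv (Ψ.symm x)).symm

lemma ne_comp_symm (h : g ≠ g' ∘ Ψ) : g' ≠ g ∘ Ψ.symm := by
  rintro rfl
  exact h (funext fun x => by simp)

end Equiv

section Pair

variable {S : Type*} [TopologicalSpace S] [T2Space S] [ConnectedSpace S]
    [ChartedSpace ℂ S] [IsManifold 𝓘(ℂ) ω S]
    {S' : Type*} [TopologicalSpace S'] [T2Space S'] [ConnectedSpace S']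
    [ChartedSpace ℂ S'] [IsManifold 𝓘(ℂ) ω S'] {X : S → E4} {X' : S' → E4}

/-- The case of two nonconstant components. -/
lemma one_le_of_shareValues (hX : IsMinimalSurface X) (hX' : IsMinimalSurface X')
    (Ψ : S ≃ₘ^ω⟮𝓘(ℂ), 𝓘(ℂ)⟯ S') (hcomplete : IsCompleteSurface X ∨ IsCompleteSurface X')
    (c₁ : ¬ IsConst (gauss₁ X)) (c₂ : ¬ IsConst (gauss₂ X))
    (d₁ : ¬ IsConst (gauss₁ X')) (d₂ : ¬ IsConst (gauss₂ X')) {p₁ p₂ : ℕ} (h₁ : 4 < p₁)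
    (h₂ : 4 < p₂) (s₁ : ShareValues (gauss₁ X) (gauss₁ X' ∘ Ψ) p₁)
    (s₂ : ShareValues (gauss₂ X) (gauss₂ X' ∘ Ψ) p₂) (ne₁ : gauss₁ X ≠ gauss₁ X' ∘ Ψ)
    (ne₂ : gauss₂ X ≠ gauss₂ X' ∘ Ψ) : 1 / ((p₁ : ℝ) - 4) + 1 / ((p₂ : ℝ) - 4) ≥ 1 := by
  obtain ⟨V₁, rfl, hV₁⟩ := s₁.exists_shares
  obtain ⟨V₂, rfl, hV₂⟩ := s₂.exists_shares
  have h₁' : (4 : ℝ) < V₁.card := by exact_mod_cast h₁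
  have h₂' : (4 : ℝ) < V₂.card := by exact_mod_cast h₂
  by_contra! hsum
  have sj := Ψ.toEquiv.surjective
  have sj' := Ψ.symm.toEquiv.surjective
  rcases hcomplete with h | h
  · exact not_isCompleteSurface_of_shares_of_shares hX.hasLiftPairs
      (hX'.hasLiftPairs.fst.comp Ψ.contMDiff) (hX'.hasLiftPairs.snd.comp Ψ.contMDiff) c₁ c₂
      (fun k => d₁ (k.of_comp sj)) (fun k => d₂ (k.of_comp sj)) hV₁ hV₂ ne₁ ne₂ h₁' h₂' hsum h
  · exact not_isCompleteSurface_of_shares_of_shares hX'.hasLiftPairs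
      (hX.hasLiftPairs.fst.comp Ψ.symm.contMDiff) (hX.hasLiftPairs.snd.comp Ψ.symm.contMDiff) d₁ d₂
      (fun k => c₁ (k.of_comp sj')) (fun k => c₂ (k.of_comp sj')) (hV₁.symm Ψ.toEquiv)
      (hV₂.symm Ψ.toEquiv) (ne_comp_symm Ψ.toEquiv ne₁) (ne_comp_symm Ψ.toEquiv ne₂) h₁' h₂' hsum h

/-- The case of a constant second component. -/
lemma le_five_of_shareValues (hX : IsMinimalSurface X) (hX' : IsMinimalSurface X')
    (Ψ : S ≃ₘ^ω⟮𝓘(ℂ), 𝓘(ℂ)⟯ S') (hcomplete : IsCompleteSurface X ∨ IsCompleteSurface X')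
    (c₁ : ¬ IsConst (gauss₁ X)) (d₁ : ¬ IsConst (gauss₁ X')) {p : ℕ}
    (s₁ : ShareValues (gauss₁ X) (gauss₁ X' ∘ Ψ) p) (he : gauss₂ X = gauss₂ X' ∘ Ψ)
    (c₂ : IsConst (gauss₂ X)) (ne₁ : gauss₁ X ≠ gauss₁ X' ∘ Ψ) : p ≤ 5 := by
  obtain ⟨V₁, rfl, hV₁⟩ := s₁.exists_shares
  by_contra! hp
  have h₁' : (5 : ℝ) < V₁.card := by exact_mod_cast hp
  have sj := Ψ.toEquiv.surjective
  have sj' := Ψ.symm.toEquiv.surjective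
  rcases hcomplete with h | h
  · exact not_isCompleteSurface_of_shares_of_isConst hX.hasLiftPairs
      (hX'.hasLiftPairs.fst.comp Ψ.contMDiff) c₁ (fun k => d₁ (k.of_comp sj)) c₂ hV₁ ne₁ h₁' h
  · have c₂' : IsConst (gauss₂ X') := IsConst.of_comp sj (he ▸ c₂)
    exact not_isCompleteSurface_of_shares_of_isConst hX'.hasLiftPairs
      (hX.hasLiftPairs.fst.comp Ψ.symm.contMDiff) d₁ (fun k => c₁ (k.of_comp sj')) c₂'
      (hV₁.symm Ψ.toEquiv) (ne_comp_symm Ψ.toEquiv ne₁) h₁' h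

end Pair

end MinimalSurface

end

open MinimalSurface in
theorem theorem1p2
    {S : Type*} [TopologicalSpace S] [T2Space S] [ConnectedSpace S]
    [ChartedSpace ℂ S] [IsManifold 𝓘(ℂ) ω S]
    {S' : Type*} [TopologicalSpace S'] [T2Space S'] [ConnectedSpace S']
    [ChartedSpace ℂ S'] [IsManifold 𝓘(ℂ) ω S']
    (X : S → E4) (hX : IsMinimalSurface X) (hXflat : ¬ IsFlat X)
    (X' : S' → E4) (hX' : IsMinimalSurface X') (hX'flat : ¬ IsFlat X')
    (Ψ : S ≃ₘ^ω⟮𝓘(ℂ), 𝓘(ℂ)⟯ S')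
    (hcomplete : IsCompleteSurface X ∨ IsCompleteSurface X') :
    (¬ IsConst (gauss₁ X) → ¬ IsConst (gauss₂ X) →
      ¬ IsConst (gauss₁ X') → ¬ IsConst (gauss₂ X') →
      ∀ p₁ p₂ : ℕ, 4 < p₁ → 4 < p₂ →
      ShareValues (gauss₁ X) (gauss₁ X' ∘ Ψ) p₁ →
      ShareValues (gauss₂ X) (gauss₂ X' ∘ Ψ) p₂ →
      (gauss₁ X ≠ gauss₁ X' ∘ Ψ → gauss₂ X ≠ gauss₂ X' ∘ Ψ →
        1 / ((p₁ : ℝ) - 4) + 1 / ((p₂ : ℝ) - 4) ≥ 1) ∧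
      (7 ≤ p₁ → 7 ≤ p₂ →
        gauss₁ X = gauss₁ X' ∘ Ψ ∨ gauss₂ X = gauss₂ X' ∘ Ψ)) ∧
    (¬ IsConst (gauss₁ X) → ¬ IsConst (gauss₁ X') →
      ∀ p : ℕ, ShareValues (gauss₁ X) (gauss₁ X' ∘ Ψ) p →
      gauss₂ X = gauss₂ X' ∘ Ψ → IsConst (gauss₂ X) →
      (gauss₁ X ≠ gauss₁ X' ∘ Ψ → p ≤ 5) ∧
      (6 ≤ p → gaussMap X = gaussMap X' ∘ Ψ)) := by
  refine ⟨fun c₁ c₂ d₁ d₂ p₁ p₂ h₁ h₂ s₁ s₂ => ?_, fun c₁ d₁ p s₁ he c₂ => ?_⟩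
  · have key := one_le_of_shareValues hX hX' Ψ hcomplete c₁ c₂ d₁ d₂ h₁ h₂ s₁ s₂
    refine ⟨key, fun k₁ k₂ => ?_⟩
    by_contra! hne
    have h := key hne.1 hne.2
    have e : ∀ {m : ℕ}, 7 ≤ m → 1 / ((m : ℝ) - 4) ≤ 1 / 3 := fun {m} hm => by
      have : (7 : ℝ) ≤ m := by exact_mod_cast hm
      exact one_div_le_one_div_of_le (by norm_num) (by linarith)
    linarith [e k₁, e k₂]
  · have key := le_five_of_shareValues hX hX' Ψ hcomplete c₁ d₁ s₁ he c₂
    refine ⟨key, fun hp => funext fun x => Prod.ext ?_ (congrFun he x)⟩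
    by_contra hne
    have := key fun h => hne (congrFun h x)
    omega
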